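/- Let $D$ be the closed unit disc with a set $F$ of $2n$ marked points on its boundary circle, numbered $0,1,\dots,2n-1$ in cyclic order; points with even label are called incoming, points with odd label outgoing. A *string diagram* on $(D,F)$ consists of $n$ oriented arcs (continuous curves) in $D$ joining the incoming points bijectively to the outgoing points, together with finitely many oriented closed curves in $D$; the curves may intersect themselves and each other. Two string diagrams are homotopic rel boundary if their arcs are homotopic rel endpoints and their closed curves can be matched so that corresponding ones are freely homotopic. Let $CS(D,F)$ be the $\mathbb{Z}_2$-vector space generated by homotopy classes rel boundary of string diagrams, where a diagram with a contractible closed curve is set equal to $0$. A *crossing* of a string diagram is an unordered pair of distinct points of the underlying one-manifold with the same image in $D$. A diagram is *generic* if it has finitely many crossings, at each of which the two strands are differentiable with linearly independent velocities. (More than two strands may pass through a point; each pair of them is a crossing.) *Resolving* a crossing replaces it so that each strand running into the crossing leaves it along the other strand, respecting orientations. A *chord diagram* with $n$ chords is a collection of $n$ pairwise disjoint arcs in $D$ joining the points of $F$ in pairs, up to isotopy rel boundary; equivalently, a non-crossing perfect matching of $F$. Three chord diagrams $\Gamma,\Gamma',\Gamma''$ are related by bypass surgeries if there are marked points $p_0<p_1<\dots<p_5$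 such that $\Gamma$ contains the chords $p_0p_1,\,p_2p_5,\,p_3p_4$; $\Gamma'$ contains $p_1p_2,\,p_0p_3,\,p_4p_5$; $\Gamma''$ contains $p_2p_3,\,p_1p_4,\,p_0p_5$; and all their other chords coincide. Let $$V_n=\frac{\mathbb{Z}_2\langle\text{chord diagrams with } n \text{ chords}\rangle}{\langle\,\Gamma+\Gamma'+\Gamma''\;:\;\Gamma,\Gamma',\Gamma''\text{ related by bypass surgeries}\,\rangle}.$$ **Theorem.** There is a unique $\mathbb{Z}_2$-linear map $\partial\colon CS(D,F)\to CS(D,F)$ such that, for every generic string diagram $s$, $\partial[s]$ is the sum over all crossings of $s$ of the classes of the string diagrams obtained by resolving that crossing. It satisfies $\partial^2=0$, and its homology $HS=\ker\partial/\operatorname{im}\partial$ is isomorphic, as a $\mathbb{Z}_2$-vector space, to $V_n$. -/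

import Mathlib

noncomputable section

namespace StringHomology

open unitInterval

/-! ### Marked discs and string diagrams -/

/-- The closed unit disc. -/
abbrev Disc : Type := Metric.closedBall (0 : ℂ) 1

/-- A disc with `2n` marked points on its boundary circle, listed in anticlockwise order by their
angles. -/
structure MarkedDisc (n : ℕ) where
  /-- the angle of the `k`-th marked point -/
  angle : Fin (2 * n) → ℝ
  strictMono_angle : StrictMono angle
  angle_lt : ∀ k l, angle k < angle l + 2 * Real.pi

variable {n : ℕ}

namespace MarkedDisc

/-- The `k`-th marked point. -/
def point (M : MarkedDisc n) (k : Fin (2 * n)) : Disc :=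
  ⟨Complex.exp (M.angle k * Complex.I), by
    simp [Complex.norm_exp_ofReal_mul_I]⟩

/-- The points with even label, at which strings enter the disc. -/
def inPoint (M : MarkedDisc n) (i : Fin n) : Disc :=
  M.point ⟨2 * i, by omega⟩

/-- The points with odd label, at which strings leave the disc. -/
def outPoint (M : MarkedDisc n) (i : Fin n) : Disc :=
  M.point ⟨2 * i + 1, by omega⟩

end MarkedDisc

/-- A string diagram: `n` oriented arcs in the disc, joining the incoming marked points to the
outgoing ones in some bijective way, together with finitely many oriented closed curves. The
curves may intersect themselves and each other. -/
structure StringDiagram (M : MarkedDisc n) where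
  /-- the arc that starts at the `i`-th incoming point ends at outgoing point `target i` -/
  target : Equiv.Perm (Fin n)
  /-- the arcs -/
  arc : Fin n → C(I, Disc)
  arc_zero : ∀ i, arc i 0 = M.inPoint i
  arc_one : ∀ i, arc i 1 = M.outPoint (target i)
  /-- the closed curves -/
  loops : List C(UnitAddCircle, Disc)

variable {M : MarkedDisc n}

/-- Homotopy of string diagrams relative to the boundary: the arcs are homotopic relative to their
endpoints, and the closed curves can be matched up so that corresponding ones are freely
homotopic. -/
def StringDiagram.Homotopic (s t : StringDiagram M) : Prop :=
  (∀ i, (s.arc i).HomotopicRel (t.arc i) {0, 1}) ∧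
    Multiset.Rel ContinuousMap.Homotopic (s.loops : Multiset C(UnitAddCircle, Disc)) t.loops

/-- String diagrams up to homotopy relative to the boundary. -/
instance homotopySetoid (M : MarkedDisc n) : Setoid (StringDiagram M) where
  r := StringDiagram.Homotopic
  iseqv :=
    { refl := fun _ => ⟨fun _ => ContinuousMap.HomotopicRel.refl _,
        Multiset.rel_refl_of_refl_on fun x _ => ContinuousMap.Homotopic.refl x⟩
      symm := fun h => ⟨fun i => (h.1 i).symm,
        Multiset.rel_flip.1 (h.2.mono fun _ _ _ _ hab => hab.symm)⟩
      trans := fun h h' => ⟨fun i => (h.1 i).trans (h'.1 i),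
        haveI : IsTrans C(UnitAddCircle, Disc) ContinuousMap.Homotopic :=
          ⟨fun _ _ _ hab hbc => hab.trans hbc⟩
        Multiset.Rel.trans _ h.2 h'.2⟩ }

/-! ### Crossings and their resolution -/

/-- The restriction of `f` to the parameters from `u` to `v`, as a path. -/
def track (f : C(ℝ, Disc)) (u v : ℝ) : Path (f u) (f v) where
  toFun r := f (u + r * (v - u))
  continuous_toFun := by fun_prop
  source' := by simp
  target' := by simp

/-- The closed curve obtained from a path that returns to its starting point. -/
def closeUp {x : Disc} (γ : Path x x) : C(UnitAddCircle, Disc) :=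
  ⟨AddCircle.liftIco 1 0 γ.extend,
    AddCircle.liftIco_zero_continuous (by simp) γ.continuous_extend.continuousOn⟩

/-- Follow `f` from parameter `0` to parameter `u`, then `g` from parameter `v` to `1`. -/
def switchTrack (f g : C(ℝ, Disc)) (u v : ℝ) (h : f u = g v) : Path (f 0) (g 1) :=
  (track f 0 u).trans ((track g v 1).cast h rfl)

/-- `f` and `g` have linearly independent velocities at the parameters `u` and `v`. -/
def TransverseAt (f g : C(ℝ, Disc)) (u v : ℝ) : Prop :=
  ∃ a b : ℂ, HasDerivAt (fun t => (f t : ℂ)) a u ∧ HasDerivAt (fun t => (g t : ℂ)) b v ∧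
    LinearIndependent ℝ ![a, b]

namespace StringDiagram

/-- The `i`-th arc, extended to all real parameters so as to be constant outside `[0, 1]`. -/
def arcCurve (s : StringDiagram M) (i : Fin n) : C(ℝ, Disc) :=
  (s.arc i).comp ⟨Set.projIcc 0 1 zero_le_one, continuous_projIcc⟩

/-- The `k`-th closed curve, as a `1`-periodic function of a real parameter. -/
def loopCurve (s : StringDiagram M) (k : Fin s.loops.length) : C(ℝ, Disc) :=
  ⟨fun t => s.loops.get k (t : UnitAddCircle),
    (s.loops.get k).continuous.comp (AddCircle.continuous_mk' 1)⟩

theorem arcCurve_zero (s : StringDiagram M) (i : Fin n) : s.arcCurve i 0 = M.inPoint i := by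
  simp [arcCurve, ← s.arc_zero i]

theorem arcCurve_one (s : StringDiagram M) (i : Fin n) :
    s.arcCurve i 1 = M.outPoint (s.target i) := by
  simp [arcCurve, ← s.arc_one i]

theorem loopCurve_add_one (s : StringDiagram M) (k : Fin s.loops.length) (v : ℝ) :
    s.loopCurve k (v + 1) = s.loopCurve k v :=
  congrArg (s.loops.get k) (AddCircle.coe_add_period 1 v)

/-- The crossings of a string diagram: unordered pairs of distinct points of the underlying
one-manifold that have the same image in the disc. The two strands that cross may belong to
different components or to the same one, and each component is an arc or a closed curve. -/
inductive Crossing (s : StringDiagram M) : Type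
  /-- two different arcs -/
  | arcArc (i j : Fin n) (u v : ℝ) (hij : i < j) (hu : u ∈ Set.Icc (0 : ℝ) 1)
      (hv : v ∈ Set.Icc (0 : ℝ) 1) (h : s.arcCurve i u = s.arcCurve j v)
  /-- an arc and itself -/
  | arcSelf (i : Fin n) (u v : ℝ) (hu : 0 ≤ u) (huv : u < v) (hv : v ≤ 1)
      (h : s.arcCurve i u = s.arcCurve i v)
  /-- an arc and a closed curve -/
  | arcLoop (i : Fin n) (k : Fin s.loops.length) (u v : ℝ) (hu : u ∈ Set.Icc (0 : ℝ) 1)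
      (hv : v ∈ Set.Ico (0 : ℝ) 1) (h : s.arcCurve i u = s.loopCurve k v)
  /-- two different closed curves -/
  | loopLoop (k l : Fin s.loops.length) (u v : ℝ) (hkl : k < l) (hu : u ∈ Set.Ico (0 : ℝ) 1)
      (hv : v ∈ Set.Ico (0 : ℝ) 1) (h : s.loopCurve k u = s.loopCurve l v)
  /-- a closed curve and itself -/
  | loopSelf (k : Fin s.loops.length) (u v : ℝ) (hu : 0 ≤ u) (huv : u < v) (hv : v < 1)
      (h : s.loopCurve k u = s.loopCurve k v)

namespace Crossing

/-- The two strands of the crossing cross transversely. At an endpoint of an arc this is never the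
case, because `arcCurve` is constant on one side of it. -/
def Transverse {s : StringDiagram M} : s.Crossing → Prop
  | arcArc i j u v _ _ _ _ => TransverseAt (s.arcCurve i) (s.arcCurve j) u v
  | arcSelf i u v _ _ _ _ => TransverseAt (s.arcCurve i) (s.arcCurve i) u v
  | arcLoop i k u v _ _ _ => TransverseAt (s.arcCurve i) (s.loopCurve k) u v
  | loopLoop k l u v _ _ _ _ => TransverseAt (s.loopCurve k) (s.loopCurve l) u v
  | loopSelf k u v _ _ _ _ => TransverseAt (s.loopCurve k) (s.loopCurve k) u v

/-- The string diagram obtained by resolving a crossing: each of the two strands that run into the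
crossing leaves it along the other strand, in the direction of the orientation. -/
def resolve {s : StringDiagram M} : s.Crossing → StringDiagram M
  -- the two arcs exchange their final parts
  | arcArc i j u v hij _ _ h =>
    { target := (Equiv.swap i j).trans s.target
      arc := Function.update (Function.update s.arc
          i (switchTrack (s.arcCurve i) (s.arcCurve j) u v h).toContinuousMap)
          j (switchTrack (s.arcCurve j) (s.arcCurve i) v u h.symm).toContinuousMap
      arc_zero := fun k => by
        by_cases hj : k = j
        · subst hj
          simp [arcCurve_zero]
        · by_cases hi : k = i
          · subst hi
            simp [hj, arcCurve_zero]
          · simp [hi, hj, s.arc_zero]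
      arc_one := fun k => by
        by_cases hj : k = j
        · subst hj
          simp [arcCurve_one]
        · by_cases hi : k = i
          · subst hi
            simp [hj, arcCurve_one]
          · simp [hi, hj, s.arc_one, Equiv.swap_apply_of_ne_of_ne]
      loops := s.loops }
  -- the part of the arc between the two parameters splits off as a closed curve
  | arcSelf i u v _ _ _ h =>
    { target := s.target
      arc := Function.update s.arc
        i (switchTrack (s.arcCurve i) (s.arcCurve i) u v h).toContinuousMap
      arc_zero := fun k => by
        by_cases hi : k = i
        · subst hi
          simp [arcCurve_zero]
        · simp [hi, s.arc_zero]
      arc_one := fun k => by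
        by_cases hi : k = i
        · subst hi
          simp [arcCurve_one]
        · simp [hi, s.arc_one]
      loops := closeUp ((track (s.arcCurve i) u v).cast rfl h) :: s.loops }
  -- the arc makes a detour once around the closed curve
  | arcLoop i k u v _ _ h =>
    { target := s.target
      arc := Function.update s.arc
        i (((track (s.arcCurve i) 0 u).trans
            ((track (s.loopCurve k) v (v + 1)).cast h
              (h.trans (s.loopCurve_add_one k v).symm))).trans
            (track (s.arcCurve i) u 1)).toContinuousMap
      arc_zero := fun k => by
        by_cases hi : k = i
        · subst hi
          simp [arcCurve_zero]
        · simp [hi, s.arc_zero]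
      arc_one := fun k => by
        by_cases hi : k = i
        · subst hi
          simp [arcCurve_one]
        · simp [hi, s.arc_one]
      loops := s.loops.eraseIdx k }
  -- the two closed curves merge into one
  | loopLoop k l u v _ _ _ h =>
    { target := s.target
      arc := s.arc
      arc_zero := s.arc_zero
      arc_one := s.arc_one
      loops := closeUp
          (((track (s.loopCurve k) u (u + 1)).cast rfl (s.loopCurve_add_one k u).symm).trans
            ((track (s.loopCurve l) v (v + 1)).cast h
              (h.trans (s.loopCurve_add_one l v).symm))) ::
        (s.loops.eraseIdx l).eraseIdx k }
  -- the closed curve splits into two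
  | loopSelf k u v _ _ _ h =>
    { target := s.target
      arc := s.arc
      arc_zero := s.arc_zero
      arc_one := s.arc_one
      loops := closeUp ((track (s.loopCurve k) u v).cast rfl h) ::
        closeUp ((track (s.loopCurve k) v (u + 1)).cast rfl
          (h.symm.trans (s.loopCurve_add_one k u).symm)) ::
        s.loops.eraseIdx k }

end Crossing

/-- A string diagram is generic if it has finitely many crossings and all of them are transverse.
(Three or more strands may pass through the same point; each pair of them counts as one
crossing.) -/
def IsGeneric (s : StringDiagram M) : Prop :=
  Finite s.Crossing ∧ ∀ c : s.Crossing, c.Transverse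

/-- Some closed curve of the diagram is contractible. -/
def HasContractibleLoop (s : StringDiagram M) : Prop :=
  ∃ ℓ ∈ s.loops, ℓ.Nullhomotopic

end StringDiagram

/-! ### The string complex and its homology -/

/-- The relations that set every string diagram with a contractible closed curve equal to zero. -/
def contractibleRelations (M : MarkedDisc n) :
    Submodule (ZMod 2) (Quotient (homotopySetoid M) →₀ ZMod 2) :=
  Submodule.span (ZMod 2)
    {x | ∃ s : StringDiagram M, s.HasContractibleLoop ∧ x = Finsupp.single ⟦s⟧ 1}

/-- The `ℤ/2`-vector space generated by string diagrams up to homotopy relative to the boundary,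
where diagrams with a contractible closed curve are zero. -/
abbrev StringComplex (M : MarkedDisc n) : Type :=
  (Quotient (homotopySetoid M) →₀ ZMod 2) ⧸ contractibleRelations M

/-- The element of the string complex represented by a string diagram. -/
def StringDiagram.toComplex (s : StringDiagram M) : StringComplex M :=
  (contractibleRelations M).mkQ (Finsupp.single ⟦s⟧ 1)

/-- The linear map `d` resolves crossings: it sends each generic string diagram to the sum, over
its crossings, of the diagrams obtained by resolving that crossing. -/
def ResolvesCrossings (d : StringComplex M →ₗ[ZMod 2] StringComplex M) : Prop :=
  ∀ s : StringDiagram M, s.IsGeneric →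
    d s.toComplex = ∑ᶠ c : s.Crossing, c.resolve.toComplex

/-- The homology `ker d / im d` of an endomorphism (with `d ∘ d = 0`). -/
abbrev Homology {V : Type} [AddCommGroup V] [Module (ZMod 2) V] (d : V →ₗ[ZMod 2] V) : Type :=
  LinearMap.ker d ⧸ (LinearMap.range d).submoduleOf (LinearMap.ker d)

/-! ### Chord diagrams and the bypass relation -/

/-- A chord diagram with `n` chords: the `2n` marked points, numbered around the circle, are joined
in pairs by chords that do not cross. (Up to isotopy relative to the boundary, disjoint arcs in the
disc are determined by the pairs of endpoints.) -/
@[ext]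
structure ChordDiagram (n : ℕ) where
  /-- the other end of the chord at a given marked point -/
  partner : Fin (2 * n) → Fin (2 * n)
  partner_partner : ∀ a, partner (partner a) = a
  partner_ne : ∀ a, partner a ≠ a
  noncrossing : ∀ a b, ¬ (a < b ∧ b < partner a ∧ partner a < partner b)

/-- The three chord diagrams are related by bypass surgeries. Outside a bypass disc they coincide,
and the six ends of the chords passing through it are marked points `p 0 < ⋯ < p 5`, which
the three diagrams join as the three sets of parallel arcs in a hexagon. -/
def IsBypassTriple (Γ Γ' Γ'' : ChordDiagram n) : Prop :=
  ∃ p : Fin 6 → Fin (2 * n), StrictMono p ∧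
    (Γ.partner (p 0) = p 1 ∧ Γ.partner (p 2) = p 5 ∧ Γ.partner (p 3) = p 4) ∧
    (Γ'.partner (p 1) = p 2 ∧ Γ'.partner (p 0) = p 3 ∧ Γ'.partner (p 4) = p 5) ∧
    (Γ''.partner (p 2) = p 3 ∧ Γ''.partner (p 1) = p 4 ∧ Γ''.partner (p 0) = p 5) ∧
    ∀ a, a ∉ Set.range p → Γ.partner a = Γ'.partner a ∧ Γ.partner a = Γ''.partner a

/-- The span of the bypass relations. -/
def bypassRelations (n : ℕ) : Submodule (ZMod 2) (ChordDiagram n →₀ ZMod 2) :=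
  Submodule.span (ZMod 2)
    {x | ∃ Γ Γ' Γ'' : ChordDiagram n, IsBypassTriple Γ Γ' Γ'' ∧
      x = Finsupp.single Γ 1 + Finsupp.single Γ' 1 + Finsupp.single Γ'' 1}

/-- The vector space `V_n` of chord diagrams modulo the bypass relation. -/
abbrev ChordSpace (n : ℕ) : Type :=
  (ChordDiagram n →₀ ZMod 2) ⧸ bypassRelations n

end StringHomology

end

/-!
The disc is convex, so a closed curve in it is contractible and an arc is determined up to homotopy
by its endpoints. Hence the string complex has a basis indexed by permutations, given by the
diagrams with straight arcs and no closed curves (`permEquiv`). To compute the differential in this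
basis one has to count crossings modulo two. If `f` and `g` are two arcs, their crossings are the
zeros of the map `(u, v) ↦ f u - g v` on a rectangle, and all of these are nondegenerate; so the
number of crossings has the parity of the winding number of that map along the boundary of the
rectangle (`exists_hasWinding_of_zeros`), which the positions of the endpoints on the circle
determine: it is odd if the endpoints interleave and even if not (`card_crossings_arc_arc`). In the
same way an arc crosses a closed curve an even number of times (`card_crossings_arc_loop`).
Crossings whose resolution creates a closed curve contribute nothing. The differential is therefore
the combinatorial map `permD`, which sends a permutation to the sum of its compositions with the
transpositions that exchange two crossing chords. It is determined by its values on straight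
diagrams because these are generic (`isGeneric_straightDiagram`). That `permD` squares to zero is a
cancellation of terms two by two and three by three (`permD_permD`).

Its homology is computed by induction on the number of chords (`permSpace_homology`). The
permutations in which the point with label `1` is joined to one of its two neighbours span a
subcomplex that is the direct sum of two copies of the complex with one chord less
(`permD_insertMap`, `insertMap_add_injective`). The quotient by it is acyclic: exchanging the ends
of the chords at the points with labels `0` and `2` is a contracting homotopy (`exchangeHomotopy`)
up to terms on which the total length of the chords, suitably measured, is smaller (`minEnergy`,
`exists_add_permD_mem_attachedSpace`). So the homology is represented by combinations of diagrams
in the subcomplex, and by induction by non-crossing ones.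

On the side of chord diagrams, non-crossing permutations are the same as chord diagrams, and they
are cycles. The sum of the three diagrams of a bypass triple is the boundary of the diagram that
joins opposite vertices of the bypass hexagon, which has exactly three crossings
(`IsBypassTriple.exists_resolveSum`). Conversely, every chord diagram is equivalent modulo bypass
relations to a combination of ones in which the point with label `1` is joined to a neighbour
(`exists_isBypassTriple`), so the induction also shows that there are no further relations.
-/

noncomputable section
namespace StringHomology

open Set Topology

/-! ### Winding numbers around rectangles -/

/-- A continuous logarithm of `h` along `[a, b]` changes by `δ` between the endpoints. -/
def HasLogChange (h : ℝ → ℂ) (a b : ℝ) (δ : ℂ) : Prop :=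
  ∃ ℓ : ℝ → ℂ, ContinuousOn ℓ (Icc a b) ∧ (∀ t ∈ Icc a b, Complex.exp (ℓ t) = h t) ∧
    ℓ b - ℓ a = δ

theorem HasLogChange.unique {h : ℝ → ℂ} {a b : ℝ} (hab : a ≤ b) {δ δ' : ℂ}
    (h₁ : HasLogChange h a b δ) (h₂ : HasLogChange h a b δ') : δ = δ' := by
  obtain ⟨ℓ, hc, he, rfl⟩ := h₁
  obtain ⟨ℓ', hc', he', rfl⟩ := h₂
  have hd : DiscreteTopology (AddSubgroup.zmultiples (2 * Real.pi * Complex.I)) :=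
    NormedSpace.discreteTopology_zmultiples _
  have key : (fun t => ℓ t - ℓ' t) a = (fun t => ℓ t - ℓ' t) b := by
    refine isPreconnected_Icc.constant_of_mapsTo
      (T := (AddSubgroup.zmultiples (2 * Real.pi * Complex.I) : Set ℂ)) ⟨hd⟩ (hc.sub hc') ?_
      (left_mem_Icc.2 hab) (right_mem_Icc.2 hab)
    intro t ht
    have : Complex.exp (ℓ t) = Complex.exp (ℓ' t) := by rw [he t ht, he' t ht]
    obtain ⟨m, hm⟩ := Complex.exp_eq_exp_iff_exists_int.1 this
    exact AddSubgroup.mem_zmultiples_iff.2 ⟨m, by simp [hm]⟩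
  linear_combination -key

theorem HasLogChange.mul {h h' : ℝ → ℂ} {a b : ℝ} {δ δ' : ℂ}
    (h₁ : HasLogChange h a b δ) (h₂ : HasLogChange h' a b δ') :
    HasLogChange (fun t => h t * h' t) a b (δ + δ') := by
  obtain ⟨ℓ, hc, he, rfl⟩ := h₁
  obtain ⟨ℓ', hc', he', rfl⟩ := h₂
  refine ⟨fun t => ℓ t + ℓ' t, hc.add hc', fun t ht => ?_, by ring⟩
  rw [Complex.exp_add, he t ht, he' t ht]

theorem HasLogChange.congr {h h' : ℝ → ℂ} {a b : ℝ} {δ : ℂ}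
    (h₁ : HasLogChange h a b δ) (heq : ∀ t ∈ Icc a b, h t = h' t) : HasLogChange h' a b δ := by
  obtain ⟨ℓ, hc, he, hδ⟩ := h₁
  exact ⟨ℓ, hc, fun t ht => (he t ht).trans (heq t ht), hδ⟩

/-- A function with values in a rotated slit plane has a principal logarithm. -/
theorem hasLogChange_of_mem_slitPlane {h : ℝ → ℂ} {a b : ℝ} (c : ℂ) (hc : c ≠ 0)
    (hcont : ContinuousOn h (Icc a b)) (hs : ∀ t ∈ Icc a b, h t * c ∈ Complex.slitPlane) :
    HasLogChange h a b (Complex.log (h b * c) - Complex.log (h a * c)) := by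
  refine ⟨fun t => Complex.log (h t * c) - Complex.log c, ?_, fun t ht => ?_, by ring⟩
  · exact ((hcont.mul continuousOn_const).clog hs).sub continuousOn_const
  · have h0 := Complex.slitPlane_ne_zero (hs t ht)
    rw [Complex.exp_sub, Complex.exp_log h0, Complex.exp_log hc, mul_div_assoc, div_self hc,
      mul_one]

/-- The winding number of `F` along the boundary of the rectangle `[a, b] × [c, d]`, traversed
anticlockwise, is `w`. -/
def HasWinding (F : ℝ × ℝ → ℂ) (a b c d : ℝ) (w : ℤ) : Prop :=
  ∃ δ₁ δ₂ δ₃ δ₄ : ℂ, HasLogChange (fun u => F (u, c)) a b δ₁ ∧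
    HasLogChange (fun v => F (b, v)) c d δ₂ ∧ HasLogChange (fun u => F (u, d)) a b δ₃ ∧
    HasLogChange (fun v => F (a, v)) c d δ₄ ∧ δ₁ + δ₂ - δ₃ - δ₄ = 2 * Real.pi * Complex.I * w

variable {F G : ℝ × ℝ → ℂ} {a b c d : ℝ}

theorem HasWinding.sum_eq (hab : a ≤ b) (hcd : c ≤ d) {w : ℤ} (h : HasWinding F a b c d w)
    {δ₁ δ₂ δ₃ δ₄ : ℂ} (h₁ : HasLogChange (fun u => F (u, c)) a b δ₁)
    (h₂ : HasLogChange (fun v => F (b, v)) c d δ₂) (h₃ : HasLogChange (fun u => F (u, d)) a b δ₃)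
    (h₄ : HasLogChange (fun v => F (a, v)) c d δ₄) :
    δ₁ + δ₂ - δ₃ - δ₄ = 2 * Real.pi * Complex.I * w := by
  obtain ⟨ε₁, ε₂, ε₃, ε₄, k₁, k₂, k₃, k₄, hs⟩ := h
  rw [h₁.unique hab k₁, h₂.unique hcd k₂, h₃.unique hab k₃, h₄.unique hcd k₄, hs]

theorem HasWinding.mul {w w' : ℤ} (h : HasWinding F a b c d w) (h' : HasWinding G a b c d w') :
    HasWinding (fun z => F z * G z) a b c d (w + w') := by
  obtain ⟨δ₁, δ₂, δ₃, δ₄, h₁, h₂, h₃, h₄, hs⟩ := h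
  obtain ⟨ε₁, ε₂, ε₃, ε₄, k₁, k₂, k₃, k₄, ks⟩ := h'
  refine ⟨_, _, _, _, h₁.mul k₁, h₂.mul k₂, h₃.mul k₃, h₄.mul k₄, ?_⟩
  push_cast
  linear_combination hs + ks

/-- The boundary of the rectangle `[a, b] × [c, d]`. -/
def rectBoundary (a b c d : ℝ) : Set (ℝ × ℝ) := Icc a b ×ˢ Icc c d \ Ioo a b ×ˢ Ioo c d

theorem edges_mem_rectBoundary (hab : a ≤ b) (hcd : c ≤ d) :
    (∀ t ∈ Icc a b, (t, c) ∈ rectBoundary a b c d) ∧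
    (∀ t ∈ Icc c d, (b, t) ∈ rectBoundary a b c d) ∧
    (∀ t ∈ Icc a b, (t, d) ∈ rectBoundary a b c d) ∧
      (∀ t ∈ Icc c d, (a, t) ∈ rectBoundary a b c d) :=
  ⟨fun _ ht => ⟨⟨ht, left_mem_Icc.2 hcd⟩, fun h => lt_irrefl _ h.2.1⟩,
    fun _ ht => ⟨⟨right_mem_Icc.2 hab, ht⟩, fun h => lt_irrefl _ h.1.2⟩,
    fun _ ht => ⟨⟨ht, right_mem_Icc.2 hcd⟩, fun h => lt_irrefl _ h.2.2⟩,
    fun _ ht => ⟨⟨left_mem_Icc.2 hab, ht⟩, fun h => lt_irrefl _ h.1.1⟩⟩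

theorem HasWinding.congr (hab : a ≤ b) (hcd : c ≤ d) {w : ℤ} (h : HasWinding F a b c d w)
    (heq : ∀ z ∈ rectBoundary a b c d, F z = G z) : HasWinding G a b c d w := by
  obtain ⟨δ₁, δ₂, δ₃, δ₄, h₁, h₂, h₃, h₄, hs⟩ := h
  obtain ⟨m₁, m₂, m₃, m₄⟩ := edges_mem_rectBoundary hab hcd
  exact ⟨δ₁, δ₂, δ₃, δ₄, h₁.congr fun t ht => heq _ (m₁ t ht),
    h₂.congr fun t ht => heq _ (m₂ t ht), h₃.congr fun t ht => heq _ (m₃ t ht),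
    h₄.congr fun t ht => heq _ (m₄ t ht), hs⟩

theorem hasWinding_zero_of_log {ℓ : ℝ × ℝ → ℂ} (hab : a ≤ b) (hcd : c ≤ d)
    (hc : ContinuousOn ℓ (rectBoundary a b c d))
    (hℓ : ∀ z ∈ rectBoundary a b c d, Complex.exp (ℓ z) = F z) : HasWinding F a b c d 0 := by
  obtain ⟨m₁, m₂, m₃, m₄⟩ := edges_mem_rectBoundary hab hcd
  refine ⟨_, _, _, _,
    ⟨fun u => ℓ (u, c), hc.comp (by fun_prop) m₁, fun t ht => hℓ _ (m₁ t ht), rfl⟩,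
    ⟨fun v => ℓ (b, v), hc.comp (by fun_prop) m₂, fun t ht => hℓ _ (m₂ t ht), rfl⟩,
    ⟨fun u => ℓ (u, d), hc.comp (by fun_prop) m₃, fun t ht => hℓ _ (m₃ t ht), rfl⟩,
    ⟨fun v => ℓ (a, v), hc.comp (by fun_prop) m₄, fun t ht => hℓ _ (m₄ t ht), rfl⟩, ?_⟩
  push_cast
  ring

/-- A nowhere vanishing function on a rectangle has winding number `0`, because it has a
logarithm. -/
theorem hasWinding_zero_of_ne_zero (hab : a ≤ b) (hcd : c ≤ d)
    (hF : ContinuousOn F (Icc a b ×ˢ Icc c d)) (h0 : ∀ z ∈ Icc a b ×ˢ Icc c d, F z ≠ 0) :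
    HasWinding F a b c d 0 := by
  let clamp : ℝ × ℝ → ℝ × ℝ := fun z => (projIcc a b hab z.1, projIcc c d hcd z.2)
  have hclamp : Continuous clamp := by
    refine (continuous_subtype_val.comp (continuous_projIcc.comp continuous_fst)).prodMk
      (continuous_subtype_val.comp (continuous_projIcc.comp continuous_snd))
  have hmem : ∀ z, clamp z ∈ Icc a b ×ˢ Icc c d := fun z =>
    ⟨(projIcc a b hab z.1).2, (projIcc c d hcd z.2).2⟩
  have hid : ∀ z ∈ Icc a b ×ˢ Icc c d, clamp z = z := fun z hz => by
    have h1 := projIcc_of_mem hab hz.1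
    have h2 := projIcc_of_mem hcd hz.2
    simp only [clamp, h1, h2]
  let f : C(ℝ × ℝ, ℂ) := ⟨fun z => F (clamp z), hF.comp_continuous hclamp hmem⟩
  have hf0 : ∀ z, f z ≠ 0 := fun z => h0 _ (hmem z)
  obtain ⟨ℓ, ⟨-, hℓ⟩, -⟩ := Complex.isCoveringMapOn_exp.existsUnique_continuousMap_lifts f
    (a₀ := (0, 0)) (e₀ := Complex.log (f (0, 0))) (Complex.exp_log (hf0 _)) (fun z => hf0 z)
  refine hasWinding_zero_of_log (ℓ := ℓ) hab hcd ℓ.continuous.continuousOn fun z hz => ?_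
  have := congrFun hℓ z
  simp only [Function.comp_apply] at this
  rw [this]
  simp [f, hid z hz.1]

/-- A function with values in a rotated slit plane on the boundary of a rectangle has winding
number `0`. -/
theorem hasWinding_zero_of_slitPlane (hab : a ≤ b) (hcd : c ≤ d) (k : ℂ) (hk : k ≠ 0)
    (hF : ContinuousOn F (rectBoundary a b c d))
    (hs : ∀ z ∈ rectBoundary a b c d, F z * k ∈ Complex.slitPlane) :
    HasWinding F a b c d 0 := by
  refine hasWinding_zero_of_log (ℓ := fun z => Complex.log (F z * k) - Complex.log k) hab hcd
    (((hF.mul continuousOn_const).clog hs).sub continuousOn_const) fun z hz => ?_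
  rw [Complex.exp_sub, Complex.exp_log (Complex.slitPlane_ne_zero (hs z hz)),
    Complex.exp_log hk, mul_div_assoc, div_self hk, mul_one]

/-- The coordinate `(u, v) ↦ (u - u₀) + i (v - v₀)` winds once around a rectangle that contains
`(u₀, v₀)`. -/
theorem hasWinding_coordinate {u₀ v₀ : ℝ} (hu : u₀ ∈ Ioo a b) (hv : v₀ ∈ Ioo c d) :
    HasWinding (fun z => ((z.1 - u₀ : ℝ) : ℂ) + ((z.2 - v₀ : ℝ) : ℂ) * Complex.I) a b c d 1 := by
  obtain ⟨ha, hb⟩ := hu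
  obtain ⟨hc, hd⟩ := hv
  refine ⟨_, _, _, _,
    hasLogChange_of_mem_slitPlane 1 one_ne_zero (by fun_prop) fun t ht => ?_,
    hasLogChange_of_mem_slitPlane 1 one_ne_zero (by fun_prop) fun t ht => ?_,
    hasLogChange_of_mem_slitPlane 1 one_ne_zero (by fun_prop) fun t ht => ?_,
    hasLogChange_of_mem_slitPlane (-1) (by simp) (by fun_prop) fun t ht => ?_, ?_⟩
  · refine Complex.mem_slitPlane_iff.2 (Or.inr ?_)
    simp [sub_ne_zero, hc.ne]
  · refine Complex.mem_slitPlane_iff.2 (Or.inl ?_)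
    simp [hb]
  · refine Complex.mem_slitPlane_iff.2 (Or.inr ?_)
    simp [sub_ne_zero, hd.ne']
  · refine Complex.mem_slitPlane_iff.2 (Or.inl ?_)
    simp [ha]
  · have h1 : ∀ z : ℂ, Complex.log z = Real.log ‖z‖ + Complex.arg z * Complex.I := fun z => rfl
    have e1 := Complex.arg_neg_eq_arg_sub_pi_of_im_pos
      (x := ((a - u₀ : ℝ) : ℂ) + ((d - v₀ : ℝ) : ℂ) * Complex.I) (by simpa using hd)
    have e2 := Complex.arg_neg_eq_arg_add_pi_of_im_neg
      (x := ((a - u₀ : ℝ) : ℂ) + ((c - v₀ : ℝ) : ℂ) * Complex.I) (by simpa using hc)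
    simp only [mul_one, mul_neg_one, h1, e1, e2, norm_neg]
    push_cast
    ring

theorem HasWinding.conj {w : ℤ} (h : HasWinding F a b c d w) :
    HasWinding (fun z => (starRingEnd ℂ) (F z)) a b c d (-w) := by
  have key : ∀ {h : ℝ → ℂ} {a b : ℝ} {δ : ℂ}, HasLogChange h a b δ →
      HasLogChange (fun t => (starRingEnd ℂ) (h t)) a b ((starRingEnd ℂ) δ) := by
    rintro h a b δ ⟨ℓ, hc, he, rfl⟩
    refine ⟨fun t => (starRingEnd ℂ) (ℓ t), Complex.continuous_conj.comp_continuousOn hc,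
      fun t ht => ?_, by simp⟩
    rw [Complex.exp_conj, he t ht]
  obtain ⟨δ₁, δ₂, δ₃, δ₄, h₁, h₂, h₃, h₄, hs⟩ := h
  refine ⟨_, _, _, _, key h₁, key h₂, key h₃, key h₄, ?_⟩
  have := congrArg (starRingEnd ℂ) hs
  simp only [map_add, map_sub, map_mul, map_ofNat, Complex.conj_ofReal, Complex.conj_I,
    map_intCast] at this
  rw [this]
  push_cast
  ring

/-- If `ζ` has winding number `w` and `‖β‖ < ‖α‖` then so has `α * ζ + β * conj ζ`. -/
theorem HasWinding.add_conj {w : ℤ} (hab : a ≤ b) (hcd : c ≤ d) {ζ : ℝ × ℝ → ℂ}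
    (hζ : Continuous ζ) (h : HasWinding ζ a b c d w)
    (h0 : ∀ z ∈ rectBoundary a b c d, ζ z ≠ 0) {α β : ℂ}
    (hαβ : ‖β‖ < ‖α‖) :
    HasWinding (fun z => α * ζ z + β * (starRingEnd ℂ) (ζ z)) a b c d w := by
  have hα : α ≠ 0 := by
    rintro rfl
    simp only [norm_zero] at hαβ
    exact absurd hαβ (not_lt.2 (norm_nonneg β))
  have hG : HasWinding (fun z => α + β * (starRingEnd ℂ) (ζ z) / ζ z) a b c d 0 := by
    refine hasWinding_zero_of_slitPlane hab hcd α⁻¹ (inv_ne_zero hα) ?_ fun z hz => ?_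
    · refine continuousOn_const.add (ContinuousOn.div ?_ hζ.continuousOn h0)
      exact (continuous_const.mul (Complex.continuous_conj.comp hζ)).continuousOn
    · rw [add_mul, mul_inv_cancel₀ hα]
      refine Complex.mem_slitPlane_of_norm_lt_one ?_
      rw [norm_mul, norm_div, norm_mul, RCLike.norm_conj, mul_div_assoc,
        div_self (norm_ne_zero_iff.2 (h0 z hz)), mul_one, norm_inv, ← div_eq_mul_inv]
      exact (div_lt_one (norm_pos_iff.2 hα)).2 hαβ
  refine (zero_add w ▸ hG.mul h).congr hab hcd fun z hz => ?_
  have := h0 z hz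
  field_simp

/-- An injective real-linear map winds an odd number of times around each point. -/
theorem exists_odd_hasWinding_linear {u₀ v₀ : ℝ} (hu : u₀ ∈ Ioo a b) (hv : v₀ ∈ Ioo c d)
    (L : ℝ × ℝ →L[ℝ] ℂ) (hL : Function.Injective L) :
    ∃ w : ℤ, Odd w ∧ HasWinding (fun z => L (z - (u₀, v₀))) a b c d w := by
  have hab := (hu.1.trans hu.2).le
  have hcd := (hv.1.trans hv.2).le
  set ζ : ℝ × ℝ → ℂ := fun z => ((z.1 - u₀ : ℝ) : ℂ) + ((z.2 - v₀ : ℝ) : ℂ) * Complex.I with hζ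
  have hζc : Continuous ζ := by fun_prop
  have hζ1 : HasWinding ζ a b c d 1 := hasWinding_coordinate hu hv
  have hζ0 : ∀ z ∈ rectBoundary a b c d, ζ z ≠ 0 := by
    rintro ⟨u, v⟩ ⟨-, hz⟩ h
    have h1 := congrArg Complex.re h
    have h2 := congrArg Complex.im h
    simp only [hζ, Complex.add_re, Complex.ofReal_re, Complex.mul_re, Complex.I_re,
      Complex.ofReal_im, Complex.I_im, Complex.zero_re, Complex.add_im, Complex.mul_im,
      Complex.zero_im] at h1 h2
    have h3 : u = u₀ := by linarith
    have h4 : v = v₀ := by linarith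
    subst h3 h4
    exact hz ⟨hu, hv⟩
  set p := L (1, 0) with hp
  set q := L (0, 1) with hq
  have hLpq : ∀ x y : ℝ, L (x, y) = x * p + y * q := fun x y => by
    have : ((x, y) : ℝ × ℝ) = x • (1, 0) + y • (0, 1) := by simp
    rw [this, map_add, map_smul, map_smul, hp, hq, Complex.real_smul, Complex.real_smul]
  set α : ℂ := (p - q * Complex.I) / 2 with hα
  set β : ℂ := (p + q * Complex.I) / 2 with hβ
  have hform : ∀ z : ℝ × ℝ, L (z - (u₀, v₀)) = α * ζ z + β * (starRingEnd ℂ) (ζ z) := by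
    rintro ⟨u, v⟩
    rw [show ((u, v) : ℝ × ℝ) - (u₀, v₀) = (u - u₀, v - v₀) from rfl, hLpq]
    simp only [hζ, hα, hβ, map_add, map_mul, Complex.conj_ofReal, Complex.conj_I]
    linear_combination (((v - v₀ : ℝ) : ℂ) * q) * Complex.I_sq
  have hne : ‖α‖ ≠ ‖β‖ := by
    intro h
    -- `‖α‖² - ‖β‖²` is the determinant of `L`
    have hdet : p.re * q.im - p.im * q.re = 0 := by
      have h' : Complex.normSq α = Complex.normSq β := by
        rw [Complex.normSq_eq_norm_sq, Complex.normSq_eq_norm_sq, h]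
      simp only [hα, hβ, Complex.normSq_apply, Complex.div_ofNat_re, Complex.div_ofNat_im,
        Complex.sub_re, Complex.add_re, Complex.sub_im, Complex.add_im, Complex.mul_re,
        Complex.mul_im, Complex.I_re, Complex.I_im] at h'
      linarith
    have k1 : L (q.re, -p.re) = L (0, 0) := by
      rw [hLpq, hLpq]
      apply Complex.ext
      · simp; ring
      · simp; linarith
    have k2 : L (q.im, -p.im) = L (0, 0) := by
      rw [hLpq, hLpq]
      apply Complex.ext
      · simp; linarith
      · simp; ring
    have k1' := hL k1
    have k2' := hL k2
    simp only [Prod.mk.injEq, neg_eq_zero] at k1' k2'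
    have hp0 : p = 0 := Complex.ext k1'.2 k2'.2
    have : ((1, 0) : ℝ × ℝ) = 0 := hL (by rw [← hp, hp0, map_zero])
    simp at this
  rcases lt_or_gt_of_ne hne with h | h
  · refine ⟨-1, by decide, ?_⟩
    have h2 := HasWinding.add_conj hab hcd (Complex.continuous_conj.comp hζc) hζ1.conj
      (fun z hz => by simpa using hζ0 z hz) h
    refine h2.congr hab hcd fun z _ => ?_
    rw [hform]
    simp
    ring
  · exact ⟨1, by decide, (HasWinding.add_conj hab hcd hζc hζ1 hζ0 h).congr hab hcd
      fun z _ => (hform z).symm⟩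

/-- The argument principle modulo two: a continuous function on a rectangle whose zeros are
finitely many interior points with injective real derivative winds along the boundary as often
as it has zeros, modulo two. Zeros are removed one at a time by dividing by the derivative there. -/
theorem exists_hasWinding_of_zeros (hab : a ≤ b) (hcd : c ≤ d) (Z : Finset (ℝ × ℝ)) :
    ∀ F : ℝ × ℝ → ℂ, ContinuousOn F (Icc a b ×ˢ Icc c d) →
      (∀ z ∈ Icc a b ×ˢ Icc c d, F z = 0 ↔ z ∈ Z) →
      (∀ z ∈ Z, z ∈ Ioo a b ×ˢ Ioo c d ∧
        ∃ L : ℝ × ℝ →L[ℝ] ℂ, Function.Injective L ∧ HasFDerivAt F L z) →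
      ∃ w : ℤ, (w : ZMod 2) = (Z.card : ZMod 2) ∧ HasWinding F a b c d w := by
  classical
  induction Z using Finset.induction_on with
  | empty =>
    intro F hF h0 _
    exact ⟨0, by simp, hasWinding_zero_of_ne_zero hab hcd hF fun z hz h => by
      simpa using (h0 z hz).1 h⟩
  | insert z₀ Z hz₀ ih =>
    intro F hF h0 hZ
    obtain ⟨hz₀R, L, hL, hFL⟩ := hZ z₀ (Finset.mem_insert_self _ _)
    have hz₀R' : z₀ ∈ Icc a b ×ˢ Icc c d := ⟨Ioo_subset_Icc_self hz₀R.1, Ioo_subset_Icc_self hz₀R.2⟩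
    have hF0 : F z₀ = 0 := (h0 z₀ hz₀R').2 (Finset.mem_insert_self _ _)
    have hLne : ∀ z, z ≠ z₀ → L (z - z₀) ≠ 0 := fun z hz h =>
      hz (sub_eq_zero.1 (hL (h.trans (map_zero L).symm)))
    set G : ℝ × ℝ → ℂ := fun z => if z = z₀ then 1 else F z / L (z - z₀) with hG
    have hGne : ∀ z, z ≠ z₀ → G =ᶠ[𝓝 z] fun z => F z / L (z - z₀) := fun z hz => by
      filter_upwards [isOpen_ne.mem_nhds hz] with y hy
      exact if_neg hy
    have hFG : ∀ z ∈ Icc a b ×ˢ Icc c d, F z = G z * L (z - z₀) := fun z _ => by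
      by_cases h : z = z₀
      · simp [h, hF0]
      · rw [hG]
        simp only [if_neg h]
        rw [div_mul_cancel₀ _ (hLne z h)]
    suffices hG' : ∃ w : ℤ, (w : ZMod 2) = (Z.card : ZMod 2) ∧ HasWinding G a b c d w by
      obtain ⟨w, hw, hGw⟩ := hG'
      obtain ⟨w', hw', hLw⟩ := exists_odd_hasWinding_linear hz₀R.1 hz₀R.2 L hL
      refine ⟨w + w', ?_, (hGw.mul hLw).congr hab hcd fun z hz => (hFG z hz.1).symm⟩
      rw [Finset.card_insert_of_notMem hz₀]
      push_cast
      rw [hw, (ZMod.intCast_eq_one_iff_odd).2 hw']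
    refine ih G ?_ ?_ ?_
    · intro z hz
      by_cases h : z = z₀
      · subst h
        -- near its zero, `F` differs from the linear map by a little-o
        have hlin : ∃ K > 0, ∀ y, K * ‖y‖ ≤ ‖L y‖ := by
          obtain ⟨K, hK, hKL⟩ := L.toLinearMap.injective_iff_antilipschitz.1 hL
          refine ⟨(K : ℝ)⁻¹, by positivity, fun y => ?_⟩
          have := hKL.le_mul_dist y 0
          simp only [dist_zero_right, ContinuousLinearMap.coe_coe, map_zero] at this
          rw [inv_mul_le_iff₀ (by positivity)]
          exact this
        obtain ⟨K, hK, hKL⟩ := hlin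
        apply ContinuousAt.continuousWithinAt
        rw [Metric.continuousAt_iff]
        intro ε hε
        have ho := hFL.isLittleO.def (c := K * (ε / 2)) (by positivity)
        obtain ⟨η, hη, hη'⟩ := Metric.eventually_nhds_iff.1 ho
        refine ⟨η, hη, fun y hy => ?_⟩
        by_cases hyz : y = z
        · simpa [hyz] using hε
        · have h1 := hη' hy
          rw [hF0, sub_zero] at h1
          have h2 := hKL (y - z)
          have h3 : 0 < ‖L (y - z)‖ := norm_pos_iff.2 (hLne y hyz)
          have h4 : G y - G z = (F y - L (y - z)) / L (y - z) := by
            simp only [hG, if_neg hyz, if_true]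
            rw [sub_div, div_self (hLne y hyz)]
          rw [dist_eq_norm, h4, norm_div, div_lt_iff₀ h3]
          nlinarith [norm_nonneg (y - z)]
      · refine ContinuousWithinAt.congr_of_eventuallyEq ?_
          ((hGne z h).filter_mono nhdsWithin_le_nhds) (hGne z h).self_of_nhds
        exact (hF z hz).div (by fun_prop) (hLne z h)
    · intro z hz
      by_cases h : z = z₀
      · subst h
        simp [hG, hz₀]
      · have := h0 z hz
        simp only [hG, if_neg h, div_eq_zero_iff, hLne z h, or_false]
        simp only [Finset.mem_insert, h, false_or] at this
        exact this
    · intro z hz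
      obtain ⟨hzR, L', hL', hFL'⟩ := hZ z (Finset.mem_insert_of_mem hz)
      have hne : z ≠ z₀ := fun h => hz₀ (h ▸ hz)
      have hFz : F z = 0 := (h0 z ⟨Ioo_subset_Icc_self hzR.1, Ioo_subset_Icc_self hzR.2⟩).2
        (Finset.mem_insert_of_mem hz)
      refine ⟨hzR, (L (z - z₀))⁻¹ • L', fun x y hxy => hL' ?_, ?_⟩
      · exact smul_right_injective ℂ (inv_ne_zero (hLne z hne)) hxy
      · have h1 : HasFDerivAt (fun y => L (y - z₀)) L z :=
          L.hasFDerivAt.comp z ((hasFDerivAt_id z).sub_const z₀)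
        have h2 := hFL'.mul ((hasDerivAt_inv (hLne z hne)).comp_hasFDerivAt_of_eq z
          (h1.restrictScalars ℝ) rfl)
        refine HasFDerivAt.congr_of_eventuallyEq ?_ (hGne z hne)
        have h3 : (fun y => F y / L (y - z₀)) = F * (Inv.inv ∘ fun y => L (y - z₀)) := by
          funext y
          simp [div_eq_mul_inv]
        rw [h3]
        refine HasFDerivAt.congr_fderiv h2 (ContinuousLinearMap.ext fun y => ?_)
        simp [hFz]

end StringHomology
end

noncomputable section
namespace StringHomology

open Set Topology

/-! ### Intersection numbers of curves in the disc, modulo two -/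

/-- The truth value of `a < b`, modulo two. -/
def ltBit {α : Type*} [LinearOrder α] (a b : α) : ZMod 2 := if a < b then 1 else 0

theorem one_sub_div_mem_slitPlane {p z : ℂ} (hp : ‖p‖ = 1) (hz : ‖z‖ ≤ 1) (hne : z ≠ p) :
    1 - z / p ∈ Complex.slitPlane := by
  have hp0 : p ≠ 0 := fun h => by simp [h] at hp
  refine Complex.mem_slitPlane_iff.2 (Or.inl ?_)
  have h1 : ‖z / p‖ ≤ 1 := by rw [norm_div, hp, div_one]; exact hz
  have h2 : (z / p).re ≤ 1 := (Complex.re_le_norm _).trans h1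
  rcases h2.lt_or_eq with h | h
  · simpa using h
  · exfalso
    have h3 : Complex.normSq (z / p) ≤ 1 := by
      rw [Complex.normSq_eq_norm_sq]; nlinarith [norm_nonneg (z / p)]
    rw [Complex.normSq_apply, h] at h3
    have h4 : (z / p).im = 0 := by nlinarith [mul_self_nonneg (z / p).im]
    have h5 : z / p = 1 := Complex.ext h h4
    exact hne ((div_eq_one_iff_eq hp0).1 h5)

theorem hasLogChange_const_sub {g : ℝ → ℂ} {c d : ℝ} {p : ℂ} (hp : ‖p‖ = 1)
    (hg : ContinuousOn g (Icc c d)) (hg1 : ∀ t ∈ Icc c d, ‖g t‖ ≤ 1)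
    (hgp : ∀ t ∈ Icc c d, g t ≠ p) :
    HasLogChange (fun t => p - g t) c d
      (Complex.log (1 - g d / p) - Complex.log (1 - g c / p)) := by
  have hp0 : p ≠ 0 := fun h => by simp [h] at hp
  have key : ∀ z, (p - z) * p⁻¹ = 1 - z / p := fun z => by field_simp
  have := hasLogChange_of_mem_slitPlane (h := fun t => p - g t) p⁻¹ (inv_ne_zero hp0)
    (continuousOn_const.sub hg)
    (fun t ht => by rw [key]; exact one_sub_div_mem_slitPlane hp (hg1 t ht) (hgp t ht))
  simpa only [key] using this

theorem hasLogChange_sub_const {f : ℝ → ℂ} {a b : ℝ} {q : ℂ} (hq : ‖q‖ = 1)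
    (hf : ContinuousOn f (Icc a b)) (hf1 : ∀ t ∈ Icc a b, ‖f t‖ ≤ 1)
    (hfq : ∀ t ∈ Icc a b, f t ≠ q) :
    HasLogChange (fun t => f t - q) a b
      (Complex.log (1 - f b / q) - Complex.log (1 - f a / q)) := by
  have hq0 : q ≠ 0 := fun h => by simp [h] at hq
  have key : ∀ z, (z - q) * (-q)⁻¹ = 1 - z / q := fun z => by field_simp; ring
  have := hasLogChange_of_mem_slitPlane (h := fun t => f t - q) (-q)⁻¹
    (inv_ne_zero (neg_ne_zero.2 hq0)) (hf.sub continuousOn_const)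
    (fun t ht => by rw [key]; exact one_sub_div_mem_slitPlane hq (hf1 t ht) (hfq t ht))
  simpa only [key] using this

theorem log_one_sub_exp {φ : ℝ} (h0 : 0 < φ) (h1 : φ < 2 * Real.pi) :
    Complex.log (1 - Complex.exp (φ * Complex.I)) =
      Real.log (2 * Real.sin (φ / 2)) + ((φ - Real.pi) / 2 : ℝ) * Complex.I := by
  have hs : 0 < 2 * Real.sin (φ / 2) :=
    mul_pos two_pos (Real.sin_pos_of_pos_of_lt_pi (by linarith) (by linarith))
  rw [← Complex.log_exp (x := Real.log (2 * Real.sin (φ / 2)) +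
    ((φ - Real.pi) / 2 : ℝ) * Complex.I)]
  · congr 1
    rw [Complex.exp_add, ← Complex.ofReal_exp, Real.exp_log hs]
    apply Complex.ext
    · have hc : Real.cos ((φ - Real.pi) / 2) = Real.sin (φ / 2) := by
        rw [sub_div, Real.cos_sub_pi_div_two]
      have hd : Real.cos φ = 1 - 2 * Real.sin (φ / 2) ^ 2 := by
        have := Real.cos_sq_add_sin_sq (φ / 2)
        rw [show φ = 2 * (φ / 2) by ring, Real.cos_two_mul]
        rw [show 2 * (φ / 2) / 2 = φ / 2 by ring]
        linarith
      rw [Complex.re_ofReal_mul, Complex.exp_ofReal_mul_I_re, hc, Complex.sub_re,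
        Complex.exp_ofReal_mul_I_re, hd, Complex.one_re]
      ring
    · have hc : Real.sin ((φ - Real.pi) / 2) = - Real.cos (φ / 2) := by
        rw [sub_div, Real.sin_sub_pi_div_two]
      have hd : Real.sin φ = 2 * Real.sin (φ / 2) * Real.cos (φ / 2) := by
        rw [← Real.sin_two_mul]
        congr 1
        ring
      rw [Complex.im_ofReal_mul, Complex.exp_ofReal_mul_I_im, hc, Complex.sub_im,
        Complex.exp_ofReal_mul_I_im, hd, Complex.one_im]
      ring
  · simp
    linarith [Real.pi_pos]
  · simp
    linarith [Real.pi_pos]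

/-- For two points of the circle with angles `α` and `β`, the principal arguments of `1 - p / q`
and `1 - q / p` differ by the angle from `q` to `p` in `(0, 2π)`, up to a constant. -/
theorem log_one_sub_div_sub {α β : ℝ} (hne : α ≠ β) (h1 : α < β + 2 * Real.pi)
    (h2 : β < α + 2 * Real.pi) {p q : ℂ} (hp : p = Complex.exp (α * Complex.I))
    (hq : q = Complex.exp (β * Complex.I)) :
    Complex.log (1 - p / q) - Complex.log (1 - q / p) =
      (α - β - Real.pi + 2 * Real.pi * (if α < β then 1 else 0)) * Complex.I := by
  have hpq : ∀ x y : ℝ, Complex.exp (x * Complex.I) / Complex.exp (y * Complex.I) =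
      Complex.exp ((x - y : ℝ) * Complex.I) := fun x y => by
    rw [← Complex.exp_sub]
    congr 1
    push_cast
    ring
  have hper : ∀ x : ℝ, Complex.exp ((x + 2 * Real.pi : ℝ) * Complex.I) =
      Complex.exp (x * Complex.I) := fun x => by
    push_cast
    rw [add_mul, Complex.exp_periodic]
  have hsin : Real.sin ((β - α + 2 * Real.pi) / 2) = Real.sin ((α - β) / 2) := by
    rw [show (β - α + 2 * Real.pi) / 2 = Real.pi - (α - β) / 2 by ring, Real.sin_pi_sub]
  have hsin' : Real.sin ((α - β + 2 * Real.pi) / 2) = Real.sin ((β - α) / 2) := by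
    rw [show (α - β + 2 * Real.pi) / 2 = Real.pi - (β - α) / 2 by ring, Real.sin_pi_sub]
  rw [hp, hq, hpq, hpq]
  rcases lt_or_gt_of_ne hne with h | h
  · rw [if_pos h, ← hper (α - β), log_one_sub_exp (by linarith) (by linarith),
      log_one_sub_exp (by linarith) (by linarith), hsin']
    push_cast
    ring
  · rw [if_neg h.not_gt, ← hper (β - α), log_one_sub_exp (by linarith) (by linarith),
      log_one_sub_exp (by linarith) (by linarith), hsin]
    push_cast
    ring

theorem TransverseAt.exists_hasFDerivAt {f g : C(ℝ, Disc)} {u v : ℝ} (h : TransverseAt f g u v) :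
    ∃ L : ℝ × ℝ →L[ℝ] ℂ, Function.Injective L ∧
      HasFDerivAt (fun z : ℝ × ℝ => (f z.1 : ℂ) - g z.2) L (u, v) := by
  obtain ⟨a, b, ha, hb, hlin⟩ := h
  refine ⟨(ContinuousLinearMap.fst ℝ ℝ ℝ).smulRight a - (ContinuousLinearMap.snd ℝ ℝ ℝ).smulRight b,
    ?_, ?_⟩
  · rw [injective_iff_map_eq_zero]
    rintro ⟨x, y⟩ hxy
    rw [LinearIndependent.pair_iff] at hlin
    have := hlin x (-y) (by simpa [sub_eq_add_neg] using hxy)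
    simpa using this
  · have h1 : HasFDerivAt (fun z : ℝ × ℝ => (f z.1 : ℂ))
        ((ContinuousLinearMap.fst ℝ ℝ ℝ).smulRight a) (u, v) := by
      refine (HasFDerivAt.comp (g := fun t : ℝ => (f t : ℂ)) (u, v)
        (HasDerivAt.hasFDerivAt ha) (hasFDerivAt_fst (p := (u, v)))).congr_fderiv
        (ContinuousLinearMap.ext fun y => ?_)
      simp
    have h2 : HasFDerivAt (fun z : ℝ × ℝ => (g z.2 : ℂ))
        ((ContinuousLinearMap.snd ℝ ℝ ℝ).smulRight b) (u, v) := by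
      refine (HasFDerivAt.comp (g := fun t : ℝ => (g t : ℂ)) (u, v)
        (HasDerivAt.hasFDerivAt hb) (hasFDerivAt_snd (p := (u, v)))).congr_fderiv
        (ContinuousLinearMap.ext fun y => ?_)
      simp
    exact h1.sub h2

theorem exists_hasWinding_of_crossings {f g : C(ℝ, Disc)} {a b c d : ℝ} (hab : a ≤ b) (hcd : c ≤ d)
    (Z : Finset (ℝ × ℝ)) (hZ : ∀ z ∈ Icc a b ×ˢ Icc c d, f z.1 = g z.2 ↔ z ∈ Z)
    (hZ' : ∀ z ∈ Z, z ∈ Ioo a b ×ˢ Ioo c d ∧ TransverseAt f g z.1 z.2) :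
    ∃ w : ℤ, (w : ZMod 2) = (Z.card : ZMod 2) ∧
      HasWinding (fun z => (f z.1 : ℂ) - g z.2) a b c d w := by
  refine exists_hasWinding_of_zeros hab hcd Z _ (Continuous.continuousOn (by fun_prop))
    (fun z hz => ?_) fun z hz => ⟨(hZ' z hz).1, (hZ' z hz).2.exists_hasFDerivAt⟩
  rw [sub_eq_zero, ← hZ z hz, Subtype.ext_iff]

theorem disc_norm_le (x : Disc) : ‖(x : ℂ)‖ ≤ 1 := mem_closedBall_zero_iff.1 x.2

/-- Two transverse curves that join points of the circle cross an odd number of times if and only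
if their endpoints interleave. The four sides of the parameter square have principal logarithms,
since differences with a point of the circle lie in a half plane. -/
theorem card_crossings_arc_arc {f g : C(ℝ, Disc)} {α₀ α₁ β₀ β₁ : ℝ}
    (hf₀ : (f 0 : ℂ) = Complex.exp (α₀ * Complex.I))
    (hf₁ : (f 1 : ℂ) = Complex.exp (α₁ * Complex.I))
    (hg₀ : (g 0 : ℂ) = Complex.exp (β₀ * Complex.I))
    (hg₁ : (g 1 : ℂ) = Complex.exp (β₁ * Complex.I))
    (hne : ∀ α ∈ ({α₀, α₁} : Set ℝ), ∀ β ∈ ({β₀, β₁} : Set ℝ),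
      α ≠ β ∧ α < β + 2 * Real.pi ∧ β < α + 2 * Real.pi)
    (Z : Finset (ℝ × ℝ)) (hZ : ∀ z ∈ Icc (0 : ℝ) 1 ×ˢ Icc (0 : ℝ) 1, f z.1 = g z.2 ↔ z ∈ Z)
    (hZ' : ∀ z ∈ Z, z ∈ Ioo (0 : ℝ) 1 ×ˢ Ioo (0 : ℝ) 1 ∧ TransverseAt f g z.1 z.2) :
    (Z.card : ZMod 2) = ltBit α₀ β₀ + ltBit α₁ β₀ + ltBit α₀ β₁ + ltBit α₁ β₁ := by
  obtain ⟨w, hw, hW⟩ := exists_hasWinding_of_crossings zero_le_one zero_le_one Z hZ hZ'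
  have hn : ∀ x : ℝ, ‖Complex.exp (x * Complex.I)‖ = 1 := Complex.norm_exp_ofReal_mul_I
  have hcross : ∀ u ∈ Icc (0 : ℝ) 1, ∀ v ∈ Icc (0 : ℝ) 1,
      (u = 0 ∨ u = 1 ∨ v = 0 ∨ v = 1) → (f u : ℂ) ≠ g v := by
    intro u hu v hv h hfg
    have h1 := (hZ' _ ((hZ (u, v) ⟨hu, hv⟩).1 (Subtype.ext hfg))).1
    obtain ⟨⟨h2, h3⟩, h4, h5⟩ := h1
    dsimp only at h2 h3 h4 h5
    rcases h with h | h | h | h <;> linarith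
  have h0 : (0 : ℝ) ∈ Icc (0 : ℝ) 1 := by simp
  have h1 : (1 : ℝ) ∈ Icc (0 : ℝ) 1 := by simp
  have hs := hW.sum_eq zero_le_one zero_le_one
    (hasLogChange_sub_const (f := fun u => (f u : ℂ)) (by rw [hg₀]; exact hn _)
      (Continuous.continuousOn (by fun_prop)) (fun t _ => disc_norm_le _)
      (fun t ht => hcross t ht 0 h0 (by simp)))
    (hasLogChange_const_sub (g := fun u => (g u : ℂ)) (by rw [hf₁]; exact hn _)
      (Continuous.continuousOn (by fun_prop)) (fun t _ => disc_norm_le _)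
      (fun t ht => (hcross 1 h1 t ht (by simp)).symm))
    (hasLogChange_sub_const (f := fun u => (f u : ℂ)) (by rw [hg₁]; exact hn _)
      (Continuous.continuousOn (by fun_prop)) (fun t _ => disc_norm_le _)
      (fun t ht => hcross t ht 1 h1 (by simp)))
    (hasLogChange_const_sub (g := fun u => (g u : ℂ)) (by rw [hf₀]; exact hn _)
      (Continuous.continuousOn (by fun_prop)) (fun t _ => disc_norm_le _)
      (fun t ht => (hcross 0 h0 t ht (by simp)).symm))
  have k := fun α hα β hβ => log_one_sub_div_sub (hne α hα β hβ).1 (hne α hα β hβ).2.1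
    (hne α hα β hβ).2.2 rfl rfl
  have k00 := k α₀ (by simp) β₀ (by simp)
  have k10 := k α₁ (by simp) β₀ (by simp)
  have k01 := k α₀ (by simp) β₁ (by simp)
  have k11 := k α₁ (by simp) β₁ (by simp)
  rw [← hf₀, ← hg₀] at k00
  rw [← hf₁, ← hg₀] at k10
  rw [← hf₀, ← hg₁] at k01
  rw [← hf₁, ← hg₁] at k11
  have hsum : (2 * Real.pi * Complex.I) * (w : ℂ) = (2 * Real.pi * Complex.I) *
      (((if α₁ < β₀ then 1 else 0) - (if α₀ < β₀ then 1 else 0) - (if α₁ < β₁ then 1 else 0) +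
        (if α₀ < β₁ then 1 else 0) : ℤ) : ℂ) := by
    push_cast
    linear_combination k10 - k00 - k11 + k01 - hs
  have hwe := Int.cast_injective (α := ℂ) (mul_left_cancel₀ Complex.two_pi_I_ne_zero hsum)
  have h2 : ∀ x : ZMod 2, -x = x := by decide
  rw [← hw, hwe]
  simp only [ltBit]
  push_cast
  simp only [sub_eq_add_neg, h2]
  ring

/-- A transverse pair of a curve that joins points of the circle and a closed curve crosses an even
number of times. -/
theorem card_crossings_arc_loop {f g : C(ℝ, Disc)} (hf₀ : ‖(f 0 : ℂ)‖ = 1) (hf₁ : ‖(f 1 : ℂ)‖ = 1)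
    {c : ℝ} (hg : ∀ v, g (v + 1) = g v) (Z : Finset (ℝ × ℝ))
    (hZ : ∀ z ∈ Icc (0 : ℝ) 1 ×ˢ Icc c (c + 1), f z.1 = g z.2 ↔ z ∈ Z)
    (hZ' : ∀ z ∈ Z, z ∈ Ioo (0 : ℝ) 1 ×ˢ Ioo c (c + 1) ∧ TransverseAt f g z.1 z.2) :
    (Z.card : ZMod 2) = 0 := by
  have hcc : c ≤ c + 1 := by linarith
  obtain ⟨w, hw, hW⟩ := exists_hasWinding_of_crossings zero_le_one hcc Z hZ hZ'
  have hcross : ∀ u ∈ Icc (0 : ℝ) 1, ∀ v ∈ Icc c (c + 1),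
      (u = 0 ∨ u = 1) → (g v : ℂ) ≠ f u := by
    intro u hu v hv h hfg
    have h1 := (hZ' _ ((hZ (u, v) ⟨hu, hv⟩).1 (Subtype.ext hfg.symm))).1
    obtain ⟨⟨h2, h3⟩, h4, h5⟩ := h1
    dsimp only at h2 h3 h4 h5
    rcases h with h | h <;> linarith
  obtain ⟨δ₁, -, δ₃, -, h₁, -, h₃, -, -⟩ := id hW
  have hs := hW.sum_eq zero_le_one hcc h₁
    (hasLogChange_const_sub (g := fun u => (g u : ℂ)) hf₁
      (Continuous.continuousOn (by fun_prop)) (fun t _ => disc_norm_le _)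
      (fun t ht => (hcross 1 (by simp) t ht (by simp)))) h₃
    (hasLogChange_const_sub (g := fun u => (g u : ℂ)) hf₀
      (Continuous.continuousOn (by fun_prop)) (fun t _ => disc_norm_le _)
      (fun t ht => (hcross 0 (by simp) t ht (by simp))))
  have h13 : δ₁ = δ₃ := h₁.unique zero_le_one (by simpa only [hg] using h₃)
  rw [hg, h13] at hs
  have hw0 : (2 * Real.pi * Complex.I) * (w : ℂ) = 0 := by
    rw [← hs]
    ring
  have : w = 0 := by
    simpa using (mul_eq_zero.1 hw0).resolve_left Complex.two_pi_I_ne_zero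
  rw [← hw, this, Int.cast_zero]

end StringHomology
end

noncomputable section
namespace StringHomology

/-! ### The complex of permutations -/

theorem ltBit_comm {a b : ℕ} (h : a ≠ b) : ltBit b a = 1 + ltBit a b := by
  rcases lt_or_gt_of_ne h with h | h
  · rw [ltBit, ltBit, if_pos h, if_neg h.not_gt]
    decide
  · rw [ltBit, ltBit, if_pos h, if_neg h.not_gt]
    decide

/-- The quadratic relation that expresses transitivity of a linear order. -/
theorem ltBit_transitivity {a b c : ℕ} (hab : a ≠ b) (hac : a ≠ c) (hbc : b ≠ c) :
    ltBit a b * ltBit b c + ltBit a c * ltBit a b + ltBit a c * ltBit b c + ltBit a c = 0 := by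
  simp only [ltBit]
  split_ifs <;> first | omega | decide

/-- For four distinct numbers, regarded as points of a circle: whether the chord from `a` to `b`
crosses the chord from `c` to `d`. -/
def interleave (a b c d : ℕ) : ZMod 2 := ltBit a c + ltBit b c + ltBit a d + ltBit b d

theorem interleave_comm {a b c d : ℕ} (hac : a ≠ c) (hbc : b ≠ c) (had : a ≠ d) (hbd : b ≠ d) :
    interleave c d a b = interleave a b c d := by
  have h4 : (4 : ZMod 2) = 0 := by decide
  simp only [interleave, ltBit_comm hac, ltBit_comm hbc, ltBit_comm had, ltBit_comm hbd]
  linear_combination h4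

/-- Two crossing chords that have exchanged their second endpoints no longer cross. -/
theorem interleave_mul_exchange {a a' b b' : ℕ} (haa : a ≠ a') (hab : a ≠ b) (hab' : a ≠ b')
    (hba : a' ≠ b) (hba' : a' ≠ b') (hbb : b ≠ b') :
    interleave a a' b b' * interleave a b' b a' = 0 := by
  simp only [interleave, ltBit]
  split_ifs <;> first | omega | decide

/-- Three chords: the two ways of resolving two crossings one after the other that lead to the same
diagram cancel. The identity is the sum of the transitivity relations over the eight choices of one
endpoint of each chord. -/
theorem interleave_three_chords {a a' b b' c c' : ℕ}
    (h : [a, a', b, b', c, c'].Nodup) :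
    interleave a a' b b' * interleave b a' c c' + interleave b b' c c' * interleave c b' a a' +
      interleave c c' a a' * interleave a c' b b' = 0 := by
  simp only [List.nodup_cons, List.mem_cons, List.not_mem_nil, or_false, not_or, not_false_iff,
    List.nodup_nil, and_true] at h
  obtain ⟨⟨aa, ab, ab', ac, ac'⟩, ⟨a'b, a'b', a'c, a'c'⟩, ⟨bb', bc, bc'⟩, ⟨b'c, b'c'⟩, cc'⟩ := h
  simp only [interleave, ltBit_comm ab', ltBit_comm ac, ltBit_comm ac', ltBit_comm a'b',
    ltBit_comm a'c, ltBit_comm a'c', ltBit_comm bc', ltBit_comm b'c']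
  linear_combination (norm := skip) ltBit_transitivity ab ac bc + ltBit_transitivity ab ac' bc' +
    ltBit_transitivity ab' ac b'c + ltBit_transitivity ab' ac' b'c' +
    ltBit_transitivity a'b a'c bc + ltBit_transitivity a'b a'c' bc' +
    ltBit_transitivity a'b' a'c b'c + ltBit_transitivity a'b' a'c' b'c'
  ring_nf
  reduce_mod_char

variable {n : ℕ}

/-- Whether the chords of a permutation that start at the incoming points `i` and `j` cross. The
`i`-th incoming point has label `2 * i`, the `k`-th outgoing point has label `2 * k + 1`. -/
def chordCross (σ : Equiv.Perm (Fin n)) (i j : Fin n) : ZMod 2 :=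
  interleave (2 * i) (2 * σ i + 1) (2 * j) (2 * σ j + 1)

theorem chordCross_comm (σ : Equiv.Perm (Fin n)) (i j : Fin n) :
    chordCross σ i j = chordCross σ j i := by
  by_cases h : i = j
  · rw [h]
  · have h1 : (i : ℕ) ≠ j := fun h' => h (Fin.ext h')
    have h2 : (σ i : ℕ) ≠ σ j := fun h' => h (σ.injective (Fin.ext h'))
    exact interleave_comm (by omega) (by omega) (by omega) (by omega)

/-- The vector space over `ℤ/2` with basis the permutations: string diagrams without closed curves,
up to homotopy. -/
abbrev PermSpace (n : ℕ) : Type := Equiv.Perm (Fin n) →₀ ZMod 2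

/-- The sum of the resolutions of all crossings of the straight diagram of a permutation. -/
def resolveSum (σ : Equiv.Perm (Fin n)) : PermSpace n :=
  ∑ p : Fin n × Fin n with p.1 < p.2,
    chordCross σ p.1 p.2 • Finsupp.single (σ * Equiv.swap p.1 p.2) 1

/-- The differential of the string complex, in terms of permutations. -/
def permD (n : ℕ) : PermSpace n →ₗ[ZMod 2] PermSpace n :=
  Finsupp.linearCombination (ZMod 2) resolveSum

theorem permD_single (σ : Equiv.Perm (Fin n)) : permD n (Finsupp.single σ 1) = resolveSum σ := by
  rw [permD, Finsupp.linearCombination_single, one_smul]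

/-- `chordCross` as a function of the unordered pair of chords. -/
def chordCrossSym (σ : Equiv.Perm (Fin n)) : Sym2 (Fin n) → ZMod 2 :=
  Sym2.lift ⟨chordCross σ, chordCross_comm σ⟩

/-- The transposition given by an unordered pair. -/
def swapSym : Sym2 (Fin n) → Equiv.Perm (Fin n) :=
  Sym2.lift ⟨Equiv.swap, Equiv.swap_comm⟩

@[simp] theorem chordCrossSym_mk (σ : Equiv.Perm (Fin n)) (i j : Fin n) :
    chordCrossSym σ s(i, j) = chordCross σ i j := rfl

@[simp] theorem swapSym_mk (i j : Fin n) : swapSym s(i, j) = Equiv.swap i j := rfl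

theorem swapSym_mul_self (z : Sym2 (Fin n)) : swapSym z * swapSym z = 1 := by
  induction z with | _ i j => simp

@[simp] theorem swapSym_apply_apply (z : Sym2 (Fin n)) (x : Fin n) :
    swapSym z (swapSym z x) = x := by
  rw [← Equiv.Perm.mul_apply, swapSym_mul_self, Equiv.Perm.one_apply]

theorem swapSym_map (τ : Equiv.Perm (Fin n)) (z : Sym2 (Fin n)) :
    swapSym (z.map τ) = τ * swapSym z * τ⁻¹ := by
  induction z with | _ i j => simp [Equiv.swap_apply_apply]

theorem resolveSum_eq_sum_sym2 (σ : Equiv.Perm (Fin n)) :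
    resolveSum σ = ∑ z : Sym2 (Fin n) with ¬ z.IsDiag,
      chordCrossSym σ z • Finsupp.single (σ * swapSym z) 1 := by
  have h := Finset.sum_sym2_filter_not_isDiag (Finset.univ : Finset (Fin n))
    (fun z => chordCrossSym σ z • (Finsupp.single (σ * swapSym z) 1 : PermSpace n))
  rw [Finset.sym2_univ] at h
  rw [h, resolveSum]
  refine Finset.sum_congr ?_ fun _ _ => rfl
  ext p
  simp only [Finset.mem_filter, Finset.mem_univ, true_and, Finset.mem_offDiag]
  exact ⟨fun h => ⟨h.ne, h⟩, fun h => h.2⟩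

/-- The rotation `(ij, jk) ↦ (jk, ki)` of pairs of transpositions, which preserves their
product. -/
def rotatePair : Sym2 (Fin n) × Sym2 (Fin n) ≃ Sym2 (Fin n) × Sym2 (Fin n) where
  toFun p := (p.2, p.1.map (swapSym p.2))
  invFun p := (p.2.map (swapSym p.1), p.1)
  left_inv p := by simp [Sym2.map_map]
  right_inv p := by simp [Sym2.map_map]

/-- The two unordered pairs have the form `{i, j}`, `{j, k}` with different `i`, `j`, `k`. -/
def Adjacent (p : Sym2 (Fin n) × Sym2 (Fin n)) : Prop :=
  ∃ i j k, i ≠ j ∧ j ≠ k ∧ i ≠ k ∧ p = (s(i, j), s(j, k))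

theorem Adjacent.swap {p : Sym2 (Fin n) × Sym2 (Fin n)} (h : Adjacent p) : Adjacent p.swap := by
  obtain ⟨i, j, k, hij, hjk, hik, rfl⟩ := h
  exact ⟨k, j, i, hjk.symm, hij.symm, hik.symm, by
    rw [Sym2.eq_swap (a := k), Sym2.eq_swap (a := j) (b := i)]; rfl⟩

theorem rotatePair_adjacent {i j k : Fin n} (hij : i ≠ j) (hik : i ≠ k) :
    rotatePair (s(i, j), s(j, k)) = (s(j, k), s(k, i)) := by
  simp only [rotatePair, Equiv.coe_fn_mk, swapSym_mk, Sym2.map_mk, Equiv.swap_apply_left,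
    Equiv.swap_apply_of_ne_of_ne hij hik]
  rw [Sym2.eq_swap (a := i)]

/-- Two unordered pairs are equal, have one element in common or are disjoint. -/
theorem pair_cases (p : Sym2 (Fin n) × Sym2 (Fin n)) (h1 : ¬ p.1.IsDiag) (h2 : ¬ p.2.IsDiag) :
    p.1 = p.2 ∨ Adjacent p ∨ ∃ i j k l, i ≠ j ∧ k ≠ l ∧ i ≠ k ∧ i ≠ l ∧ j ≠ k ∧ j ≠ l ∧
      p = (s(i, j), s(k, l)) := by
  obtain ⟨z, z'⟩ := p
  induction z with | _ i j
  induction z' with | _ k l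
  simp only [Sym2.mk_isDiag_iff] at h1 h2
  by_cases hik : i = k
  · subst hik
    by_cases hjl : j = l
    · subst hjl
      exact Or.inl rfl
    · exact Or.inr (Or.inl ⟨j, i, l, Ne.symm h1, h2, hjl, by rw [Sym2.eq_swap]⟩)
  by_cases hil : i = l
  · subst hil
    by_cases hjk : j = k
    · subst hjk
      exact Or.inl Sym2.eq_swap
    · refine Or.inr (Or.inl ⟨j, i, k, Ne.symm h1, Ne.symm h2, hjk, ?_⟩)
      rw [Sym2.eq_swap, Sym2.eq_swap (a := k)]
  by_cases hjk : j = k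
  · subst hjk
    exact Or.inr (Or.inl ⟨i, j, l, h1, h2, hil, rfl⟩)
  by_cases hjl : j = l
  · subst hjl
    exact Or.inr (Or.inl ⟨i, j, k, h1, Ne.symm h2, hik, by rw [Sym2.eq_swap (a := k)]⟩)
  exact Or.inr (Or.inr ⟨i, j, k, l, h1, h2, hik, hil, hjk, hjl, rfl⟩)

/-- The coefficient with which two successive resolutions contribute to the square of the
differential. -/
def pairCoeff (σ : Equiv.Perm (Fin n)) (p : Sym2 (Fin n) × Sym2 (Fin n)) : ZMod 2 :=
  chordCrossSym σ p.1 * chordCrossSym (σ * swapSym p.1) p.2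

theorem pairCoeff_rotate (σ : Equiv.Perm (Fin n)) {p : Sym2 (Fin n) × Sym2 (Fin n)}
    (hp : Adjacent p) :
    pairCoeff σ p + pairCoeff σ (rotatePair p) + pairCoeff σ (rotatePair (rotatePair p)) = 0 := by
  obtain ⟨i, j, k, hij, hjk, hik, rfl⟩ := hp
  rw [rotatePair_adjacent hij hik, rotatePair_adjacent hjk hij.symm]
  have key : ∀ i j k : Fin n, i ≠ j → j ≠ k → i ≠ k → pairCoeff σ (s(i, j), s(j, k)) =
      interleave (2 * i) (2 * σ i + 1) (2 * j) (2 * σ j + 1) *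
        interleave (2 * j) (2 * σ i + 1) (2 * k) (2 * σ k + 1) := by
    intro i j k hij hjk hik
    simp [pairCoeff, chordCross, Equiv.swap_apply_of_ne_of_ne hik.symm hjk.symm]
  rw [key i j k hij hjk hik, key j k i hjk hik.symm hij.symm, key k i j hik.symm hij hjk.symm]
  apply interleave_three_chords
  have h1 : ∀ {i j : Fin n}, i ≠ j → (i : ℕ) ≠ j := fun h h' => h (Fin.ext h')
  have h2 : ∀ {i j : Fin n}, i ≠ j → (σ i : ℕ) ≠ σ j := fun h h' => h (σ.injective (Fin.ext h'))
  have := h1 hij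
  have := h1 hjk
  have := h1 hik
  have := h2 hij
  have := h2 hjk
  have := h2 hik
  simp only [List.nodup_cons, List.mem_cons, List.not_mem_nil, or_false, not_or, not_false_iff,
    List.nodup_nil, and_true]
  omega

/-- The differential squares to zero: disjoint crossings can be resolved in either order, and
crossings with a common strand cancel in threes. -/
theorem permD_permD (x : PermSpace n) : permD n (permD n x) = 0 := by
  classical
  suffices h : ∀ σ, permD n (resolveSum σ) = 0 by
    have : permD n ∘ₗ permD n = 0 := by
      ext σ : 2
      simp [permD_single, h]
    exact LinearMap.congr_fun this x
  intro σ
  let f : Sym2 (Fin n) × Sym2 (Fin n) → PermSpace n := fun p =>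
    pairCoeff σ p • Finsupp.single (σ * (swapSym p.1 * swapSym p.2)) 1
  let T : Finset (Sym2 (Fin n)) := Finset.univ.filter fun z => ¬ z.IsDiag
  have hD : permD n (resolveSum σ) = ∑ p ∈ T ×ˢ T, f p := by
    rw [resolveSum_eq_sum_sym2, map_sum, Finset.sum_product]
    refine Finset.sum_congr rfl fun z _ => ?_
    rw [map_smul, permD_single, resolveSum_eq_sum_sym2, Finset.smul_sum]
    refine Finset.sum_congr rfl fun z' _ => ?_
    rw [smul_smul, mul_assoc]
    rfl
  have hfr : ∀ p, f (rotatePair p) =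
      pairCoeff σ (rotatePair p) • Finsupp.single (σ * (swapSym p.1 * swapSym p.2)) 1 := by
    intro p
    simp only [f]
    congr 3
    change swapSym p.2 * swapSym (p.1.map (swapSym p.2)) = _
    rw [swapSym_map, ← mul_assoc, ← mul_assoc, swapSym_mul_self, one_mul]
    congr 1
    exact inv_eq_of_mul_eq_one_left (swapSym_mul_self _)
  have hadj : ∀ p : Sym2 (Fin n) × Sym2 (Fin n), Adjacent p → Adjacent (rotatePair p) := by
    rintro _ ⟨i, j, k, hij, hjk, hik, rfl⟩
    rw [rotatePair_adjacent hij hik]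
    exact ⟨j, k, i, hjk, hik.symm, hij.symm, rfl⟩
  have hadjT : ∀ p, Adjacent p → p ∈ T ×ˢ T := by
    rintro _ ⟨i, j, k, hij, hjk, hik, rfl⟩
    simp [T, hij, hjk]
  have hS : (T ×ˢ T).filter Adjacent = Finset.univ.filter Adjacent := by
    ext p
    simp only [Finset.mem_filter, Finset.mem_univ, true_and]
    exact ⟨fun h => h.2, fun h => ⟨hadjT p h, h⟩⟩
  have hadj' : ∀ p : Sym2 (Fin n) × Sym2 (Fin n), Adjacent (rotatePair p) → Adjacent p := by
    intro p hp
    have h3 : rotatePair (rotatePair (rotatePair p)) = p := by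
      obtain ⟨i, j, k, hij, hjk, hik, h⟩ := hp
      have h' : p = (s(k, i), s(i, j)) := by
        apply rotatePair.injective
        rw [h, rotatePair_adjacent hik.symm hjk.symm]
      rw [h', rotatePair_adjacent hik.symm hjk.symm, rotatePair_adjacent hij hik,
        rotatePair_adjacent hjk hij.symm]
    rw [← h3]
    exact hadj _ (hadj _ hp)
  have hrot : ∀ g : Sym2 (Fin n) × Sym2 (Fin n) → PermSpace n,
      ∑ p with Adjacent p, g (rotatePair p) = ∑ p with Adjacent p, g p := fun g =>
    Finset.sum_equiv rotatePair (fun p => by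
      simp only [Finset.mem_filter, Finset.mem_univ, true_and]
      exact ⟨hadj p, hadj' p⟩) fun _ _ => rfl
  rw [hD, ← Finset.sum_filter_add_sum_filter_not _ Adjacent, hS]
  have hA : ∑ p with Adjacent p, f p = 0 := by
    calc ∑ p with Adjacent p, f p
        = ∑ p with Adjacent p, f p + ∑ p with Adjacent p, f (rotatePair p) +
          ∑ p with Adjacent p, f (rotatePair (rotatePair p)) := by
          rw [hrot fun p => f (rotatePair p), hrot f, ZModModule.add_self, zero_add]
      _ = ∑ p with Adjacent p,
            (f p + f (rotatePair p) + f (rotatePair (rotatePair p))) := by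
          rw [Finset.sum_add_distrib, Finset.sum_add_distrib]
      _ = 0 := Finset.sum_eq_zero fun p hp => by
          have h1 := hfr (rotatePair p)
          have h2 : σ * (swapSym (rotatePair p).1 * swapSym (rotatePair p).2) =
              σ * (swapSym p.1 * swapSym p.2) := by
            change σ * (swapSym p.2 * swapSym (p.1.map (swapSym p.2))) = _
            rw [swapSym_map, ← mul_assoc (swapSym p.2), ← mul_assoc (swapSym p.2),
              swapSym_mul_self, one_mul, inv_eq_of_mul_eq_one_left (swapSym_mul_self _)]
          rw [h2] at h1
          rw [h1, hfr]
          simp only [f]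
          rw [← add_smul, ← add_smul, pairCoeff_rotate σ (Finset.mem_filter.1 hp).2, zero_smul]
  rw [hA, zero_add]
  have hsame : ∀ z : Sym2 (Fin n), ¬ z.IsDiag → pairCoeff σ (z, z) = 0 := by
    intro z
    induction z with | _ i j
    intro hz
    have hij : i ≠ j := hz
    have h1 : (i : ℕ) ≠ j := fun h => hij (Fin.ext h)
    have h2 : (σ i : ℕ) ≠ σ j := fun h => hij (σ.injective (Fin.ext h))
    simp only [pairCoeff, chordCrossSym_mk, swapSym_mk, chordCross, Equiv.Perm.mul_apply,
      Equiv.swap_apply_left, Equiv.swap_apply_right]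
    exact interleave_mul_exchange (by omega) (by omega) (by omega) (by omega) (by omega) (by omega)
  have hcase : ∀ p ∈ (T ×ˢ T).filter (fun p => ¬ Adjacent p),
      f p = 0 ∨ (p.1 ≠ p.2 ∧ f p = f p.swap) := by
    intro p hp
    simp only [Finset.mem_filter, Finset.mem_product, T, Finset.mem_univ, true_and] at hp
    rcases pair_cases p hp.1.1 hp.1.2 with h | h | ⟨i, j, k, l, hij, hkl, hik, hil, hjk, hjl, rfl⟩
    · left
      obtain ⟨z, z'⟩ := p
      dsimp only at h
      subst h
      simp only [f, hsame z hp.1.1, zero_smul]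
    · exact absurd h hp.2
    · right
      refine ⟨by simp [hik, hil], ?_⟩
      have hc : Equiv.swap i j * Equiv.swap k l = Equiv.swap k l * Equiv.swap i j :=
        (Equiv.Perm.disjoint_swap_swap (by simp [*])).commute
      simp only [f, pairCoeff, Prod.swap, chordCrossSym_mk, swapSym_mk, hc, chordCross,
        Equiv.Perm.mul_apply, Equiv.swap_apply_of_ne_of_ne hik.symm hjk.symm,
        Equiv.swap_apply_of_ne_of_ne hil.symm hjl.symm, Equiv.swap_apply_of_ne_of_ne hik hil,
        Equiv.swap_apply_of_ne_of_ne hjk hjl]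
      rw [mul_comm (interleave _ _ _ _)]
  refine Finset.sum_involution (fun p _ => p.swap) (fun p hp => ?_) (fun p hp h0 hs => ?_)
    (fun p hp => ?_) (fun p _ => Prod.swap_swap p)
  · rcases hcase p hp with h | h
    · have hp' : p.swap ∈ (T ×ˢ T).filter (fun p => ¬ Adjacent p) := by
        simp only [Finset.mem_filter, Finset.mem_product] at hp ⊢
        exact ⟨hp.1.symm, fun h => hp.2 h.swap⟩
      rcases hcase _ hp' with h' | h'
      · rw [h, h', add_zero]
      · rw [h'.2, Prod.swap_swap, h, add_zero]
    · rw [← h.2, ZModModule.add_self]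
  · rcases hcase p hp with h | h
    · exact h0 h
    · exact h.1 (congrArg Prod.snd hs)
  · simp only [Finset.mem_filter, Finset.mem_product] at hp ⊢
    exact ⟨hp.1.symm, fun h => hp.2 h.swap⟩

end StringHomology
end

noncomputable section
namespace StringHomology
variable {n : ℕ}

/-! ### Inserting a chord between adjacent marked points -/

/-- Make room for two new adjacent marked points at the labels `a` and `a + 1`. -/
def shiftLabel (a t : ℕ) : ℕ := if t < a then t else t + 2

theorem shiftLabel_strictMono (a : ℕ) : StrictMono (shiftLabel a) := by
  intro s t h
  simp only [shiftLabel]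
  split_ifs <;> omega

theorem ltBit_map {f : ℕ → ℕ} (hf : StrictMono f) (a b : ℕ) : ltBit (f a) (f b) = ltBit a b := by
  simp only [ltBit, hf.lt_iff_lt]

theorem interleave_map {f : ℕ → ℕ} (hf : StrictMono f) (a b c d : ℕ) :
    interleave (f a) (f b) (f c) (f d) = interleave a b c d := by
  simp only [interleave, ltBit_map hf]

/-- Insert a chord from the new incoming point `i` to the new outgoing point `0`. For `i = 0` and
`i = 1` its endpoints are adjacent on the circle. -/
def insertPerm (i : Fin (n + 1)) (σ : Equiv.Perm (Fin n)) : Equiv.Perm (Fin (n + 1)) :=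
  (finSuccEquiv' i).trans ((Equiv.optionCongr σ).trans (finSuccEquiv' 0).symm)

@[simp] theorem insertPerm_self (i : Fin (n + 1)) (σ : Equiv.Perm (Fin n)) :
    insertPerm i σ i = 0 := by
  simp [insertPerm]

@[simp] theorem insertPerm_succAbove (i : Fin (n + 1)) (σ : Equiv.Perm (Fin n)) (j : Fin n) :
    insertPerm i σ (i.succAbove j) = (σ j).succ := by
  simp [insertPerm]

theorem insertPerm_injective (i : Fin (n + 1)) :
    Function.Injective (insertPerm i : Equiv.Perm (Fin n) → _) := by
  intro σ τ h
  ext j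
  have := congrArg (fun e => e (i.succAbove j)) h
  simp only [insertPerm_succAbove, Fin.succ_inj] at this
  rw [this]

theorem exists_insertPerm {i : Fin (n + 1)} {σ : Equiv.Perm (Fin (n + 1))} (h : σ i = 0) :
    ∃ ρ, insertPerm i ρ = σ := by
  have hne : ∀ j, σ (i.succAbove j) ≠ 0 := fun j hj =>
    Fin.succAbove_ne i j (σ.injective (hj.trans h.symm))
  let f : Fin n → Fin n := fun j => (σ (i.succAbove j)).pred (hne j)
  have hf : Function.Injective f := fun j k hjk => by
    simpa [f, Fin.pred_inj] using hjk
  refine ⟨Equiv.ofBijective f (Finite.injective_iff_bijective.1 hf), Equiv.ext fun x => ?_⟩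
  rcases Fin.eq_self_or_eq_succAbove i x with rfl | ⟨j, rfl⟩
  · rw [insertPerm_self, h]
  · rw [insertPerm_succAbove]
    simp [f]

theorem insertPerm_mul_swap (i : Fin (n + 1)) (σ : Equiv.Perm (Fin n)) (j k : Fin n) :
    insertPerm i σ * Equiv.swap (i.succAbove j) (i.succAbove k) =
      insertPerm i (σ * Equiv.swap j k) := by
  ext x : 1
  rw [Equiv.Perm.mul_apply]
  rcases Fin.eq_self_or_eq_succAbove i x with rfl | ⟨l, rfl⟩
  · rw [Equiv.swap_apply_of_ne_of_ne (Fin.succAbove_ne _ _).symm (Fin.succAbove_ne _ _).symm]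
    simp
  · rw [(Fin.succAbove_right_injective (p := i)).swap_apply, insertPerm_succAbove,
      insertPerm_succAbove, Equiv.Perm.mul_apply]

theorem two_mul_succAbove {i : Fin (n + 1)} (hi : (i : ℕ) ≤ 1) (j : Fin n) :
    2 * (i.succAbove j : ℕ) = shiftLabel i (2 * j) := by
  rw [Fin.succAbove, shiftLabel]
  simp only [Fin.lt_def, Fin.val_castSucc]
  split_ifs <;> simp only [Fin.val_castSucc, Fin.val_succ] <;> omega

theorem two_mul_succ_add_one {i : Fin (n + 1)} (hi : (i : ℕ) ≤ 1) (k : Fin n) :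
    2 * (k.succ : ℕ) + 1 = shiftLabel i (2 * k + 1) := by
  rw [shiftLabel, if_neg (by omega), Fin.val_succ]
  omega

theorem chordCross_insertPerm {i : Fin (n + 1)} (hi : (i : ℕ) ≤ 1) (σ : Equiv.Perm (Fin n))
    (j k : Fin n) :
    chordCross (insertPerm i σ) (i.succAbove j) (i.succAbove k) = chordCross σ j k := by
  simp only [chordCross, insertPerm_succAbove, two_mul_succAbove hi, two_mul_succ_add_one hi]
  exact interleave_map (shiftLabel_strictMono _) _ _ _ _

/-- The inserted chord crosses no other chord. -/
theorem chordCross_insertPerm_self {i : Fin (n + 1)} (hi : (i : ℕ) ≤ 1) (σ : Equiv.Perm (Fin n))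
    (k : Fin n) : chordCross (insertPerm i σ) i (i.succAbove k) = 0 := by
  have h : (i.succAbove k : ℕ) ≠ i := fun h => Fin.succAbove_ne i k (Fin.ext h)
  simp only [chordCross, insertPerm_succAbove, insertPerm_self, interleave, ltBit,
    Fin.val_succ, Fin.val_zero]
  split_ifs <;> first | omega | decide

/-- The linear extension of `insertPerm`. -/
def insertMap (i : Fin (n + 1)) : PermSpace n →ₗ[ZMod 2] PermSpace (n + 1) :=
  Finsupp.lmapDomain _ _ (insertPerm i)

theorem insertMap_single (i : Fin (n + 1)) (σ : Equiv.Perm (Fin n)) (r : ZMod 2) :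
    insertMap i (Finsupp.single σ r) = Finsupp.single (insertPerm i σ) r := by
  simp [insertMap]

theorem resolveSum_eq (σ : Equiv.Perm (Fin n)) :
    resolveSum σ = ∑ i, ∑ j, if i < j then
      chordCross σ i j • (Finsupp.single (σ * Equiv.swap i j) 1 : PermSpace n) else 0 := by
  rw [resolveSum, Finset.sum_filter, ← Finset.univ_product_univ, Finset.sum_product]

theorem resolveSum_insertPerm {i : Fin (n + 1)} (hi : (i : ℕ) ≤ 1) (σ : Equiv.Perm (Fin n)) :
    resolveSum (insertPerm i σ) = insertMap i (resolveSum σ) := by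
  rw [resolveSum_eq, resolveSum_eq, Fin.sum_univ_succAbove _ i, map_sum, Finset.sum_eq_zero,
    zero_add]
  · refine Finset.sum_congr rfl fun j _ => ?_
    rw [Fin.sum_univ_succAbove _ i, chordCross_comm, chordCross_insertPerm_self hi, zero_smul,
      ite_self, zero_add, map_sum]
    refine Finset.sum_congr rfl fun k _ => ?_
    rw [chordCross_insertPerm hi, insertPerm_mul_swap, apply_ite (insertMap i), map_zero,
      map_smul, insertMap_single]
    simp only [Fin.succAbove_lt_succAbove_iff]
  · intro j _
    rcases Fin.eq_self_or_eq_succAbove i j with rfl | ⟨k, rfl⟩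
    · simp
    · rw [chordCross_insertPerm_self hi, zero_smul, ite_self]

theorem permD_insertMap {i : Fin (n + 1)} (hi : (i : ℕ) ≤ 1) (x : PermSpace n) :
    permD (n + 1) (insertMap i x) = insertMap i (permD n x) := by
  have : permD (n + 1) ∘ₗ insertMap i = insertMap i ∘ₗ permD n := by
    ext σ : 2
    simp only [LinearMap.comp_apply, Finsupp.lsingle_apply, insertMap_single, permD_single,
      resolveSum_insertPerm hi]
  exact LinearMap.congr_fun this x

theorem insertMap_add_injective {a a' b b' : PermSpace (n + 1)}
    (h : insertMap 0 a + insertMap 1 b = insertMap 0 a' + insertMap 1 b') : a = a' ∧ b = b' := by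
  have h01 : (0 : Fin (n + 2)) ≠ 1 := by simp
  have hval : ∀ (i : Fin (n + 2)) (x : PermSpace (n + 1)) (ρ : Equiv.Perm (Fin (n + 1))),
      insertMap i x (insertPerm i ρ) = x ρ := fun i x ρ =>
    Finsupp.mapDomain_apply (insertPerm_injective i) x ρ
  have hval' : ∀ (i j : Fin (n + 2)), i ≠ j → ∀ (x : PermSpace (n + 1))
      (ρ : Equiv.Perm (Fin (n + 1))), insertMap i x (insertPerm j ρ) = 0 := by
    intro i j hij x ρ
    refine Finsupp.mapDomain_of_notMem_range x _ ?_
    rintro ⟨σ, hσ⟩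
    have h1 : insertPerm j ρ i = 0 := by rw [← hσ, insertPerm_self]
    exact hij ((insertPerm j ρ).injective (h1.trans (insertPerm_self j ρ).symm))
  constructor
  · ext ρ
    have := congrArg (fun x : PermSpace (n + 2) => x (insertPerm 0 ρ)) h
    simpa only [Finsupp.add_apply, hval, hval' 1 0 h01.symm, add_zero] using this
  · ext ρ
    have := congrArg (fun x : PermSpace (n + 2) => x (insertPerm 1 ρ)) h
    simpa only [Finsupp.add_apply, hval, hval' 0 1 h01, zero_add] using this

/-! ### The energy of a permutation -/

/-- A strictly concave function of the distance of two points `a`, `b` on a circle of length `m`.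
The truncation `toNat` has no effect for `a`, `b` less than `m`. -/
def chordEnergy (m a b : ℕ) : ℕ := (|(a : ℤ) - b| * (m - |(a : ℤ) - b|)).toNat

theorem chordEnergy_cast {m a b : ℕ} (ha : a < m) (hb : b < m) :
    (chordEnergy m a b : ℤ) = |(a : ℤ) - b| * (m - |(a : ℤ) - b|) := by
  refine Int.toNat_of_nonneg (mul_nonneg (abs_nonneg _) (sub_nonneg.2 ?_))
  rw [abs_le]
  omega

theorem chordEnergy_comm (m a b : ℕ) : chordEnergy m a b = chordEnergy m b a := by
  rw [chordEnergy, chordEnergy, abs_sub_comm]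

/-- Crossing chords have more energy than either pair of parallel chords with the same
endpoints. -/
theorem chordEnergy_lt_of_lt {m p q r s : ℕ} (hpq : p < q) (hqr : q < r) (hrs : r < s)
    (hs : s < m) :
    chordEnergy m p q + chordEnergy m r s < chordEnergy m p r + chordEnergy m q s ∧
      chordEnergy m p s + chordEnergy m q r < chordEnergy m p r + chordEnergy m q s := by
  have e : ∀ x y : ℕ, x < y → y < m → (chordEnergy m x y : ℤ) = (y - x) * (m - (y - x)) :=
    fun x y h hy => by
      rw [chordEnergy_cast (by omega) hy, abs_sub_comm, abs_of_pos (by omega)]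
  zify at *
  rw [e p q (by omega) (by omega), e r s (by omega) (by omega), e p r (by omega) (by omega),
    e q s (by omega) (by omega), e p s (by omega) (by omega), e q r (by omega) (by omega)]
  have h1 : (0 : ℤ) < (q - p) * (s - r) := mul_pos (by omega) (by omega)
  have h2 : (0 : ℤ) < (r - q) * (m - (s - p)) := mul_pos (by omega) (by omega)
  constructor <;> nlinarith

/-- Exchanging the endpoints of two crossing chords lowers the total energy. -/
theorem chordEnergy_exchange {m a a' b b' : ℕ} (ha : a < m) (ha' : a' < m) (hb : b < m)
    (hb' : b' < m) (hab : a ≠ b) (hab' : a ≠ b') (ha'b : a' ≠ b) (ha'b' : a' ≠ b')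
    (h : interleave a a' b b' = 1) :
    chordEnergy m a b' + chordEnergy m b a' < chordEnergy m a a' + chordEnergy m b b' := by
  have key := @chordEnergy_lt_of_lt m
  have c₁ := chordEnergy_comm m a b'
  have c₂ := chordEnergy_comm m b a'
  have c₃ := chordEnergy_comm m a a'
  have c₄ := chordEnergy_comm m b b'
  rcases lt_or_gt_of_ne hab with h1 | h1 <;> rcases lt_or_gt_of_ne hab' with h2 | h2 <;>
    rcases lt_or_gt_of_ne ha'b with h3 | h3 <;> rcases lt_or_gt_of_ne ha'b' with h4 | h4 <;>
    (simp only [interleave, ltBit, h1, h2, h3, h4, h1.not_gt, h2.not_gt, h3.not_gt, h4.not_gt,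
      if_true, if_false] at h) <;>
    first
    | exact absurd h (by decide)
    | omega
    | have := key h1 h3 h4 hb'; omega
    | have := key h2 h4 h3 hb; omega
    | have := key h3 h1 h2 hb'; omega
    | have := key h4 h2 h1 hb; omega
    | have := key h1 h2 h4 ha'; omega
    | have := key h2 h1 h3 ha'; omega
    | have := key h3 h4 h2 ha; omega
    | have := key h4 h3 h1 ha; omega

/-- The total energy of the chords of a permutation. -/
def energy (σ : Equiv.Perm (Fin n)) : ℕ := ∑ i : Fin n, chordEnergy (2 * n) (2 * i) (2 * σ i + 1)

/-- Resolving a crossing lowers the energy. -/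
theorem energy_mul_swap_lt {σ : Equiv.Perm (Fin n)} {i j : Fin n} (hij : i ≠ j)
    (h : chordCross σ i j = 1) : energy (σ * Equiv.swap i j) < energy σ := by
  have h1 : (i : ℕ) ≠ j := fun h => hij (Fin.ext h)
  have h2 : (σ i : ℕ) ≠ σ j := fun h => hij (σ.injective (Fin.ext h))
  have key : ∀ τ : Equiv.Perm (Fin n), energy τ =
      ∑ k ∈ Finset.univ \ {i, j}, chordEnergy (2 * n) (2 * k) (2 * τ k + 1) +
        (chordEnergy (2 * n) (2 * i) (2 * τ i + 1) + chordEnergy (2 * n) (2 * j) (2 * τ j + 1)) :=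
    fun τ => by
      rw [energy, ← Finset.sum_sdiff (Finset.subset_univ {i, j}), Finset.sum_pair hij]
  rw [key, key]
  have hrest : ∑ k ∈ Finset.univ \ {i, j},
      chordEnergy (2 * n) (2 * k) (2 * (σ * Equiv.swap i j) k + 1) =
      ∑ k ∈ Finset.univ \ {i, j}, chordEnergy (2 * n) (2 * k) (2 * σ k + 1) := by
    refine Finset.sum_congr rfl fun k hk => ?_
    simp only [Finset.mem_sdiff, Finset.mem_insert, Finset.mem_singleton, not_or] at hk
    rw [Equiv.Perm.mul_apply, Equiv.swap_apply_of_ne_of_ne hk.2.1 hk.2.2]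
  rw [hrest]
  simp only [Equiv.Perm.mul_apply, Equiv.swap_apply_left, Equiv.swap_apply_right]
  have := chordEnergy_exchange (m := 2 * n) (by omega) (by omega) (by omega) (by omega) (by omega)
    (by omega) (by omega) (by omega) h
  omega

end StringHomology
end

noncomputable section
namespace StringHomology
variable {n : ℕ}

/-! ### Splitting off the chords at the outgoing point `0` -/

/-- Some chord joins the outgoing point `0`, which has label `1`, to one of its two neighbours, the
incoming points `0` and `1`. -/
def Attached (σ : Equiv.Perm (Fin (n + 2))) : Prop := σ 0 = 0 ∨ σ 1 = 0

/-- The subcomplex spanned by the attached permutations. -/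
def attachedSpace (n : ℕ) : Submodule (ZMod 2) (PermSpace (n + 2)) :=
  Finsupp.supported (ZMod 2) (ZMod 2) {σ | Attached σ}

theorem insertMap_mem_attachedSpace {i : Fin (n + 2)} (hi : i = 0 ∨ i = 1)
    (x : PermSpace (n + 1)) : insertMap i x ∈ attachedSpace n := by
  classical
  intro σ hσ
  obtain ⟨ρ, -, rfl⟩ := Finset.mem_image.1 (Finsupp.mapDomain_support hσ)
  rcases hi with rfl | rfl
  · exact Or.inl (insertPerm_self _ _)
  · exact Or.inr (insertPerm_self _ _)

theorem single_mem_attachedSpace {σ : Equiv.Perm (Fin (n + 2))} (h : Attached σ) (r : ZMod 2) :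
    Finsupp.single σ r ∈ attachedSpace n :=
  Finsupp.single_mem_supported _ _ h

theorem exists_insertMap_of_mem_attachedSpace {x : PermSpace (n + 2)} (hx : x ∈ attachedSpace n) :
    ∃ a b, x = insertMap 0 a + insertMap 1 b := by
  have h : attachedSpace n ≤ LinearMap.range (insertMap (n := n + 1) 0) ⊔
      LinearMap.range (insertMap (n := n + 1) 1) := by
    rw [attachedSpace, Finsupp.supported_eq_span_single, Submodule.span_le]
    rintro _ ⟨σ, hσ | hσ, rfl⟩
    · obtain ⟨ρ, rfl⟩ := exists_insertPerm hσ
      exact Submodule.mem_sup_left ⟨Finsupp.single ρ 1, insertMap_single _ _ _⟩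
    · obtain ⟨ρ, rfl⟩ := exists_insertPerm hσ
      exact Submodule.mem_sup_right ⟨Finsupp.single ρ 1, insertMap_single _ _ _⟩
  obtain ⟨_, ⟨a, rfl⟩, _, ⟨b, rfl⟩, rfl⟩ := Submodule.mem_sup.1 (h hx)
  exact ⟨a, b, rfl⟩

theorem permD_mem_attachedSpace {x : PermSpace (n + 2)} (hx : x ∈ attachedSpace n) :
    permD (n + 2) x ∈ attachedSpace n := by
  obtain ⟨a, b, rfl⟩ := exists_insertMap_of_mem_attachedSpace hx
  rw [map_add, permD_insertMap (by simp), permD_insertMap (by simp)]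
  exact add_mem (insertMap_mem_attachedSpace (Or.inl rfl) _)
    (insertMap_mem_attachedSpace (Or.inr rfl) _)

/-- The permutation with the targets of the incoming points `0` and `1` exchanged. -/
def exchange (σ : Equiv.Perm (Fin (n + 2))) : Equiv.Perm (Fin (n + 2)) := σ * Equiv.swap 0 1

@[simp] theorem exchange_exchange (σ : Equiv.Perm (Fin (n + 2))) :
    exchange (exchange σ) = σ := by
  simp [exchange, mul_assoc]

theorem attached_exchange {σ : Equiv.Perm (Fin (n + 2))} : Attached (exchange σ) ↔ Attached σ := by
  simp [Attached, exchange, or_comm]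

/-- The smaller of the energies of a permutation and its exchange. -/
def minEnergy (σ : Equiv.Perm (Fin (n + 2))) : ℕ := min (energy σ) (energy (exchange σ))

theorem minEnergy_exchange (σ : Equiv.Perm (Fin (n + 2))) :
    minEnergy (exchange σ) = minEnergy σ := by
  rw [minEnergy, exchange_exchange, min_comm, minEnergy]

/-- If the outgoing point `0` is not attached, then of `σ` and its exchange exactly one has a
crossing of the chords at the incoming points `0` and `1`. -/
theorem chordCross_exchange {σ : Equiv.Perm (Fin (n + 2))} (h : ¬ Attached σ) :
    chordCross (exchange σ) 0 1 = 1 + chordCross σ 0 1 := by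
  obtain ⟨h0, h1⟩ := not_or.1 h
  have h0' : (σ 0 : ℕ) ≠ 0 := fun h => h0 (Fin.ext h)
  have h1' : (σ 1 : ℕ) ≠ 0 := fun h => h1 (Fin.ext h)
  have h01 : (σ 0 : ℕ) ≠ σ 1 := fun h => by
    have := σ.injective (Fin.ext h)
    simp at this
  have key : ∀ y z : ℕ, y ≠ 0 → z ≠ 0 → y ≠ z →
      interleave 0 (2 * z + 1) 2 (2 * y + 1) = 1 + interleave 0 (2 * y + 1) 2 (2 * z + 1) := by
    intro y z hy hz hyz
    simp only [interleave, ltBit]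
    split_ifs <;> first | omega | decide
  simpa [chordCross, exchange] using key _ _ h0' h1' h01

theorem ltBit_zero_two {x : ℕ} (h : 2 < x) : ltBit 0 x = ltBit 2 x := by
  rw [ltBit, ltBit, if_pos (by omega), if_pos h]

/-- Away from the crossing of the chords at the incoming points `0` and `1`, resolving a crossing
either attaches the outgoing point `0` or lowers `minEnergy`: the same resolution can be carried out
on the exchanged permutation. -/
theorem minEnergy_mul_swap {σ : Equiv.Perm (Fin (n + 2))} {i j : Fin (n + 2)} (hij : i < j)
    (h01 : ¬ (i = 0 ∧ j = 1)) (h : chordCross σ i j = 1) :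
    Attached (σ * Equiv.swap i j) ∨ minEnergy (σ * Equiv.swap i j) < minEnergy σ := by
  by_cases hE : energy σ ≤ energy (exchange σ)
  · right
    rw [minEnergy, minEnergy, min_eq_left hE]
    exact (min_le_left _ _).trans_lt (energy_mul_swap_lt hij.ne h)
  suffices Attached (σ * Equiv.swap i j) ∨ ∃ i' j', i' ≠ j' ∧ chordCross (exchange σ) i' j' = 1 ∧
      exchange (σ * Equiv.swap i j) = exchange σ * Equiv.swap i' j' by
    refine this.imp_right ?_
    rintro ⟨i', j', hij', hc, he⟩
    rw [minEnergy, minEnergy, min_eq_right (not_le.1 hE).le, he]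
    exact (min_le_right _ _).trans_lt (energy_mul_swap_lt hij' hc)
  have hcomm : ∀ i' j' : Fin (n + 2), Equiv.swap (0 : Fin (n + 2)) 1 i' = i →
      Equiv.swap (0 : Fin (n + 2)) 1 j' = j →
      exchange (σ * Equiv.swap i j) = exchange σ * Equiv.swap i' j' := by
    rintro i' j' rfl rfl
    rw [exchange, exchange, mul_assoc, mul_assoc, Equiv.mul_swap_eq_swap_mul _ i' j']
  have hj0 : j ≠ 0 := (Fin.zero_le i |>.trans_lt hij).ne'
  have hcross : ∀ k : Fin (n + 2), k ≠ 0 → k ≠ 1 → σ k ≠ 0 → ∀ y : ℕ,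
      interleave 0 y (2 * k) (2 * σ k + 1) = interleave 2 y (2 * k) (2 * σ k + 1) := by
    intro k hk0 hk1 hk y
    have e0 : (k : ℕ) ≠ 0 := fun h => hk0 (Fin.ext h)
    have e1 : (k : ℕ) ≠ 1 := fun h => hk1 (Fin.ext (by simpa using h))
    have e2 : (σ k : ℕ) ≠ 0 := fun h => hk (Fin.ext h)
    rw [interleave, interleave, ltBit_zero_two (by omega), ltBit_zero_two (by omega)]
  by_cases hi0 : i = 0
  · subst hi0
    have hj1 : j ≠ 1 := fun hj => h01 ⟨rfl, hj⟩
    by_cases hj : σ j = 0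
    · exact Or.inl (Or.inl (by simpa using hj))
    · refine Or.inr ⟨1, j, hj1.symm, ?_, hcomm _ _ (by simp)
        (Equiv.swap_apply_of_ne_of_ne hj0 hj1)⟩
      rw [← h]
      simp only [chordCross, exchange, Equiv.Perm.mul_apply, Equiv.swap_apply_right,
        Equiv.swap_apply_of_ne_of_ne hj0 hj1, Fin.val_zero, Fin.val_one, mul_zero, mul_one]
      rw [hcross j hj0 hj1 hj]
  have hj1 : j ≠ 1 := by
    rintro rfl
    exact hi0 (Fin.ext (by simpa [Fin.lt_def] using hij))
  by_cases hi1 : i = 1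
  · subst hi1
    by_cases hj : σ j = 0
    · exact Or.inl (Or.inr (by simpa using hj))
    · refine Or.inr ⟨0, j, hj0.symm, ?_, hcomm _ _ (by simp)
        (Equiv.swap_apply_of_ne_of_ne hj0 hj1)⟩
      rw [← h]
      simp only [chordCross, exchange, Equiv.Perm.mul_apply, Equiv.swap_apply_left,
        Equiv.swap_apply_of_ne_of_ne hj0 hj1, Fin.val_zero, Fin.val_one, mul_zero, mul_one]
      rw [hcross j hj0 hj1 hj]
  · refine Or.inr ⟨i, j, hij.ne, ?_, hcomm _ _ (Equiv.swap_apply_of_ne_of_ne hi0 hi1)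
      (Equiv.swap_apply_of_ne_of_ne hj0 hj1)⟩
    rw [← h]
    simp only [chordCross, exchange, Equiv.Perm.mul_apply,
      Equiv.swap_apply_of_ne_of_ne hi0 hi1, Equiv.swap_apply_of_ne_of_ne hj0 hj1]

/-- The filtration of the permutation space, relative to the attached permutations, by
`minEnergy`. -/
def energyFiltration (n k : ℕ) : Submodule (ZMod 2) (PermSpace (n + 2)) :=
  Finsupp.supported (ZMod 2) (ZMod 2) {σ | Attached σ ∨ minEnergy σ < k}

theorem energyFiltration_mono {k l : ℕ} (h : k ≤ l) :
    energyFiltration n k ≤ energyFiltration n l :=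
  Finsupp.supported_mono fun _ hσ => hσ.imp_right fun h' => h'.trans_le h

theorem attachedSpace_le_energyFiltration (k : ℕ) : attachedSpace n ≤ energyFiltration n k :=
  Finsupp.supported_mono fun _ hσ => Or.inl hσ

theorem energyFiltration_zero : energyFiltration n 0 = attachedSpace n := by
  simp [energyFiltration, attachedSpace]

/-- The contracting homotopy: exchange the targets of the incoming points `0` and `1` if this
creates a crossing of their chords. -/
def exchangeHomotopy (n : ℕ) : PermSpace (n + 2) →ₗ[ZMod 2] PermSpace (n + 2) :=
  Finsupp.linearCombination (ZMod 2) fun σ =>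
    open scoped Classical in
    if Attached σ ∨ chordCross σ 0 1 = 1 then 0 else Finsupp.single (exchange σ) 1

theorem exchangeHomotopy_single_of {σ : Equiv.Perm (Fin (n + 2))}
    (h : Attached σ ∨ chordCross σ 0 1 = 1) :
    exchangeHomotopy n (Finsupp.single σ 1) = 0 := by
  rw [exchangeHomotopy, Finsupp.linearCombination_single, if_pos h, smul_zero]

theorem exchangeHomotopy_single_of_not {σ : Equiv.Perm (Fin (n + 2))}
    (h : ¬ Attached σ) (h' : chordCross σ 0 1 = 0) :
    exchangeHomotopy n (Finsupp.single σ 1) = Finsupp.single (exchange σ) 1 := by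
  rw [exchangeHomotopy, Finsupp.linearCombination_single, if_neg (by simp [h, h']), one_smul]

theorem exchangeHomotopy_attachedSpace {x : PermSpace (n + 2)} (hx : x ∈ attachedSpace n) :
    exchangeHomotopy n x = 0 := by
  have : attachedSpace n ≤ LinearMap.ker (exchangeHomotopy n) := by
    rw [attachedSpace, Finsupp.supported_eq_span_single, Submodule.span_le]
    rintro _ ⟨σ, hσ, rfl⟩
    exact exchangeHomotopy_single_of (Or.inl hσ)
  exact this hx

theorem zmod_two_cases (x : ZMod 2) : x = 0 ∨ x = 1 := by
  revert x
  decide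

theorem exchangeHomotopy_energyFiltration {k : ℕ} {x : PermSpace (n + 2)}
    (hx : x ∈ energyFiltration n k) : exchangeHomotopy n x ∈ energyFiltration n k := by
  have : energyFiltration n k ≤ (energyFiltration n k).comap (exchangeHomotopy n) := by
    conv_lhs => rw [energyFiltration, Finsupp.supported_eq_span_single]
    rw [Submodule.span_le]
    rintro _ ⟨σ, hσ, rfl⟩
    change exchangeHomotopy n (Finsupp.single σ 1) ∈ energyFiltration n k
    by_cases h : Attached σ
    · rw [exchangeHomotopy_single_of (Or.inl h)]
      exact zero_mem _
    rcases zmod_two_cases (chordCross σ 0 1) with h' | h'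
    · rw [exchangeHomotopy_single_of_not h h']
      refine Finsupp.single_mem_supported _ _ (Or.inr ?_)
      rw [minEnergy_exchange]
      exact hσ.resolve_left h
    · rw [exchangeHomotopy_single_of (Or.inr h')]
      exact zero_mem _
  exact this hx

/-- Up to terms of lower filtration, the differential resolves only the crossing of the chords at
the incoming points `0` and `1`. -/
theorem resolveSum_sub_mem (σ : Equiv.Perm (Fin (n + 2))) :
    ∃ r ∈ energyFiltration n (minEnergy σ),
      resolveSum σ = chordCross σ 0 1 • Finsupp.single (exchange σ) 1 + r := by
  rw [resolveSum, ← Finset.add_sum_erase _ _ (a := ((0, 1) : Fin (n + 2) × Fin (n + 2)))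
    (by simp)]
  refine ⟨_, sum_mem fun p hp => ?_, rfl⟩
  obtain ⟨i, j⟩ := p
  simp only [Finset.mem_erase, Finset.mem_filter, Finset.mem_univ, true_and, ne_eq,
    Prod.mk.injEq] at hp
  rcases zmod_two_cases (chordCross σ i j) with h | h
  · dsimp only
    rw [h, zero_smul]
    exact zero_mem _
  · exact Submodule.smul_mem _ _ (Finsupp.single_mem_supported _ _
      (minEnergy_mul_swap hp.2 hp.1 h))

/-- `D h + h D` is the identity up to terms of lower filtration. -/
theorem homotopy_mem_energyFiltration {k : ℕ} {x : PermSpace (n + 2)}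
    (hx : x ∈ energyFiltration n (k + 1)) :
    permD (n + 2) (exchangeHomotopy n x) + exchangeHomotopy n (permD (n + 2) x) + x ∈
      energyFiltration n k := by
  have : energyFiltration n (k + 1) ≤ (energyFiltration n k).comap
      (permD (n + 2) ∘ₗ exchangeHomotopy n + exchangeHomotopy n ∘ₗ permD (n + 2) +
        LinearMap.id) := by
    conv_lhs => rw [energyFiltration, Finsupp.supported_eq_span_single]
    rw [Submodule.span_le]
    rintro _ ⟨σ, hσ, rfl⟩
    change permD (n + 2) (exchangeHomotopy n (Finsupp.single σ 1)) +
      exchangeHomotopy n (permD (n + 2) (Finsupp.single σ 1)) + Finsupp.single σ 1 ∈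
        energyFiltration n k
    by_cases h : Attached σ
    · have h1 := single_mem_attachedSpace h 1
      rw [exchangeHomotopy_attachedSpace h1,
        exchangeHomotopy_attachedSpace (permD_mem_attachedSpace h1), map_zero, zero_add, zero_add]
      exact attachedSpace_le_energyFiltration k h1
    · have hk : minEnergy σ ≤ k := Nat.lt_succ_iff.1 (hσ.resolve_left h)
      have hex := chordCross_exchange h
      have hσ' : ¬ Attached (exchange σ) := fun h' => h (attached_exchange.1 h')
      obtain ⟨r, hr, hr'⟩ := resolveSum_sub_mem σ
      have hhr := exchangeHomotopy_energyFiltration hr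
      refine energyFiltration_mono hk ?_
      rcases zmod_two_cases (chordCross σ 0 1) with h' | h'
      · obtain ⟨s, hs, hs'⟩ := resolveSum_sub_mem (exchange σ)
        rw [minEnergy_exchange] at hs
        rw [exchangeHomotopy_single_of_not h h', permD_single, permD_single, hr', hs', hex, h',
          exchange_exchange, zero_smul, zero_add, add_zero, one_smul]
        have : Finsupp.single σ 1 + s + exchangeHomotopy n r + Finsupp.single σ 1 =
            (Finsupp.single σ 1 + Finsupp.single σ 1) + (s + exchangeHomotopy n r) := by abel
        rw [this, ZModModule.add_self, zero_add]
        exact add_mem hs hhr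
      · rw [h', show (1 : ZMod 2) + 1 = 0 by decide] at hex
        rw [exchangeHomotopy_single_of (Or.inr h'), permD_single, hr', h', one_smul, map_add,
          exchangeHomotopy_single_of_not hσ' hex, exchange_exchange, map_zero, zero_add]
        rw [add_right_comm, ZModModule.add_self, zero_add]
        exact hhr
  exact this hx

/-- The quotient of the permutation complex by the attached permutations is acyclic. -/
theorem exists_add_permD_mem_attachedSpace {x : PermSpace (n + 2)}
    (hx : permD (n + 2) x ∈ attachedSpace n) :
    ∃ y, x + permD (n + 2) y ∈ attachedSpace n := by
  have key : ∀ k : ℕ, ∀ x ∈ energyFiltration n k, permD (n + 2) x ∈ attachedSpace n →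
      ∃ y, x + permD (n + 2) y ∈ attachedSpace n := by
    intro k
    induction k with
    | zero =>
      intro x hx _
      exact ⟨0, by rwa [map_zero, add_zero, ← energyFiltration_zero]⟩
    | succ k ih =>
      intro x hx hd
      have h1 := homotopy_mem_energyFiltration hx
      rw [exchangeHomotopy_attachedSpace hd, add_zero, add_comm _ x] at h1
      obtain ⟨y, hy⟩ := ih _ h1 (by rwa [map_add, permD_permD, add_zero])
      exact ⟨exchangeHomotopy n x + y, by rwa [map_add, ← add_assoc]⟩
  refine key (∑ σ : Equiv.Perm (Fin (n + 2)), minEnergy σ + 1) x (fun σ _ => Or.inr ?_) hx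
  exact Nat.lt_succ_iff.2 (Finset.single_le_sum (fun _ _ => Nat.zero_le _) (Finset.mem_univ σ))

end StringHomology
end

noncomputable section
namespace StringHomology
variable {n : ℕ}

/-! ### Chord diagrams as permutations without crossings -/

/-- The label of the `i`-th incoming point. -/
def inLabel (i : Fin n) : Fin (2 * n) := ⟨2 * i, by omega⟩

/-- The label of the `k`-th outgoing point. -/
def outLabel (k : Fin n) : Fin (2 * n) := ⟨2 * k + 1, by omega⟩

theorem inLabel_injective : Function.Injective (inLabel : Fin n → _) := fun i j h => by
  simp only [inLabel, Fin.mk.injEq] at h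
  omega

theorem outLabel_injective : Function.Injective (outLabel : Fin n → _) := fun i j h => by
  simp only [outLabel, Fin.mk.injEq] at h
  omega

theorem inLabel_ne_outLabel (i k : Fin n) : inLabel i ≠ outLabel k := fun h => by
  simp only [inLabel, outLabel, Fin.mk.injEq] at h
  omega

theorem label_cases (a : Fin (2 * n)) : (∃ i, a = inLabel i) ∨ ∃ k, a = outLabel k := by
  rcases Nat.mod_two_eq_zero_or_one a with h | h
  · exact Or.inl ⟨⟨a / 2, by omega⟩, Fin.ext (by simp only [inLabel]; omega)⟩
  · exact Or.inr ⟨⟨a / 2, by omega⟩, Fin.ext (by simp only [outLabel]; omega)⟩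

namespace ChordDiagram

/-- The points between the two ends of a chord are matched with each other, so that there is an
even number of them. -/
theorem odd_sub_of_lt (Γ : ChordDiagram n) {a : Fin (2 * n)} (h : a < Γ.partner a) :
    ((Γ.partner a : ℕ) - a) % 2 = 1 := by
  have hsum : ∑ _b ∈ Finset.Ioo a (Γ.partner a), (1 : ZMod 2) = 0 := by
    refine Finset.sum_involution (fun b _ => Γ.partner b) (fun _ _ => by decide)
      (fun b _ _ => Γ.partner_ne b) (fun b hb => ?_) (fun b _ => Γ.partner_partner b)
    rw [Finset.mem_Ioo] at hb ⊢
    have h1 := Γ.noncrossing a b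
    have h2 := Γ.noncrossing (Γ.partner b) a
    rw [Γ.partner_partner] at h2
    have h3 : Γ.partner b ≠ a := fun h' => by
      rw [← h', Γ.partner_partner] at hb
      exact lt_irrefl _ hb.2
    have h4 : Γ.partner b ≠ Γ.partner a := fun h' => by
      have := congrArg Γ.partner h'
      rw [Γ.partner_partner, Γ.partner_partner] at this
      exact hb.1.ne' this
    constructor
    · by_contra hlt
      exact h2 ⟨lt_of_le_of_ne (not_lt.1 hlt) h3, hb.1, hb.2⟩
    · by_contra hlt
      exact h1 ⟨hb.1, hb.2, lt_of_le_of_ne (not_lt.1 hlt) h4.symm⟩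
  rw [Finset.sum_const, Fin.card_Ioo, nsmul_one, ZMod.natCast_eq_zero_iff] at hsum
  have : (a : ℕ) < Γ.partner a := h
  omega

theorem partner_parity (Γ : ChordDiagram n) (a : Fin (2 * n)) :
    ((Γ.partner a : ℕ) + a) % 2 = 1 := by
  rcases lt_or_gt_of_ne (Γ.partner_ne a) with h | h
  · have := Γ.odd_sub_of_lt (a := Γ.partner a) (by rwa [Γ.partner_partner])
    rw [Γ.partner_partner] at this
    have : (Γ.partner a : ℕ) < a := h
    omega
  · have := Γ.odd_sub_of_lt h
    have : (a : ℕ) < Γ.partner a := h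
    omega

/-- The permutation of a chord diagram, whose chords join incoming to outgoing points. -/
def toPerm (Γ : ChordDiagram n) : Equiv.Perm (Fin n) where
  toFun i := ⟨(Γ.partner (inLabel i) : ℕ) / 2, by omega⟩
  invFun k := ⟨(Γ.partner (outLabel k) : ℕ) / 2, by omega⟩
  left_inv i := by
    have h := Γ.partner_parity (inLabel i)
    have : outLabel ⟨(Γ.partner (inLabel i) : ℕ) / 2, by omega⟩ = Γ.partner (inLabel i) := by
      simp only [inLabel] at h
      exact Fin.ext (by simp only [outLabel, inLabel]; omega)
    simp only [this, Γ.partner_partner]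
    exact Fin.ext (by simp [inLabel])
  right_inv k := by
    have h := Γ.partner_parity (outLabel k)
    have : inLabel ⟨(Γ.partner (outLabel k) : ℕ) / 2, by omega⟩ = Γ.partner (outLabel k) := by
      simp only [outLabel] at h
      exact Fin.ext (by simp only [outLabel, inLabel]; omega)
    simp only [this, Γ.partner_partner]
    exact Fin.ext (by simp only [outLabel]; omega)

theorem partner_inLabel (Γ : ChordDiagram n) (i : Fin n) :
    Γ.partner (inLabel i) = outLabel (Γ.toPerm i) := by
  have h := Γ.partner_parity (inLabel i)
  simp only [inLabel] at h
  exact Fin.ext (by simp only [outLabel, inLabel, toPerm, Equiv.coe_fn_mk]; omega)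

theorem partner_outLabel (Γ : ChordDiagram n) (i : Fin n) :
    Γ.partner (outLabel (Γ.toPerm i)) = inLabel i := by
  rw [← partner_inLabel, Γ.partner_partner]

theorem partner_outLabel_eq_iff (Γ : ChordDiagram n) (i k : Fin n) :
    Γ.partner (outLabel k) = inLabel i ↔ Γ.toPerm i = k := by
  constructor
  · intro h
    rw [← outLabel_injective.eq_iff, ← partner_inLabel, ← h, Γ.partner_partner]
  · rintro rfl
    exact Γ.partner_outLabel i

theorem toPerm_injective : Function.Injective (toPerm : ChordDiagram n → _) := by
  intro Γ Γ' h
  ext a : 2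
  rcases label_cases a with ⟨i, rfl⟩ | ⟨k, rfl⟩
  · rw [partner_inLabel, partner_inLabel, h]
  · obtain ⟨i, rfl⟩ := Γ.toPerm.surjective k
    rw [partner_outLabel, h, partner_outLabel]

end ChordDiagram

/-- No two chords of the permutation cross. -/
def Noncrossing (σ : Equiv.Perm (Fin n)) : Prop := ∀ i j, i ≠ j → chordCross σ i j = 0

theorem ChordDiagram.noncrossing_toPerm (Γ : ChordDiagram n) : Noncrossing Γ.toPerm := by
  intro i j hij
  have h1 := Γ.noncrossing (inLabel i) (inLabel j)
  have h2 := Γ.noncrossing (inLabel i) (outLabel (Γ.toPerm j))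
  have h3 := Γ.noncrossing (outLabel (Γ.toPerm i)) (inLabel j)
  have h4 := Γ.noncrossing (outLabel (Γ.toPerm i)) (outLabel (Γ.toPerm j))
  have h5 := Γ.noncrossing (inLabel j) (inLabel i)
  have h6 := Γ.noncrossing (outLabel (Γ.toPerm j)) (inLabel i)
  have h7 := Γ.noncrossing (inLabel j) (outLabel (Γ.toPerm i))
  have h8 := Γ.noncrossing (outLabel (Γ.toPerm j)) (outLabel (Γ.toPerm i))
  have e1 : (i : ℕ) ≠ j := fun h => hij (Fin.ext h)
  have e2 : (Γ.toPerm i : ℕ) ≠ Γ.toPerm j := fun h => hij (Γ.toPerm.injective (Fin.ext h))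
  simp only [partner_inLabel, partner_outLabel] at h1 h2 h3 h4 h5 h6 h7 h8
  simp only [inLabel, outLabel, Fin.mk_lt_mk] at h1 h2 h3 h4 h5 h6 h7 h8
  simp only [chordCross, interleave, ltBit]
  split_ifs <;> first | rfl | (exfalso; omega)

/-- The chord diagram of a permutation without crossings. -/
def ofPerm (σ : Equiv.Perm (Fin n)) (hσ : Noncrossing σ) : ChordDiagram n where
  partner a := if (a : ℕ) % 2 = 0 then outLabel (σ ⟨a / 2, by omega⟩)
    else inLabel (σ⁻¹ ⟨a / 2, by omega⟩)
  partner_partner a := by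
    rcases label_cases a with ⟨i, rfl⟩ | ⟨k, rfl⟩
    · simp [inLabel, outLabel, Nat.mul_add_div]
    · simp [inLabel, outLabel, Nat.mul_add_div]
  partner_ne a := by
    rcases label_cases a with ⟨i, rfl⟩ | ⟨k, rfl⟩
    · simp [inLabel, outLabel]; omega
    · simp [inLabel, outLabel]; omega
  noncrossing a b := by
    have key : ∀ a : Fin (2 * n), ∃ i, (a = inLabel i ∧
        (if (a : ℕ) % 2 = 0 then outLabel (σ ⟨a / 2, by omega⟩)
          else inLabel (σ⁻¹ ⟨a / 2, by omega⟩)) = outLabel (σ i)) ∨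
        (a = outLabel (σ i) ∧ (if (a : ℕ) % 2 = 0 then outLabel (σ ⟨a / 2, by omega⟩)
          else inLabel (σ⁻¹ ⟨a / 2, by omega⟩)) = inLabel i) := by
      intro a
      rcases label_cases a with ⟨i, rfl⟩ | ⟨k, rfl⟩
      · exact ⟨i, Or.inl ⟨rfl, by simp [inLabel]⟩⟩
      · exact ⟨σ⁻¹ k, Or.inr ⟨by simp, by
          simp [outLabel, Nat.mul_add_div]⟩⟩
    obtain ⟨i, hi⟩ := key a
    obtain ⟨j, hj⟩ := key b
    rintro ⟨h1, h2, h3⟩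
    have hij : i ≠ j := by
      rintro rfl
      rcases hi with ⟨ha, ha'⟩ | ⟨ha, ha'⟩ <;> rcases hj with ⟨hb, hb'⟩ | ⟨hb, hb'⟩ <;>
        rw [ha'] at h2 h3 <;> rw [hb'] at h3 <;> rw [ha] at h1 <;> rw [hb] at h1 h2 <;>
        first | exact lt_irrefl _ h1 | exact lt_irrefl _ h2
    have hc := hσ i j hij
    have e1 : (i : ℕ) ≠ j := fun h => hij (Fin.ext h)
    have e2 : (σ i : ℕ) ≠ σ j := fun h => hij (σ.injective (Fin.ext h))
    revert hc
    simp only [chordCross, interleave, ltBit]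
    rcases hi with ⟨ha, ha'⟩ | ⟨ha, ha'⟩ <;> rcases hj with ⟨hb, hb'⟩ | ⟨hb, hb'⟩ <;>
      rw [ha'] at h2 h3 <;> rw [hb'] at h3 <;> rw [ha] at h1 <;> rw [hb] at h1 h2 <;>
      simp only [inLabel, outLabel, Fin.mk_lt_mk] at h1 h2 h3 <;>
      split_ifs <;> first | (exfalso; omega) | decide

@[simp] theorem toPerm_ofPerm (σ : Equiv.Perm (Fin n)) (hσ : Noncrossing σ) :
    (ofPerm σ hσ).toPerm = σ := by
  ext i : 1
  apply outLabel_injective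
  rw [← ChordDiagram.partner_inLabel]
  simp [ofPerm, inLabel]

theorem resolveSum_eq_zero {σ : Equiv.Perm (Fin n)} (hσ : Noncrossing σ) : resolveSum σ = 0 :=
  Finset.sum_eq_zero fun p hp => by
    rw [hσ _ _ (Finset.mem_filter.1 hp).2.ne, zero_smul]

theorem noncrossing_insertPerm {i : Fin (n + 1)} (hi : (i : ℕ) ≤ 1) {σ : Equiv.Perm (Fin n)} :
    Noncrossing (insertPerm i σ) ↔ Noncrossing σ := by
  constructor
  · intro h j k hjk
    rw [← chordCross_insertPerm hi]
    exact h _ _ fun h' => hjk (Fin.succAbove_right_injective h')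
  · intro h j k hjk
    rcases Fin.eq_self_or_eq_succAbove i j with rfl | ⟨j, rfl⟩
    · rcases Fin.eq_self_or_eq_succAbove j k with rfl | ⟨k, rfl⟩
      · exact absurd rfl hjk
      · exact chordCross_insertPerm_self hi σ k
    · rcases Fin.eq_self_or_eq_succAbove i k with rfl | ⟨k, rfl⟩
      · rw [chordCross_comm]
        exact chordCross_insertPerm_self hi σ j
      · rw [chordCross_insertPerm hi]
        exact h _ _ fun h' => hjk (by rw [h'])

/-- Insert a chord between the incoming point `i` and the outgoing point `0` into a chord
diagram. -/
def insertChord (i : Fin (n + 1)) (hi : (i : ℕ) ≤ 1) (Γ : ChordDiagram n) : ChordDiagram (n + 1) :=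
  ofPerm (insertPerm i Γ.toPerm) ((noncrossing_insertPerm hi).2 Γ.noncrossing_toPerm)

theorem exists_insertChord {i : Fin (n + 1)} (hi : (i : ℕ) ≤ 1) {Γ : ChordDiagram (n + 1)}
    (h : Γ.toPerm i = 0) : ∃ Γ', insertChord i hi Γ' = Γ := by
  obtain ⟨ρ, hρ⟩ := exists_insertPerm h
  refine ⟨ofPerm ρ ((noncrossing_insertPerm hi).1 (hρ ▸ Γ.noncrossing_toPerm)),
    ChordDiagram.toPerm_injective ?_⟩
  simp [insertChord, hρ]

/-! ### Bypass triples -/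

/-- Outside the hexagon it suffices to compare the diagrams at the incoming points: the hexagon is a
union of chords, so a chord with one end outside it has both ends outside. -/
theorem isBypassTriple_iff_inLabel {Γ Γ' Γ'' : ChordDiagram n} : IsBypassTriple Γ Γ' Γ'' ↔
    ∃ p : Fin 6 → Fin (2 * n), StrictMono p ∧
    (Γ.partner (p 0) = p 1 ∧ Γ.partner (p 2) = p 5 ∧ Γ.partner (p 3) = p 4) ∧
    (Γ'.partner (p 1) = p 2 ∧ Γ'.partner (p 0) = p 3 ∧ Γ'.partner (p 4) = p 5) ∧
    (Γ''.partner (p 2) = p 3 ∧ Γ''.partner (p 1) = p 4 ∧ Γ''.partner (p 0) = p 5) ∧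
    ∀ i, inLabel i ∉ Set.range p → Γ.toPerm i = Γ'.toPerm i ∧ Γ.toPerm i = Γ''.toPerm i := by
  refine exists_congr fun p => and_congr_right fun hp => and_congr_right fun h1 =>
    and_congr_right fun h2 => and_congr_right fun h3 => ⟨fun h i hi => ?_, fun h a ha => ?_⟩
  · have := h _ hi
    simp only [ChordDiagram.partner_inLabel, outLabel_injective.eq_iff] at this
    exact this
  · rcases label_cases a with ⟨i, rfl⟩ | ⟨k, rfl⟩
    · simp only [ChordDiagram.partner_inLabel, outLabel_injective.eq_iff]
      exact h i ha
    · obtain ⟨i, rfl⟩ := Γ.toPerm.surjective k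
      have hi : inLabel i ∉ Set.range p := by
        rintro ⟨m, hm⟩
        have hk : Γ.partner (p m) = outLabel (Γ.toPerm i) := by
          rw [hm, ChordDiagram.partner_inLabel]
        have hback : ∀ {x y}, Γ.partner x = y → Γ.partner y = x := fun h => by
          rw [← h, Γ.partner_partner]
        apply ha
        rw [← hk]
        fin_cases m
        · exact ⟨1, h1.1.symm⟩
        · exact ⟨0, (hback h1.1).symm⟩
        · exact ⟨5, h1.2.1.symm⟩
        · exact ⟨4, h1.2.2.symm⟩
        · exact ⟨3, (hback h1.2.2).symm⟩
        · exact ⟨2, (hback h1.2.1).symm⟩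
      obtain ⟨e1, e2⟩ := h i hi
      constructor
      · rw [ChordDiagram.partner_outLabel, eq_comm, ChordDiagram.partner_outLabel_eq_iff, e1]
      · rw [ChordDiagram.partner_outLabel, eq_comm, ChordDiagram.partner_outLabel_eq_iff, e2]

end StringHomology
end

noncomputable section
namespace StringHomology
variable {n : ℕ}

/-- Whether `t` lies between `d` and `d'`, modulo two. -/
def sepBit (d d' t : ℕ) : ZMod 2 := ltBit d t + ltBit d' t

theorem interleave_eq_sepBit (a b c d : ℕ) :
    interleave a b c d = sepBit a b c + sepBit a b d := by
  simp only [interleave, sepBit]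
  ring

theorem zmod_two_eq_of_add_eq_zero {x y : ZMod 2} (h : x + y = 0) : x = y := by
  revert x y
  decide

/-- The two ends of a chord lie on the same side of any other chord. -/
theorem ChordDiagram.sepBit_partner (Γ : ChordDiagram n) {i : Fin n} {x : Fin (2 * n)}
    (hx : x ≠ inLabel i) (hx' : Γ.partner x ≠ inLabel i) :
    sepBit (2 * i) (2 * Γ.toPerm i + 1) x = sepBit (2 * i) (2 * Γ.toPerm i + 1) (Γ.partner x) := by
  apply zmod_two_eq_of_add_eq_zero
  rcases label_cases x with ⟨j, rfl⟩ | ⟨k, rfl⟩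
  · rw [partner_inLabel]
    have hij : i ≠ j := fun h => hx (by rw [h])
    exact (interleave_eq_sepBit _ _ _ _).symm.trans (Γ.noncrossing_toPerm i j hij)
  · obtain ⟨j, rfl⟩ := Γ.toPerm.surjective k
    rw [partner_outLabel] at hx' ⊢
    have hij : i ≠ j := fun h => hx' (by rw [h])
    rw [add_comm]
    exact (interleave_eq_sepBit _ _ _ _).symm.trans (Γ.noncrossing_toPerm i j hij)

/-- If a permutation differs from a chord diagram only in three chords, whose endpoints lie on the
same side of each other chord, then the other chords are involved in no crossings. -/
theorem chordCross_eq_zero_of_three {Γ : ChordDiagram n} {ρ : Equiv.Perm (Fin n)} {a b c : Fin n}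
    (hρ : ∀ i, i ≠ a → i ≠ b → i ≠ c → ρ i = Γ.toPerm i)
    (hS : ∀ i, i ≠ a → i ≠ b → i ≠ c → ∃ s, ∀ j, j = a ∨ j = b ∨ j = c →
      sepBit (2 * i) (2 * Γ.toPerm i + 1) (2 * j) = s ∧
        sepBit (2 * i) (2 * Γ.toPerm i + 1) (2 * ρ j + 1) = s)
    {i j : Fin n} (hij : i ≠ j) (ha : i ≠ a) (hb : i ≠ b) (hc : i ≠ c) : chordCross ρ i j = 0 := by
  by_cases hj : j = a ∨ j = b ∨ j = c
  · obtain ⟨s, hs⟩ := hS i ha hb hc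
    rw [chordCross, interleave_eq_sepBit, hρ i ha hb hc, (hs j hj).1, (hs j hj).2,
      ZModModule.add_self]
  · simp only [not_or] at hj
    rw [chordCross, hρ i ha hb hc, hρ j hj.1 hj.2.1 hj.2.2]
    exact Γ.noncrossing_toPerm i j hij

theorem resolveSum_of_three {X : Equiv.Perm (Fin n)} {a b c : Fin n} (hab : a < b) (hbc : b < c)
    (h1 : chordCross X a b = 1) (h2 : chordCross X a c = 1) (h3 : chordCross X b c = 1)
    (h0 : ∀ i j, i ≠ j → i ≠ a → i ≠ b → i ≠ c → chordCross X i j = 0) :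
    resolveSum X = Finsupp.single (X * Equiv.swap a b) 1 + Finsupp.single (X * Equiv.swap a c) 1 +
      Finsupp.single (X * Equiv.swap b c) 1 := by
  have hac := hab.trans hbc
  have hsub : ({(a, b), (a, c), (b, c)} : Finset (Fin n × Fin n)) ⊆
      Finset.univ.filter fun p => p.1 < p.2 := by
    intro p hp
    simp only [Finset.mem_insert, Finset.mem_singleton] at hp
    rcases hp with rfl | rfl | rfl <;> simp [hab, hbc, hac]
  rw [resolveSum, ← Finset.sum_subset hsub, Finset.sum_insert, Finset.sum_insert,
    Finset.sum_singleton, h1, h2, h3, one_smul, one_smul, one_smul, add_assoc]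
  · simp [hab.ne]
  · simp [hbc.ne, hab.ne]
  · rintro ⟨i, j⟩ hp hp'
    simp only [Finset.mem_filter, Finset.mem_univ, true_and] at hp
    simp only [Finset.mem_insert, Finset.mem_singleton, Prod.mk.injEq, not_or] at hp'
    suffices chordCross X i j = 0 by rw [this, zero_smul]
    by_cases hi : i ≠ a ∧ i ≠ b ∧ i ≠ c
    · exact h0 i j hp.ne hi.1 hi.2.1 hi.2.2
    by_cases hj : j ≠ a ∧ j ≠ b ∧ j ≠ c
    · rw [chordCross_comm]
      exact h0 j i hp.ne' hj.1 hj.2.1 hj.2.2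
    exfalso
    simp only [Fin.lt_def, Fin.ext_iff, ne_eq] at *
    omega

theorem chordCross_eq_one_of_lt {X : Equiv.Perm (Fin n)} {i j : Fin n}
    (hij : i < j) (h : (j : ℕ) ≤ X i ∧ (X j : ℕ) < i ∧ (X j : ℕ) < X i ∨
      (X i : ℕ) < j ∧ (i : ℕ) ≤ X j ∧ (X j : ℕ) < X i ∨
      (X i : ℕ) < j ∧ (X j : ℕ) < i ∧ (X i : ℕ) < X j ∨
      (j : ℕ) ≤ X i ∧ (i : ℕ) ≤ X j ∧ (X i : ℕ) < X j) : chordCross X i j = 1 := by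
  have : (i : ℕ) < j := hij
  simp only [chordCross, interleave, ltBit]
  split_ifs <;> first | (exfalso; omega) | decide

/-- Three chord diagrams related by bypass surgeries are the resolutions of the three crossings of
a single diagram, in which the chords through the bypass disc join opposite vertices of the
hexagon. -/
theorem IsBypassTriple.exists_resolveSum {Γ Γ' Γ'' : ChordDiagram n}
    (h : IsBypassTriple Γ Γ' Γ'') :
    ∃ X : Equiv.Perm (Fin n), resolveSum X = Finsupp.single Γ.toPerm 1 +
      Finsupp.single Γ'.toPerm 1 + Finsupp.single Γ''.toPerm 1 := by
  obtain ⟨p, hp, ⟨h01, h25, h34⟩, ⟨h12, h03, h45⟩, ⟨h23, h14, h05⟩, hout⟩ :=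
    isBypassTriple_iff_inLabel.1 h
  have l01 : (p 0 : ℕ) < p 1 := hp (by decide)
  have l12 : (p 1 : ℕ) < p 2 := hp (by decide)
  have l23 : (p 2 : ℕ) < p 3 := hp (by decide)
  have l34 : (p 3 : ℕ) < p 4 := hp (by decide)
  have l45 : (p 4 : ℕ) < p 5 := hp (by decide)
  have q01 := Γ.partner_parity (p 0)
  have q12 := Γ'.partner_parity (p 1)
  have q23 := Γ''.partner_parity (p 2)
  have q34 := Γ.partner_parity (p 3)
  have q45 := Γ'.partner_parity (p 4)
  rw [h01] at q01
  rw [h12] at q12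
  rw [h23] at q23
  rw [h34] at q34
  rw [h45] at q45
  have hS : ∀ i, inLabel i ∉ Set.range p → ∀ k,
      sepBit (2 * i) (2 * Γ.toPerm i + 1) (p k) = sepBit (2 * i) (2 * Γ.toPerm i + 1) (p 0) := by
    intro i hi
    have hne : ∀ k, p k ≠ inLabel i := fun k hk => hi ⟨k, hk⟩
    obtain ⟨e1, e2⟩ := hout i hi
    have s01 := Γ.sepBit_partner (hne 0) (by rw [h01]; exact hne 1)
    have s12 := Γ'.sepBit_partner (hne 1) (by rw [h12]; exact hne 2)
    have s23 := Γ''.sepBit_partner (hne 2) (by rw [h23]; exact hne 3)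
    have s34 := Γ.sepBit_partner (hne 3) (by rw [h34]; exact hne 4)
    have s45 := Γ'.sepBit_partner (hne 4) (by rw [h45]; exact hne 5)
    rw [h01] at s01
    rw [h12, ← e1] at s12
    rw [h23, ← e2] at s23
    rw [h34] at s34
    rw [h45, ← e1] at s45
    intro k
    fin_cases k
    · rfl
    · exact s01.symm
    · exact (s01.trans s12).symm
    · exact (s01.trans (s12.trans s23)).symm
    · exact (s01.trans (s12.trans (s23.trans s34))).symm
    · exact (s01.trans (s12.trans (s23.trans (s34.trans s45)))).symm
  have hlab : ∀ k, ((p k : ℕ) % 2 = 0 → ∃ i, p k = inLabel i) ∧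
      ((p k : ℕ) % 2 = 1 → ∃ i, p k = outLabel i) := by
    intro k
    rcases label_cases (p k) with ⟨i, hi⟩ | ⟨i, hi⟩
    · exact ⟨fun _ => ⟨i, hi⟩, fun h' => absurd h' (by rw [hi]; simp [inLabel])⟩
    · exact ⟨fun h' => absurd h' (by rw [hi]; simp [outLabel, Nat.add_mod]), fun _ => ⟨i, hi⟩⟩
  -- both for an even and an odd first vertex, the common diagram is found by joining
  -- opposite vertices of the hexagon
  have main : ∀ (X : Equiv.Perm (Fin n)) (a b c : Fin n), a < b → b < c →
      (∀ i, i ≠ a → i ≠ b → i ≠ c → X i = Γ.toPerm i) →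
      (∀ i, i ≠ a → i ≠ b → i ≠ c → inLabel i ∉ Set.range p) →
      (∀ j, j = a ∨ j = b ∨ j = c → inLabel j ∈ Set.range p ∧ outLabel (X j) ∈ Set.range p) →
      chordCross X a b = 1 → chordCross X a c = 1 → chordCross X b c = 1 →
      resolveSum X = Finsupp.single (X * Equiv.swap a b) 1 +
        Finsupp.single (X * Equiv.swap a c) 1 + Finsupp.single (X * Equiv.swap b c) 1 := by
    intro X a b c hab hbc hX hr hm c1 c2 c3
    refine resolveSum_of_three hab hbc c1 c2 c3 fun i j hij ha hb hc =>
      chordCross_eq_zero_of_three hX (fun i ha hb hc =>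
        ⟨sepBit (2 * i) (2 * Γ.toPerm i + 1) (p 0), fun j hj => ?_⟩) hij ha hb hc
    obtain ⟨⟨k, hk⟩, ⟨l, hl⟩⟩ := hm j hj
    have e1 := hS i (hr i ha hb hc) k
    have e2 := hS i (hr i ha hb hc) l
    rw [hk] at e1
    rw [hl] at e2
    exact ⟨e1, e2⟩
  have hback : ∀ (Δ : ChordDiagram n) {i k}, Δ.partner (outLabel k) = inLabel i →
      Δ.toPerm i = k := fun Δ i k h => (Δ.partner_outLabel_eq_iff i k).1 h
  have hforth : ∀ (Δ : ChordDiagram n) {i k}, Δ.partner (inLabel i) = outLabel k →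
      Δ.toPerm i = k := fun Δ i k h => outLabel_injective (by rw [← h, Δ.partner_inLabel])
  have hext : ∀ (Δ : ChordDiagram n) (X : Equiv.Perm (Fin n)) (a b c u v : Fin n),
      (∀ i, i ≠ a → i ≠ b → i ≠ c → X i = Δ.toPerm i) → u ∈ ({a, b, c} : Set (Fin n)) →
      v ∈ ({a, b, c} : Set (Fin n)) → (∀ i ∈ ({a, b, c} : Set (Fin n)),
      X (Equiv.swap u v i) = Δ.toPerm i) → X * Equiv.swap u v = Δ.toPerm := by
    intro Δ X a b c u v hX hu hv hi
    ext i : 1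
    by_cases hi' : i ∈ ({a, b, c} : Set (Fin n))
    · exact hi i hi'
    · have hiu : i ≠ u := fun h => hi' (h ▸ hu)
      have hiv : i ≠ v := fun h => hi' (h ▸ hv)
      simp only [Set.mem_insert_iff, Set.mem_singleton_iff, not_or] at hi'
      rw [Equiv.Perm.mul_apply, Equiv.swap_apply_of_ne_of_ne hiu hiv, hX i hi'.1 hi'.2.1 hi'.2.2]
  rcases Nat.mod_two_eq_zero_or_one (p 0) with hpar | hpar
  · obtain ⟨a, ha⟩ := (hlab 0).1 hpar
    obtain ⟨x, hx⟩ := (hlab 1).2 (by omega)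
    obtain ⟨b, hb⟩ := (hlab 2).1 (by omega)
    obtain ⟨y, hy⟩ := (hlab 3).2 (by omega)
    obtain ⟨c, hc⟩ := (hlab 4).1 (by omega)
    obtain ⟨z, hz⟩ := (hlab 5).2 (by omega)
    rw [ha, hx] at l01
    rw [hx, hb] at l12
    rw [hb, hy] at l23
    rw [hy, hc] at l34
    rw [hc, hz] at l45
    simp only [inLabel, outLabel] at l01 l12 l23 l34 l45
    have e1 : Γ.toPerm a = x := hforth Γ (by rw [← ha, h01, hx])
    have e2 : Γ.toPerm b = z := hforth Γ (by rw [← hb, h25, hz])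
    have e3 : Γ.toPerm c = y := hback Γ (by rw [← hy, h34, hc])
    have e4 : Γ'.toPerm a = y := hforth Γ' (by rw [← ha, h03, hy])
    have e5 : Γ'.toPerm b = x := hback Γ' (by rw [← hx, h12, hb])
    have e6 : Γ'.toPerm c = z := hforth Γ' (by rw [← hc, h45, hz])
    have e7 : Γ''.toPerm a = z := hforth Γ'' (by rw [← ha, h05, hz])
    have e8 : Γ''.toPerm b = y := hforth Γ'' (by rw [← hb, h23, hy])
    have e9 : Γ''.toPerm c = x := hback Γ'' (by rw [← hx, h14, hc])
    have hab : a < b := Fin.lt_def.2 (by omega)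
    have hbc : b < c := Fin.lt_def.2 (by omega)
    have hac := hab.trans hbc
    have hr : ∀ i, i ≠ a → i ≠ b → i ≠ c → inLabel i ∉ Set.range p := by
      rintro i ia ib ic ⟨k, hk⟩
      fin_cases k
      · exact ia (inLabel_injective (hk.symm.trans ha))
      · exact inLabel_ne_outLabel _ _ (hk.symm.trans hx)
      · exact ib (inLabel_injective (hk.symm.trans hb))
      · exact inLabel_ne_outLabel _ _ (hk.symm.trans hy)
      · exact ic (inLabel_injective (hk.symm.trans hc))
      · exact inLabel_ne_outLabel _ _ (hk.symm.trans hz)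
    set X := Γ.toPerm * Equiv.swap a c with hXdef
    have Xa : X a = y := by simp [hXdef, e3]
    have Xb : X b = z := by simp [hXdef, Equiv.swap_apply_of_ne_of_ne hab.ne' hbc.ne, e2]
    have Xc : X c = x := by simp [hXdef, e1]
    have hX : ∀ i, i ≠ a → i ≠ b → i ≠ c → X i = Γ.toPerm i := fun i ia _ ic => by
      simp [hXdef, Equiv.swap_apply_of_ne_of_ne ia ic]
    have hX' : ∀ i, i ≠ a → i ≠ b → i ≠ c → X i = Γ'.toPerm i := fun i ia ib ic =>
      (hX i ia ib ic).trans (hout i (hr i ia ib ic)).1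
    have hX'' : ∀ i, i ≠ a → i ≠ b → i ≠ c → X i = Γ''.toPerm i := fun i ia ib ic =>
      (hX i ia ib ic).trans (hout i (hr i ia ib ic)).2
    refine ⟨X, ?_⟩
    rw [main X a b c hab hbc hX hr ?_ (chordCross_eq_one_of_lt hab (by rw [Xa, Xb]; omega))
      (chordCross_eq_one_of_lt hac (by rw [Xa, Xc]; omega))
      (chordCross_eq_one_of_lt hbc (by rw [Xb, Xc]; omega)),
      hext Γ'' X a b c a b hX'' (by simp) (by simp), hext Γ X a b c a c hX (by simp) (by simp),
      hext Γ' X a b c b c hX' (by simp) (by simp)]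
    · abel
    · rintro i (rfl | rfl | rfl)
      · rw [Equiv.swap_apply_of_ne_of_ne hab.ne hac.ne, Xa, e4]
      · rw [Equiv.swap_apply_left, Xc, e5]
      · rw [Equiv.swap_apply_right, Xb, e6]
    · rintro i (rfl | rfl | rfl)
      · rw [Equiv.swap_apply_left, Xc, e1]
      · rw [Equiv.swap_apply_of_ne_of_ne hab.ne' hbc.ne, Xb, e2]
      · rw [Equiv.swap_apply_right, Xa, e3]
    · rintro i (rfl | rfl | rfl)
      · rw [Equiv.swap_apply_left, Xb, e7]
      · rw [Equiv.swap_apply_right, Xa, e8]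
      · rw [Equiv.swap_apply_of_ne_of_ne hac.ne' hbc.ne', Xc, e9]
    · rintro i (rfl | rfl | rfl)
      · exact ⟨⟨0, ha⟩, ⟨3, by rw [Xa, hy]⟩⟩
      · exact ⟨⟨2, hb⟩, ⟨5, by rw [Xb, hz]⟩⟩
      · exact ⟨⟨4, hc⟩, ⟨1, by rw [Xc, hx]⟩⟩
  · obtain ⟨x, hx⟩ := (hlab 0).2 hpar
    obtain ⟨a, ha⟩ := (hlab 1).1 (by omega)
    obtain ⟨y, hy⟩ := (hlab 2).2 (by omega)
    obtain ⟨b, hb⟩ := (hlab 3).1 (by omega)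
    obtain ⟨z, hz⟩ := (hlab 4).2 (by omega)
    obtain ⟨c, hc⟩ := (hlab 5).1 (by omega)
    rw [hx, ha] at l01
    rw [ha, hy] at l12
    rw [hy, hb] at l23
    rw [hb, hz] at l34
    rw [hz, hc] at l45
    simp only [inLabel, outLabel] at l01 l12 l23 l34 l45
    have e1 : Γ.toPerm a = x := hback Γ (by rw [← hx, h01, ha])
    have e2 : Γ.toPerm b = z := hforth Γ (by rw [← hb, h34, hz])
    have e3 : Γ.toPerm c = y := hback Γ (by rw [← hy, h25, hc])
    have e4 : Γ'.toPerm a = y := hforth Γ' (by rw [← ha, h12, hy])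
    have e5 : Γ'.toPerm b = x := hback Γ' (by rw [← hx, h03, hb])
    have e6 : Γ'.toPerm c = z := hback Γ' (by rw [← hz, h45, hc])
    have e7 : Γ''.toPerm a = z := hforth Γ'' (by rw [← ha, h14, hz])
    have e8 : Γ''.toPerm b = y := hback Γ'' (by rw [← hy, h23, hb])
    have e9 : Γ''.toPerm c = x := hback Γ'' (by rw [← hx, h05, hc])
    have hab : a < b := Fin.lt_def.2 (by omega)
    have hbc : b < c := Fin.lt_def.2 (by omega)
    have hac := hab.trans hbc
    have hr : ∀ i, i ≠ a → i ≠ b → i ≠ c → inLabel i ∉ Set.range p := by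
      rintro i ia ib ic ⟨k, hk⟩
      fin_cases k
      · exact inLabel_ne_outLabel _ _ (hk.symm.trans hx)
      · exact ia (inLabel_injective (hk.symm.trans ha))
      · exact inLabel_ne_outLabel _ _ (hk.symm.trans hy)
      · exact ib (inLabel_injective (hk.symm.trans hb))
      · exact inLabel_ne_outLabel _ _ (hk.symm.trans hz)
      · exact ic (inLabel_injective (hk.symm.trans hc))
    set X := Γ.toPerm * Equiv.swap a b with hXdef
    have Xa : X a = z := by simp [hXdef, e2]
    have Xb : X b = x := by simp [hXdef, e1]
    have Xc : X c = y := by simp [hXdef, Equiv.swap_apply_of_ne_of_ne hac.ne' hbc.ne', e3]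
    have hX : ∀ i, i ≠ a → i ≠ b → i ≠ c → X i = Γ.toPerm i := fun i ia ib _ => by
      simp [hXdef, Equiv.swap_apply_of_ne_of_ne ia ib]
    have hX' : ∀ i, i ≠ a → i ≠ b → i ≠ c → X i = Γ'.toPerm i := fun i ia ib ic =>
      (hX i ia ib ic).trans (hout i (hr i ia ib ic)).1
    have hX'' : ∀ i, i ≠ a → i ≠ b → i ≠ c → X i = Γ''.toPerm i := fun i ia ib ic =>
      (hX i ia ib ic).trans (hout i (hr i ia ib ic)).2
    refine ⟨X, ?_⟩
    rw [main X a b c hab hbc hX hr ?_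
      (chordCross_eq_one_of_lt hab (by rw [Xa, Xb]; omega))
      (chordCross_eq_one_of_lt hac (by rw [Xa, Xc]; omega))
      (chordCross_eq_one_of_lt hbc (by rw [Xb, Xc]; omega)),
      hext Γ X a b c a b hX (by simp) (by simp), hext Γ' X a b c a c hX' (by simp) (by simp),
      hext Γ'' X a b c b c hX'' (by simp) (by simp)]
    · rintro i (rfl | rfl | rfl)
      · rw [Equiv.swap_apply_of_ne_of_ne hab.ne hac.ne, Xa, e7]
      · rw [Equiv.swap_apply_left, Xc, e8]
      · rw [Equiv.swap_apply_right, Xb, e9]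
    · rintro i (rfl | rfl | rfl)
      · rw [Equiv.swap_apply_left, Xc, e4]
      · rw [Equiv.swap_apply_of_ne_of_ne hab.ne' hbc.ne, Xb, e5]
      · rw [Equiv.swap_apply_right, Xa, e6]
    · rintro i (rfl | rfl | rfl)
      · rw [Equiv.swap_apply_left, Xb, e1]
      · rw [Equiv.swap_apply_right, Xa, e2]
      · rw [Equiv.swap_apply_of_ne_of_ne hac.ne' hbc.ne', Xc, e3]
    · rintro i (rfl | rfl | rfl)
      · exact ⟨⟨1, ha⟩, ⟨4, by rw [Xa, hz]⟩⟩
      · exact ⟨⟨3, hb⟩, ⟨0, by rw [Xb, hx]⟩⟩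
      · exact ⟨⟨5, hc⟩, ⟨2, by rw [Xc, hy]⟩⟩

/-- `shiftLabel` as a map of marked points. -/
def shiftFin (i : Fin (n + 1)) (x : Fin (2 * n)) : Fin (2 * (n + 1)) :=
  ⟨shiftLabel i x, by
    have := x.2
    rw [shiftLabel]
    split_ifs <;> omega⟩

theorem shiftFin_strictMono (i : Fin (n + 1)) : StrictMono (shiftFin i) := fun _ _ h =>
  shiftLabel_strictMono i h

theorem shiftFin_inLabel {i : Fin (n + 1)} (hi : (i : ℕ) ≤ 1) (j : Fin n) :
    shiftFin i (inLabel j) = inLabel (i.succAbove j) :=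
  Fin.ext (two_mul_succAbove hi j).symm

theorem shiftFin_outLabel {i : Fin (n + 1)} (hi : (i : ℕ) ≤ 1) (k : Fin n) :
    shiftFin i (outLabel k) = outLabel k.succ :=
  Fin.ext (two_mul_succ_add_one hi k).symm

theorem toPerm_insertChord {i : Fin (n + 1)} (hi : (i : ℕ) ≤ 1) (Γ : ChordDiagram n) :
    (insertChord i hi Γ).toPerm = insertPerm i Γ.toPerm :=
  toPerm_ofPerm _ _

theorem insertChord_partner {i : Fin (n + 1)} (hi : (i : ℕ) ≤ 1) (Γ : ChordDiagram n)
    (x : Fin (2 * n)) :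
    (insertChord i hi Γ).partner (shiftFin i x) = shiftFin i (Γ.partner x) := by
  rcases label_cases x with ⟨j, rfl⟩ | ⟨k, rfl⟩
  · rw [shiftFin_inLabel hi, ChordDiagram.partner_inLabel, ChordDiagram.partner_inLabel,
      shiftFin_outLabel hi, toPerm_insertChord, insertPerm_succAbove]
  · obtain ⟨j, rfl⟩ := Γ.toPerm.surjective k
    rw [ChordDiagram.partner_outLabel, shiftFin_outLabel hi, shiftFin_inLabel hi,
      ChordDiagram.partner_outLabel_eq_iff, toPerm_insertChord, insertPerm_succAbove]

theorem IsBypassTriple.insertChord {i : Fin (n + 1)} (hi : (i : ℕ) ≤ 1)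
    {Γ Γ' Γ'' : ChordDiagram n} (h : IsBypassTriple Γ Γ' Γ'') :
    IsBypassTriple (insertChord i hi Γ) (insertChord i hi Γ') (insertChord i hi Γ'') := by
  obtain ⟨p, hp, ⟨h01, h25, h34⟩, ⟨h12, h03, h45⟩, ⟨h23, h14, h05⟩, hout⟩ :=
    isBypassTriple_iff_inLabel.1 h
  refine isBypassTriple_iff_inLabel.2 ⟨shiftFin i ∘ p, (shiftFin_strictMono i).comp hp, ?_, ?_, ?_,
    fun j hj => ?_⟩
  · simp only [Function.comp_apply, insertChord_partner, h01, h25, h34, and_self]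
  · simp only [Function.comp_apply, insertChord_partner, h12, h03, h45, and_self]
  · simp only [Function.comp_apply, insertChord_partner, h23, h14, h05, and_self]
  · rw [toPerm_insertChord, toPerm_insertChord, toPerm_insertChord]
    rcases Fin.eq_self_or_eq_succAbove i j with rfl | ⟨k, rfl⟩
    · simp
    · have := hout k (by
        rintro ⟨m, hm⟩
        exact hj ⟨m, by rw [Function.comp_apply, hm, shiftFin_inLabel hi]⟩)
      simp [this.1.symm, this.2.symm]

end StringHomology
end

noncomputable section
namespace StringHomology
variable {n : ℕ}

/-! ### Bypass surgery at the outgoing point `0` -/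

theorem fin_zero_val : ((0 : Fin (n + 2)) : ℕ) = 0 := rfl

theorem fin_one_val : ((1 : Fin (n + 2)) : ℕ) = 1 := Fin.val_one n

theorem fin_zero_le : ((0 : Fin (n + 2)) : ℕ) ≤ 1 := Nat.zero_le 1

theorem fin_one_le : ((1 : Fin (n + 2)) : ℕ) ≤ 1 := fin_one_val.le

theorem interleave_ne_zero {a b c d : ℕ} (hac : a < c) (hcb : c < b) (hd : d < a ∨ b < d) :
    interleave a b c d ≠ 0 := by
  simp only [interleave, ltBit]
  split_ifs <;> first | (exfalso; omega) | decide

theorem interleave_swap_right (a b c d : ℕ) : interleave a b c d = interleave a b d c := by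
  simp only [interleave]
  ring

/-- In a chord diagram in which the point with label `1` is matched to neither neighbour, the chords
at the points with labels `0`, `1`, `2` are parallel. -/
theorem exists_parallel_chords (Γ : ChordDiagram (n + 2)) (h : ¬ Attached Γ.toPerm) :
    ∃ m, Γ.toPerm m = 0 ∧ 1 < (m : ℕ) ∧ 0 < (Γ.toPerm 1 : ℕ) ∧ (Γ.toPerm 1 : ℕ) < m ∧
      (m : ℕ) ≤ Γ.toPerm 0 := by
  obtain ⟨hy0, hz0⟩ := not_or.1 h
  obtain ⟨m, hm⟩ := Γ.toPerm.surjective 0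
  have hm0 : m ≠ 0 := fun h => hy0 (h ▸ hm)
  have hm1 : m ≠ 1 := fun h => hz0 (h ▸ hm)
  have vm : 1 < (m : ℕ) := by
    have e0 : (m : ℕ) ≠ 0 := fun h => hm0 (Fin.ext h)
    have e1 : (m : ℕ) ≠ 1 := fun h => hm1 (Fin.ext (by simpa using h))
    omega
  have vz : (Γ.toPerm 1 : ℕ) ≠ 0 := fun h => hz0 (Fin.ext h)
  have vy : (Γ.toPerm 0 : ℕ) ≠ 0 := fun h => hy0 (Fin.ext h)
  refine ⟨m, hm, vm, by omega, ?_, ?_⟩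
  · by_contra hlt
    have c1m := Γ.noncrossing_toPerm 1 m hm1.symm
    rw [chordCross, hm, fin_zero_val, fin_one_val] at c1m
    exact interleave_ne_zero (by omega) (by omega) (by omega) c1m
  · by_contra hlt
    have c0m := Γ.noncrossing_toPerm 0 m hm0.symm
    rw [chordCross, hm, fin_zero_val] at c0m
    rw [interleave_swap_right] at c0m
    exact interleave_ne_zero (by omega) (by omega) (by omega) c0m

/-- The vertices of the hexagon spanned by the chords at the points with labels `0`, `1`, `2` lie on
the same side of every other chord. -/
theorem sepBit_hexagon (Γ : ChordDiagram (n + 2)) {m : Fin (n + 2)} (hm : Γ.toPerm m = 0)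
    {i : Fin (n + 2)} (i0 : i ≠ 0) (i1 : i ≠ 1) (im : i ≠ m) {t : ℕ}
    (ht : t = 0 ∨ t = 1 ∨ t = 2 ∨ t = 2 * Γ.toPerm 1 + 1 ∨ t = 2 * m ∨ t = 2 * Γ.toPerm 0 + 1) :
    sepBit (2 * i) (2 * Γ.toPerm i + 1) t = 0 := by
  have vi : 2 ≤ (i : ℕ) := by
    have e0 : (i : ℕ) ≠ 0 := fun h => i0 (Fin.ext h)
    have e1 : (i : ℕ) ≠ 1 := fun h => i1 (Fin.ext (by simpa using h))
    omega
  have vσ : (Γ.toPerm i : ℕ) ≠ 0 := fun h => im (Γ.toPerm.injective (by rw [hm]; exact Fin.ext h))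
  have small : ∀ t : ℕ, t ≤ 2 → sepBit (2 * i) (2 * Γ.toPerm i + 1) t = 0 := by
    intro t ht
    rw [sepBit, ltBit, ltBit, if_neg (by omega), if_neg (by omega), add_zero]
  have hchord : ∀ j, i ≠ j → sepBit (2 * i) (2 * Γ.toPerm i + 1) (2 * j) =
      sepBit (2 * i) (2 * Γ.toPerm i + 1) (2 * Γ.toPerm j + 1) := fun j hij =>
    zmod_two_eq_of_add_eq_zero
      ((interleave_eq_sepBit _ _ _ _).symm.trans (Γ.noncrossing_toPerm i j hij))
  rcases ht with rfl | rfl | rfl | rfl | rfl | rfl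
  · exact small 0 (by omega)
  · exact small 1 (by omega)
  · exact small 2 le_rfl
  · exact (hchord 1 i1).symm.trans (small _ (by simp))
  · exact (hchord m im).trans (small _ (by rw [hm]; simp))
  · exact (hchord 0 i0).symm.trans (small _ (by simp))

/-- Rejoining the vertices of the hexagon without crossings gives a diagram without crossings. -/
theorem noncrossing_of_hexagon (Γ : ChordDiagram (n + 2)) {m : Fin (n + 2)} (hm : Γ.toPerm m = 0)
    {ρ : Equiv.Perm (Fin (n + 2))} (hρ : ∀ i, i ≠ 0 → i ≠ 1 → i ≠ m → ρ i = Γ.toPerm i)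
    (hj : ∀ j, j = 0 ∨ j = 1 ∨ j = m → ρ j = 0 ∨ ρ j = Γ.toPerm 1 ∨ ρ j = Γ.toPerm 0)
    (c1 : chordCross ρ 0 1 = 0) (c2 : chordCross ρ 0 m = 0) (c3 : chordCross ρ 1 m = 0) :
    Noncrossing ρ := by
  have hout : ∀ {i j}, i ≠ j → i ≠ 0 → i ≠ 1 → i ≠ m → chordCross ρ i j = 0 := by
    intro i j hij i0 i1 im
    refine chordCross_eq_zero_of_three hρ (fun i i0 i1 im => ⟨0, fun j h =>
      ⟨sepBit_hexagon Γ hm i0 i1 im ?_, sepBit_hexagon Γ hm i0 i1 im ?_⟩⟩) hij i0 i1 im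
    · rcases h with rfl | rfl | rfl <;> simp
    · rcases hj j h with h | h | h <;> rw [h] <;> simp
  intro i j hij
  by_cases hi : i ≠ 0 ∧ i ≠ 1 ∧ i ≠ m
  · exact hout hij hi.1 hi.2.1 hi.2.2
  by_cases hj : j ≠ 0 ∧ j ≠ 1 ∧ j ≠ m
  · rw [chordCross_comm]
    exact hout hij.symm hj.1 hj.2.1 hj.2.2
  have hi' : i = 0 ∨ i = 1 ∨ i = m := by tauto
  have hj' : j = 0 ∨ j = 1 ∨ j = m := by tauto
  have c1' := (chordCross_comm ρ 1 0).trans c1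
  have c2' := (chordCross_comm ρ m 0).trans c2
  have c3' := (chordCross_comm ρ m 1).trans c3
  rcases hi' with rfl | rfl | rfl <;> rcases hj' with rfl | rfl | rfl <;>
    first | exact absurd rfl hij | assumption

theorem interleave_eq_zero_of_between {a b c d : ℕ} (hac : a ≠ c) (had : a ≠ d) (hbc : b ≠ c)
    (hbd : b ≠ d) (h : a < c ∧ c < b ↔ a < d ∧ d < b) (h' : b < c ∧ c < a ↔ b < d ∧ d < a) :
    interleave a b c d = 0 := by
  simp only [interleave, ltBit]
  split_ifs <;> first | (exfalso; omega) | decide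

theorem hexagon_strictMono {y z m : Fin (n + 2)} (hz : 0 < (z : ℕ)) (hzm : (z : ℕ) < m)
    (hmy : (m : ℕ) ≤ y) :
    StrictMono ![inLabel 0, outLabel 0, inLabel 1, outLabel z, inLabel m, outLabel y] := by
  rw [Fin.strictMono_iff_lt_succ]
  intro i
  fin_cases i
  · change 2 * ((0 : Fin (n + 2)) : ℕ) < 2 * ((0 : Fin (n + 2)) : ℕ) + 1
    omega
  · change 2 * ((0 : Fin (n + 2)) : ℕ) + 1 < 2 * ((1 : Fin (n + 2)) : ℕ)
    rw [fin_zero_val, fin_one_val]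
    omega
  · change 2 * ((1 : Fin (n + 2)) : ℕ) < 2 * (z : ℕ) + 1
    rw [fin_one_val]
    omega
  · change 2 * (z : ℕ) + 1 < 2 * (m : ℕ)
    omega
  · change 2 * (m : ℕ) < 2 * (y : ℕ) + 1
    omega

/-- Every chord diagram in which the point with label `1` is not matched to a neighbour is related
by bypass surgeries to two diagrams in which it is. -/
theorem exists_isBypassTriple (Γ : ChordDiagram (n + 2)) (h : ¬ Attached Γ.toPerm) :
    ∃ Γ₁ Γ₂, IsBypassTriple Γ₁ Γ₂ Γ ∧ Γ₁.toPerm 0 = 0 ∧ Γ₂.toPerm 1 = 0 := by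
  obtain ⟨m, hm, vm, vz, lzm, lmy⟩ := exists_parallel_chords Γ h
  have h01 : (0 : Fin (n + 2)) ≠ 1 := by simp
  have hm0 : m ≠ 0 := fun h => by simp [h] at vm
  have hm1 : m ≠ 1 := fun h => by simp [h] at vm
  have Xi : ∀ i, i ≠ 0 → i ≠ 1 → exchange Γ.toPerm i = Γ.toPerm i := fun i i0 i1 => by
    simp [exchange, Equiv.swap_apply_of_ne_of_ne i0 i1]
  have X0 : exchange Γ.toPerm 0 = Γ.toPerm 1 := by simp [exchange]
  have X1 : exchange Γ.toPerm 1 = Γ.toPerm 0 := by simp [exchange]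
  have Xm : exchange Γ.toPerm m = 0 := (Xi m hm0 hm1).trans hm
  obtain ⟨σ₁, hσ₁⟩ : ∃ ρ, ρ = exchange Γ.toPerm * Equiv.swap 0 m := ⟨_, rfl⟩
  have a0 : σ₁ 0 = 0 := by simp [hσ₁, Xm]
  have a1 : σ₁ 1 = Γ.toPerm 0 := by
    simp [hσ₁, Equiv.swap_apply_of_ne_of_ne h01.symm hm1.symm, X1]
  have am : σ₁ m = Γ.toPerm 1 := by simp [hσ₁, X0]
  have ai : ∀ i, i ≠ 0 → i ≠ 1 → i ≠ m → σ₁ i = Γ.toPerm i := fun i i0 i1 im => by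
    simp [hσ₁, Equiv.swap_apply_of_ne_of_ne i0 im, Xi i i0 i1]
  obtain ⟨σ₂, hσ₂⟩ : ∃ ρ, ρ = exchange Γ.toPerm * Equiv.swap 1 m := ⟨_, rfl⟩
  have b0 : σ₂ 0 = Γ.toPerm 1 := by
    simp [hσ₂, Equiv.swap_apply_of_ne_of_ne h01 hm0.symm, X0]
  have b1 : σ₂ 1 = 0 := by simp [hσ₂, Xm]
  have bm : σ₂ m = Γ.toPerm 0 := by simp [hσ₂, X1]
  have bi : ∀ i, i ≠ 0 → i ≠ 1 → i ≠ m → σ₂ i = Γ.toPerm i := fun i i0 i1 im => by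
    simp [hσ₂, Equiv.swap_apply_of_ne_of_ne i1 im, Xi i i0 i1]
  have v0 : ((0 : Fin (n + 2)) : ℕ) = 0 := rfl
  have v1 : ((1 : Fin (n + 2)) : ℕ) = 1 := by simp
  have n₁ : Noncrossing σ₁ := by
    refine noncrossing_of_hexagon Γ hm ai ?_ ?_ ?_ ?_
    · rintro j (rfl | rfl | rfl)
      · exact Or.inl a0
      · exact Or.inr (Or.inr a1)
      · exact Or.inr (Or.inl am)
    · rw [chordCross, a0, a1, v0, v1]
      apply interleave_eq_zero_of_between <;> omega
    · rw [chordCross, a0, am, v0]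
      apply interleave_eq_zero_of_between <;> omega
    · rw [chordCross, a1, am, v1]
      apply interleave_eq_zero_of_between <;> omega
  have n₂ : Noncrossing σ₂ := by
    refine noncrossing_of_hexagon Γ hm bi ?_ ?_ ?_ ?_
    · rintro j (rfl | rfl | rfl)
      · exact Or.inr (Or.inl b0)
      · exact Or.inl b1
      · exact Or.inr (Or.inr bm)
    · rw [chordCross, b0, b1, v0, v1]
      apply interleave_eq_zero_of_between <;> omega
    · rw [chordCross, b0, bm, v0]
      apply interleave_eq_zero_of_between <;> omega
    · rw [chordCross, b1, bm, v0, v1]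
      apply interleave_eq_zero_of_between <;> omega
  refine ⟨ofPerm σ₁ n₁, ofPerm σ₂ n₂, ?_, by simpa using a0, by simpa using b1⟩
  refine isBypassTriple_iff_inLabel.2 ⟨_, hexagon_strictMono vz lzm lmy, ⟨?_, ?_, ?_⟩,
    ⟨?_, ?_, ?_⟩, ⟨?_, ?_, ?_⟩, fun i hi => ?_⟩
  · change (ofPerm σ₁ n₁).partner (inLabel 0) = outLabel 0
    rw [ChordDiagram.partner_inLabel, toPerm_ofPerm, a0]
  · change (ofPerm σ₁ n₁).partner (inLabel 1) = outLabel (Γ.toPerm 0)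
    rw [ChordDiagram.partner_inLabel, toPerm_ofPerm, a1]
  · change (ofPerm σ₁ n₁).partner (outLabel (Γ.toPerm 1)) = inLabel m
    rw [ChordDiagram.partner_outLabel_eq_iff, toPerm_ofPerm, am]
  · change (ofPerm σ₂ n₂).partner (outLabel 0) = inLabel 1
    rw [ChordDiagram.partner_outLabel_eq_iff, toPerm_ofPerm, b1]
  · change (ofPerm σ₂ n₂).partner (inLabel 0) = outLabel (Γ.toPerm 1)
    rw [ChordDiagram.partner_inLabel, toPerm_ofPerm, b0]
  · change (ofPerm σ₂ n₂).partner (inLabel m) = outLabel (Γ.toPerm 0)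
    rw [ChordDiagram.partner_inLabel, toPerm_ofPerm, bm]
  · change Γ.partner (inLabel 1) = outLabel (Γ.toPerm 1)
    rw [ChordDiagram.partner_inLabel]
  · change Γ.partner (outLabel 0) = inLabel m
    rw [ChordDiagram.partner_outLabel_eq_iff, ← hm]
  · change Γ.partner (inLabel 0) = outLabel (Γ.toPerm 0)
    rw [ChordDiagram.partner_inLabel]
  · have i0 : i ≠ 0 := fun h => hi ⟨0, by rw [h]; rfl⟩
    have i1 : i ≠ 1 := fun h => hi ⟨2, by rw [h]; rfl⟩
    have im : i ≠ m := fun h => hi ⟨4, by rw [h]; rfl⟩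
    rw [toPerm_ofPerm, toPerm_ofPerm, ai i i0 i1 im, bi i i0 i1 im]
    exact ⟨rfl, rfl⟩

/-! ### The homology of the permutation complex -/

/-- The map that sends a chord diagram to its permutation. -/
def chordMap (n : ℕ) : (ChordDiagram n →₀ ZMod 2) →ₗ[ZMod 2] PermSpace n :=
  Finsupp.lmapDomain _ _ ChordDiagram.toPerm

theorem chordMap_single (Γ : ChordDiagram n) (r : ZMod 2) :
    chordMap n (Finsupp.single Γ r) = Finsupp.single Γ.toPerm r := by
  simp [chordMap]

theorem permD_chordMap (x : ChordDiagram n →₀ ZMod 2) : permD n (chordMap n x) = 0 := by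
  have : permD n ∘ₗ chordMap n = 0 := by
    ext Γ : 2
    simp only [LinearMap.comp_apply, Finsupp.lsingle_apply, chordMap_single, permD_single,
      resolveSum_eq_zero Γ.noncrossing_toPerm, LinearMap.zero_apply]
  exact LinearMap.congr_fun this x

theorem chordMap_mem_range_of_mem_bypassRelations {x : ChordDiagram n →₀ ZMod 2}
    (hx : x ∈ bypassRelations n) : chordMap n x ∈ LinearMap.range (permD n) := by
  have : bypassRelations n ≤ (LinearMap.range (permD n)).comap (chordMap n) := by
    rw [bypassRelations, Submodule.span_le]
    rintro _ ⟨Γ, Γ', Γ'', h, rfl⟩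
    obtain ⟨X, hX⟩ := h.exists_resolveSum
    exact ⟨Finsupp.single X 1, by simp only [permD_single, hX, map_add, chordMap_single]⟩
  exact this hx

/-- The linear extension of `insertChord`. -/
def insertChordMap (i : Fin (n + 1)) (hi : (i : ℕ) ≤ 1) :
    (ChordDiagram n →₀ ZMod 2) →ₗ[ZMod 2] (ChordDiagram (n + 1) →₀ ZMod 2) :=
  Finsupp.lmapDomain _ _ (insertChord i hi)

theorem insertChordMap_single {i : Fin (n + 1)} (hi : (i : ℕ) ≤ 1) (Γ : ChordDiagram n)
    (r : ZMod 2) : insertChordMap i hi (Finsupp.single Γ r) =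
      Finsupp.single (insertChord i hi Γ) r := by
  simp [insertChordMap]

theorem chordMap_insertChordMap {i : Fin (n + 1)} (hi : (i : ℕ) ≤ 1)
    (x : ChordDiagram n →₀ ZMod 2) :
    chordMap (n + 1) (insertChordMap i hi x) = insertMap i (chordMap n x) := by
  have : chordMap (n + 1) ∘ₗ insertChordMap i hi = insertMap i ∘ₗ chordMap n := by
    ext Γ : 2
    simp only [LinearMap.comp_apply, Finsupp.lsingle_apply, insertChordMap_single,
      chordMap_single, insertMap_single, toPerm_insertChord]
  exact LinearMap.congr_fun this x

theorem insertChordMap_mem_bypassRelations {i : Fin (n + 1)} (hi : (i : ℕ) ≤ 1)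
    {x : ChordDiagram n →₀ ZMod 2} (hx : x ∈ bypassRelations n) :
    insertChordMap i hi x ∈ bypassRelations (n + 1) := by
  have : bypassRelations n ≤ (bypassRelations (n + 1)).comap (insertChordMap i hi) := by
    rw [bypassRelations, Submodule.span_le]
    rintro _ ⟨Γ, Γ', Γ'', h, rfl⟩
    refine Submodule.subset_span ⟨_, _, _, h.insertChord hi, ?_⟩
    simp only [map_add, insertChordMap_single]
  exact this hx

theorem permSpace_add_add_self (x y : PermSpace n) : x + y + y = x := by
  rw [add_assoc, ZModModule.add_self, add_zero]

/-- Modulo the bypass relations, the chord diagrams in which the point with label `1` is matched to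
a neighbour span everything. -/
theorem exists_add_insertChordMap_mem (x : ChordDiagram (n + 2) →₀ ZMod 2) :
    ∃ a b, x + (insertChordMap 0 fin_zero_le a + insertChordMap 1 fin_one_le b) ∈
      bypassRelations (n + 2) := by
  induction x using Finsupp.induction_linear with
  | zero => exact ⟨0, 0, by simp⟩
  | add x y hx hy =>
    obtain ⟨a, b, h⟩ := hx
    obtain ⟨a', b', h'⟩ := hy
    refine ⟨a + a', b + b', ?_⟩
    have := add_mem h h'
    rw [map_add, map_add]
    convert this using 1
    abel
  | single Γ r =>
    rcases zmod_two_cases r with rfl | rfl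
    · exact ⟨0, 0, by simp⟩
    have hz : ∀ {Γ : ChordDiagram (n + 2)}, Γ.toPerm 0 = 0 → ∃ a, insertChordMap (n := n + 1) 0
        fin_zero_le a = Finsupp.single Γ 1 := fun h => by
      obtain ⟨Δ, hΔ⟩ := exists_insertChord fin_zero_le h
      exact ⟨Finsupp.single Δ 1, by rw [insertChordMap_single, hΔ]⟩
    have ho : ∀ {Γ : ChordDiagram (n + 2)}, Γ.toPerm 1 = 0 → ∃ a, insertChordMap (n := n + 1) 1
        fin_one_le a = Finsupp.single Γ 1 := fun h => by
      obtain ⟨Δ, hΔ⟩ := exists_insertChord fin_one_le h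
      exact ⟨Finsupp.single Δ 1, by rw [insertChordMap_single, hΔ]⟩
    by_cases h : Attached Γ.toPerm
    · rcases h with h | h
      · obtain ⟨a, ha⟩ := hz h
        exact ⟨a, 0, by rw [ha, map_zero, add_zero, ZModModule.add_self]; exact zero_mem _⟩
      · obtain ⟨b, hb⟩ := ho h
        exact ⟨0, b, by rw [hb, map_zero, zero_add, ZModModule.add_self]; exact zero_mem _⟩
    · obtain ⟨Γ₁, Γ₂, ht, h1, h2⟩ := exists_isBypassTriple Γ h
      obtain ⟨a, ha⟩ := hz h1
      obtain ⟨b, hb⟩ := ho h2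
      refine ⟨a, b, Submodule.subset_span ⟨Γ₁, Γ₂, Γ, ht, ?_⟩⟩
      rw [ha, hb]
      abel

/-- Chord diagrams represent all homology classes of the permutation complex, and the bypass
relations are all the relations between them. By induction: the permutation complex for `n + 2` is,
up to an acyclic quotient, a direct sum of two copies of the one for `n + 1`. -/
theorem permSpace_homology (n : ℕ) :
    (∀ x, permD n x = 0 → ∃ c y, x = chordMap n c + permD n y) ∧
      ∀ c, chordMap n c ∈ LinearMap.range (permD n) → c ∈ bypassRelations n := by
  -- for at most one chord the differential vanishes and there is a single diagram
  have base : ∀ n, n ≤ 1 →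
      (∀ x, permD n x = 0 → ∃ c y, x = chordMap n c + permD n y) ∧
        ∀ c, chordMap n c ∈ LinearMap.range (permD n) → c ∈ bypassRelations n := by
    intro n hn
    have : Subsingleton (Fin n) := by
      rw [Fin.subsingleton_iff_le_one]
      exact hn
    have hnc : ∀ σ : Equiv.Perm (Fin n), Noncrossing σ := fun σ i j hij =>
      absurd (Subsingleton.elim i j) hij
    have hD : permD n = 0 := by
      ext σ : 2
      simp [permD_single, resolveSum_eq_zero (hnc σ)]
    constructor
    · intro x _
      refine ⟨Finsupp.single (ofPerm 1 (hnc 1)) (x 1), 0, ?_⟩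
      rw [map_zero, add_zero, chordMap_single, toPerm_ofPerm]
      refine Finsupp.ext fun σ => ?_
      rw [Subsingleton.elim σ 1, Finsupp.single_eq_same]
    · intro c hc
      rw [hD, LinearMap.range_zero, Submodule.mem_bot] at hc
      have hc0 : c = 0 := Finsupp.mapDomain_injective ChordDiagram.toPerm_injective
        (hc.trans (map_zero (chordMap n)).symm)
      rw [hc0]
      exact zero_mem _
  induction n with
  | zero => exact base 0 (by simp)
  | succ n ih =>
    cases n with
    | zero => exact base 1 le_rfl
    | succ n =>
      obtain ⟨ih1, ih2⟩ := ih
      have hi0 : ((0 : Fin (n + 2)) : ℕ) ≤ 1 := by simp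
      have hi1 : ((1 : Fin (n + 2)) : ℕ) ≤ 1 := by simp
      constructor
      · intro x hx
        obtain ⟨y, hy⟩ := exists_add_permD_mem_attachedSpace (x := x) (by rw [hx]; exact zero_mem _)
        obtain ⟨a, b, hab⟩ := exists_insertMap_of_mem_attachedSpace hy
        have hd := congrArg (permD (n + 2)) hab
        rw [map_add, hx, permD_permD, add_zero, map_add, permD_insertMap hi0,
          permD_insertMap hi1] at hd
        obtain ⟨ha, hb⟩ := insertMap_add_injective (a := 0) (b := 0)
          (a' := permD (n + 1) a) (b' := permD (n + 1) b)
          (by rw [map_zero, map_zero, add_zero]; exact hd)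
        obtain ⟨c, u, rfl⟩ := ih1 a ha.symm
        obtain ⟨c', u', rfl⟩ := ih1 b hb.symm
        refine ⟨insertChordMap 0 hi0 c + insertChordMap 1 hi1 c',
          insertMap 0 u + insertMap 1 u' + y, ?_⟩
        have hx' : x = (x + permD (n + 2) y) + permD (n + 2) y :=
          (permSpace_add_add_self x _).symm
        rw [hx', hab]
        simp only [map_add, chordMap_insertChordMap, permD_insertMap hi0, permD_insertMap hi1]
        abel
      · rintro x ⟨y, hy⟩
        obtain ⟨a, b, hab⟩ := exists_add_insertChordMap_mem x
        obtain ⟨w, hw⟩ := chordMap_mem_range_of_mem_bypassRelations hab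
        rw [map_add, map_add, chordMap_insertChordMap, chordMap_insertChordMap, ← hy] at hw
        have h1 : insertMap 0 (chordMap (n + 1) a) + insertMap 1 (chordMap (n + 1) b) =
            permD (n + 2) (w + y) := by
          rw [map_add, hw, add_comm (permD (n + 2) y)]
          exact (permSpace_add_add_self _ _).symm
        obtain ⟨v, hv⟩ := exists_add_permD_mem_attachedSpace (x := w + y) (by
          rw [← h1]
          exact add_mem (insertMap_mem_attachedSpace (Or.inl rfl) _)
            (insertMap_mem_attachedSpace (Or.inr rfl) _))
        obtain ⟨a', b', hab'⟩ := exists_insertMap_of_mem_attachedSpace hv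
        have hd := congrArg (permD (n + 2)) hab'
        rw [map_add, permD_permD, add_zero, ← h1, map_add, permD_insertMap hi0,
          permD_insertMap hi1] at hd
        obtain ⟨ha, hb⟩ := insertMap_add_injective hd
        have h2 := add_mem (insertChordMap_mem_bypassRelations hi0 (ih2 a ⟨a', ha.symm⟩))
          (insertChordMap_mem_bypassRelations hi1 (ih2 b ⟨b', hb.symm⟩))
        have h3 := add_mem hab h2
        rwa [add_assoc, ZModModule.add_self, add_zero] at h3

end StringHomology
end

noncomputable section
namespace StringHomology
variable {n : ℕ} {M : MarkedDisc n}

/-! ### The string complex of the disc -/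

/-- The disc is convex, so maps to it that agree on a set are homotopic relative to that set. -/
theorem homotopicRel_of_eqOn {X : Type*} [TopologicalSpace X] {f g : C(X, Disc)} {S : Set X}
    (h : Set.EqOn f g S) : f.HomotopicRel g S := by
  refine ⟨{
    toFun := fun x => ⟨(1 - (x.1 : ℝ)) • (f x.2 : ℂ) + (x.1 : ℝ) • (g x.2 : ℂ),
      convex_closedBall (0 : ℂ) 1 (f x.2).2 (g x.2).2 (by linarith [x.1.2.2]) x.1.2.1 (by ring)⟩
    continuous_toFun := by fun_prop
    map_zero_left := fun x => Subtype.ext (by simp)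
    map_one_left := fun x => Subtype.ext (by simp)
    prop' := fun t x hx => Subtype.ext ?_ }⟩
  change (1 - (t : ℝ)) • (f x : ℂ) + (t : ℝ) • (g x : ℂ) = f x
  rw [← h hx, ← add_smul, sub_add_cancel, one_smul]

theorem nullhomotopic_disc {X : Type*} [TopologicalSpace X] (f : C(X, Disc)) : f.Nullhomotopic :=
  ⟨⟨0, by simp⟩, (homotopicRel_of_eqOn (S := ∅) (Set.eqOn_empty _ _)).homotopic⟩

theorem MarkedDisc.point_injective (M : MarkedDisc n) : Function.Injective M.point := by
  intro k l h
  have h1 : Complex.exp (M.angle k * Complex.I) = Complex.exp (M.angle l * Complex.I) :=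
    congrArg Subtype.val h
  obtain ⟨m, hm⟩ := Complex.exp_eq_exp_iff_exists_int.1 h1
  have h2 : M.angle k = M.angle l + m * (2 * Real.pi) := by
    have := congrArg Complex.im hm
    simpa using this
  have h3 := M.angle_lt k l
  have h4 := M.angle_lt l k
  have hpi : 0 < 2 * Real.pi := Real.two_pi_pos
  have h5 : (m : ℝ) < 1 := by nlinarith
  have h6 : (-1 : ℝ) < m := by nlinarith
  have h7 : m = 0 := by
    have a1 : m < 1 := by exact_mod_cast h5
    have a2 : -1 < m := by exact_mod_cast h6
    omega
  refine M.strictMono_angle.injective ?_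
  rw [h2, h7]
  simp

theorem MarkedDisc.outPoint_injective (M : MarkedDisc n) : Function.Injective M.outPoint := by
  intro i j h
  have := congrArg Fin.val (M.point_injective h)
  exact Fin.ext (by simpa using this)

theorem MarkedDisc.inPoint_injective (M : MarkedDisc n) : Function.Injective M.inPoint := by
  intro i j h
  have := congrArg Fin.val (M.point_injective h)
  exact Fin.ext (by simpa using this)

theorem MarkedDisc.inPoint_ne_outPoint (M : MarkedDisc n) (i j : Fin n) :
    M.inPoint i ≠ M.outPoint j := by
  intro h
  have := congrArg Fin.val (M.point_injective h)
  simp only at this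
  omega

theorem MarkedDisc.norm_point (M : MarkedDisc n) (k : Fin (2 * n)) : ‖(M.point k : ℂ)‖ = 1 :=
  Complex.norm_exp_ofReal_mul_I _

/-- The segment between two points of the disc. -/
def segmentArc (p q : Disc) : C(unitInterval, Disc) where
  toFun t := ⟨(1 - (t : ℝ)) • (p : ℂ) + (t : ℝ) • (q : ℂ),
    convex_closedBall (0 : ℂ) 1 p.2 q.2 (by linarith [t.2.2]) t.2.1 (by ring)⟩
  continuous_toFun := by fun_prop

/-- The string diagram whose arcs are straight. -/
def straightDiagram (M : MarkedDisc n) (σ : Equiv.Perm (Fin n)) (L : List C(UnitAddCircle, Disc)) :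
    StringDiagram M where
  target := σ
  arc i := segmentArc (M.inPoint i) (M.outPoint (σ i))
  arc_zero i := Subtype.ext (by simp [segmentArc])
  arc_one i := Subtype.ext (by simp [segmentArc])
  loops := L

theorem StringDiagram.toComplex_eq_straight (s : StringDiagram M) :
    s.toComplex = (straightDiagram M s.target s.loops).toComplex := by
  have h : s ≈ straightDiagram M s.target s.loops := by
    refine ⟨fun i => homotopicRel_of_eqOn ?_,
      Multiset.rel_refl_of_refl_on fun ℓ _ => ContinuousMap.Homotopic.refl ℓ⟩
    rintro t (rfl | rfl)
    · rw [s.arc_zero, StringDiagram.arc_zero]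
    · rw [s.arc_one, StringDiagram.arc_one]
      rfl
  exact congrArg (fun q => (contractibleRelations M).mkQ (Finsupp.single q 1)) (Quotient.sound h)

theorem StringDiagram.toComplex_eq_zero {s : StringDiagram M} (h : s.loops ≠ []) :
    s.toComplex = 0 := by
  obtain ⟨ℓ, hℓ⟩ := List.exists_mem_of_ne_nil _ h
  exact (Submodule.Quotient.mk_eq_zero _).2
    (Submodule.subset_span ⟨s, ⟨ℓ, hℓ, nullhomotopic_disc ℓ⟩, rfl⟩)

theorem StringDiagram.Homotopic.target_eq {s t : StringDiagram M} (h : s.Homotopic t) :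
    s.target = t.target := by
  refine Equiv.ext fun i => M.outPoint_injective ?_
  rw [← s.arc_one, ← t.arc_one]
  exact (h.1 i).fst_eq_snd (Or.inr rfl)

theorem StringDiagram.Homotopic.length_eq {s t : StringDiagram M} (h : s.Homotopic t) :
    s.loops.length = t.loops.length :=
  Multiset.card_eq_card_of_rel h.2

/-- The permutation of a homotopy class of string diagrams, or zero if there are closed curves. -/
def classPerm (M : MarkedDisc n) : Quotient (homotopySetoid M) → PermSpace n :=
  Quotient.lift (fun s => if s.loops.length = 0 then Finsupp.single s.target 1 else 0)
    fun s t (h : s.Homotopic t) => by rw [h.target_eq, h.length_eq]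

/-- The map from the string complex to the permutation complex. -/
def toPermSpace (M : MarkedDisc n) : StringComplex M →ₗ[ZMod 2] PermSpace n :=
  (contractibleRelations M).liftQ (Finsupp.linearCombination (ZMod 2) (classPerm M)) <| by
    rw [contractibleRelations, Submodule.span_le]
    rintro _ ⟨s, ⟨ℓ, hℓ, -⟩, rfl⟩
    have : s.loops ≠ [] := List.ne_nil_of_mem hℓ
    simp [classPerm, this]

theorem toPermSpace_straight (σ : Equiv.Perm (Fin n)) :
    toPermSpace M (straightDiagram M σ []).toComplex = Finsupp.single σ 1 := by
  rw [StringDiagram.toComplex, toPermSpace, Submodule.mkQ_apply, Submodule.liftQ_apply]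
  simp [classPerm, straightDiagram]

/-- Two maps on the string complex are equal if they agree on straight diagrams. -/
theorem stringComplex_hom_ext {V : Type*} [AddCommGroup V] [Module (ZMod 2) V]
    {f g : StringComplex M →ₗ[ZMod 2] V}
    (h : ∀ σ, f (straightDiagram M σ []).toComplex = g (straightDiagram M σ []).toComplex) :
    f = g := by
  refine Submodule.linearMap_qext _ (Finsupp.lhom_ext' fun q => LinearMap.ext_ring ?_)
  obtain ⟨s, rfl⟩ := Quotient.exists_rep q
  change f s.toComplex = g s.toComplex
  by_cases hs : s.loops = []
  · rw [s.toComplex_eq_straight, hs]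
    exact h _
  · rw [StringDiagram.toComplex_eq_zero hs, map_zero, map_zero]

/-- In the disc, the string complex has the permutations as a basis. -/
def permEquiv (M : MarkedDisc n) : StringComplex M ≃ₗ[ZMod 2] PermSpace n :=
  LinearEquiv.ofLinearMap (toPermSpace M)
    (Finsupp.linearCombination (ZMod 2) fun σ => (straightDiagram M σ []).toComplex)
    (by
      refine Finsupp.lhom_ext' fun σ => LinearMap.ext_ring ?_
      simp [toPermSpace_straight])
    (stringComplex_hom_ext fun σ => by simp [toPermSpace_straight])

theorem permEquiv_straight (σ : Equiv.Perm (Fin n)) :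
    permEquiv M (straightDiagram M σ []).toComplex = Finsupp.single σ 1 :=
  toPermSpace_straight σ

end StringHomology
end

noncomputable section
namespace StringHomology
variable {n : ℕ} {M : MarkedDisc n}

/-! ### Transverse crossings and straight diagrams -/

theorem TransverseAt.symm {f g : C(ℝ, Disc)} {u v : ℝ} (h : TransverseAt f g u v) :
    TransverseAt g f v u := by
  obtain ⟨a, b, ha, hb, hab⟩ := h
  exact ⟨b, a, hb, ha, LinearIndependent.pair_symm_iff.1 hab⟩

/-- An arc has no transverse crossing at its ends, where it is constant on one side. -/
theorem TransverseAt.mem_Ioo {s : StringDiagram M} {i : Fin n} {g : C(ℝ, Disc)} {u v : ℝ}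
    (h : TransverseAt (s.arcCurve i) g u v) (hu : u ∈ Set.Icc (0 : ℝ) 1) :
    u ∈ Set.Ioo (0 : ℝ) 1 := by
  obtain ⟨a, b, ha, -, hab⟩ := h
  have ha0 : a ≠ 0 := by simpa using hab.ne_zero 0
  refine ⟨lt_of_le_of_ne hu.1 ?_, lt_of_le_of_ne hu.2 ?_⟩
  · rintro rfl
    refine ha0 ((uniqueDiffWithinAt_Iic (0 : ℝ)).eq_deriv _ ha.hasDerivWithinAt ?_)
    refine (hasDerivWithinAt_const (0 : ℝ) _ ((s.arcCurve i 0 : Disc) : ℂ)).congr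
      (fun t ht => ?_) rfl
    simp [StringDiagram.arcCurve, Set.projIcc_of_le_left _ (Set.mem_Iic.1 ht)]
  · rintro rfl
    refine ha0 ((uniqueDiffWithinAt_Ici (1 : ℝ)).eq_deriv _ ha.hasDerivWithinAt ?_)
    refine (hasDerivWithinAt_const (1 : ℝ) _ ((s.arcCurve i 1 : Disc) : ℂ)).congr
      (fun t ht => ?_) rfl
    simp [StringDiagram.arcCurve, Set.projIcc_of_right_le _ (Set.mem_Ici.1 ht)]

theorem arcCurve_straightDiagram (σ : Equiv.Perm (Fin n)) (L : List C(UnitAddCircle, Disc))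
    (i : Fin n) {u : ℝ} (hu : u ∈ Set.Icc (0 : ℝ) 1) :
    ((straightDiagram M σ L).arcCurve i u : ℂ) =
      M.inPoint i + u • ((M.outPoint (σ i) : ℂ) - M.inPoint i) := by
  have : ((straightDiagram M σ L).arcCurve i u : ℂ) =
      (1 - u) • (M.inPoint i : ℂ) + u • (M.outPoint (σ i) : ℂ) := by
    simp [StringDiagram.arcCurve, straightDiagram, segmentArc, Set.projIcc_of_mem _ hu]
  rw [this, sub_smul, smul_sub, one_smul]
  abel

/-- A line meets the unit circle in at most two points. -/
theorem eq_zero_or_eq_one_of_norm {p w : ℂ} {d : ℝ} (hw : w ≠ 0) (hp : ‖p‖ = 1)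
    (hq : ‖p + w‖ = 1) (hd : ‖p + d • w‖ = 1) : d = 0 ∨ d = 1 := by
  have h1 : p.re * p.re + p.im * p.im = 1 := by
    rw [← Complex.normSq_apply, Complex.normSq_eq_norm_sq, hp, one_pow]
  have h2 : (p.re + w.re) * (p.re + w.re) + (p.im + w.im) * (p.im + w.im) = 1 := by
    rw [← Complex.add_re, ← Complex.add_im, ← Complex.normSq_apply, Complex.normSq_eq_norm_sq, hq,
      one_pow]
  have h3 : (p.re + d * w.re) * (p.re + d * w.re) + (p.im + d * w.im) * (p.im + d * w.im) = 1 := by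
    have : (p + d • w).re * (p + d • w).re + (p + d • w).im * (p + d • w).im = 1 := by
      rw [← Complex.normSq_apply, Complex.normSq_eq_norm_sq, hd, one_pow]
    simpa using this
  have hw' : w.re * w.re + w.im * w.im ≠ 0 := by
    rw [← Complex.normSq_apply]
    exact fun h => hw (Complex.normSq_eq_zero.1 h)
  have key : d * (d - 1) * (w.re * w.re + w.im * w.im) = 0 := by
    linear_combination h3 - h1 - d * (h2 - h1)
  rcases mul_eq_zero.1 ((mul_eq_zero.1 key).resolve_right hw') with h | h
  · exact Or.inl h
  · exact Or.inr (sub_eq_zero.1 h)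

theorem MarkedDisc.norm_inPoint (M : MarkedDisc n) (i : Fin n) : ‖(M.inPoint i : ℂ)‖ = 1 :=
  M.norm_point _

theorem MarkedDisc.norm_outPoint (M : MarkedDisc n) (i : Fin n) : ‖(M.outPoint i : ℂ)‖ = 1 :=
  M.norm_point _

theorem chord_ne_zero (M : MarkedDisc n) (i j : Fin n) :
    (M.outPoint j : ℂ) - M.inPoint i ≠ 0 := fun h =>
  M.inPoint_ne_outPoint i j (Subtype.ext (sub_eq_zero.1 h).symm)

/-- The chords of a straight diagram have different directions if they meet. -/
theorem linearIndependent_chords {σ : Equiv.Perm (Fin n)} {i j : Fin n} (hij : i ≠ j) {u v : ℝ}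
    (h : (M.inPoint i : ℂ) + u • ((M.outPoint (σ i) : ℂ) - M.inPoint i) =
      M.inPoint j + v • ((M.outPoint (σ j) : ℂ) - M.inPoint j)) :
    LinearIndependent ℝ ![(M.outPoint (σ i) : ℂ) - M.inPoint i,
      (M.outPoint (σ j) : ℂ) - M.inPoint j] := by
  rw [LinearIndependent.pair_iff' (chord_ne_zero M i (σ i))]
  intro c hc
  -- otherwise the second chord starts at a point of the line through the first
  have h1 : (M.inPoint j : ℂ) =
      M.inPoint i + (u - v * c) • ((M.outPoint (σ i) : ℂ) - M.inPoint i) := by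
    rw [sub_smul, mul_smul, hc, ← add_sub_assoc, h, add_sub_cancel_right]
  have h2 := eq_zero_or_eq_one_of_norm (d := u - v * c) (chord_ne_zero M i (σ i))
    (M.norm_inPoint i) (by rw [add_sub_cancel]; exact M.norm_outPoint _)
    (by rw [← h1]; exact M.norm_inPoint j)
  rcases h2 with h2 | h2
  · rw [h2, zero_smul, add_zero] at h1
    exact hij (M.inPoint_injective (Subtype.ext h1.symm))
  · rw [h2, one_smul, add_sub_cancel] at h1
    exact M.inPoint_ne_outPoint j (σ i) (Subtype.ext h1)

theorem pair_eq_of_smul_add_eq {a b p q : ℂ} (hab : LinearIndependent ℝ ![a, b]) {u v u' v' : ℝ}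
    (h : p + u • a = q + v • b) (h' : p + u' • a = q + v' • b) : u = u' ∧ v = v' := by
  have key : (u - u') • a + (v' - v) • b = 0 := by
    have := congrArg₂ (· - ·) h h'
    simp only [add_sub_add_left_eq_sub, ← sub_smul] at this
    rw [this, ← add_smul]
    simp
  obtain ⟨h1, h2⟩ := LinearIndependent.pair_iff.1 hab _ _ key
  exact ⟨by linarith, by linarith⟩

/-- Distinct chords meet at interior points only. -/
theorem chord_param_mem_Ioo {σ : Equiv.Perm (Fin n)} {i j : Fin n} (hij : i ≠ j) {u v : ℝ}
    (hu : u ∈ Set.Icc (0 : ℝ) 1)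
    (h : (M.inPoint i : ℂ) + u • ((M.outPoint (σ i) : ℂ) - M.inPoint i) =
      M.inPoint j + v • ((M.outPoint (σ j) : ℂ) - M.inPoint j)) : u ∈ Set.Ioo (0 : ℝ) 1 := by
  have key : ‖(M.inPoint i : ℂ) + u • ((M.outPoint (σ i) : ℂ) - M.inPoint i)‖ = 1 →
      (M.inPoint i : ℂ) + u • ((M.outPoint (σ i) : ℂ) - M.inPoint i) = M.inPoint j ∨
      (M.inPoint i : ℂ) + u • ((M.outPoint (σ i) : ℂ) - M.inPoint i) = M.outPoint (σ j) := by
    intro hn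
    rw [h] at hn ⊢
    rcases eq_zero_or_eq_one_of_norm (chord_ne_zero M j (σ j)) (M.norm_inPoint j)
      (by rw [add_sub_cancel]; exact M.norm_outPoint _) hn with rfl | rfl
    · exact Or.inl (by rw [zero_smul, add_zero])
    · exact Or.inr (by rw [one_smul, add_sub_cancel])
  refine ⟨lt_of_le_of_ne hu.1 ?_, lt_of_le_of_ne hu.2 ?_⟩
  · rintro rfl
    rw [zero_smul, add_zero] at key
    rcases key (M.norm_inPoint i) with h | h
    · exact hij (M.inPoint_injective (Subtype.ext h))
    · exact M.inPoint_ne_outPoint _ _ (Subtype.ext h)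
  · rintro rfl
    rw [one_smul, add_sub_cancel] at key
    rcases key (M.norm_outPoint (σ i)) with h | h
    · exact M.inPoint_ne_outPoint _ _ (Subtype.ext h.symm)
    · exact hij (σ.injective (M.outPoint_injective (Subtype.ext h)))

theorem hasDerivAt_straightDiagram (σ : Equiv.Perm (Fin n)) (L : List C(UnitAddCircle, Disc))
    (i : Fin n) {u : ℝ} (hu : u ∈ Set.Ioo (0 : ℝ) 1) :
    HasDerivAt (fun t => ((straightDiagram M σ L).arcCurve i t : ℂ))
      ((M.outPoint (σ i) : ℂ) - M.inPoint i) u := by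
  have h : HasDerivAt (fun t : ℝ => (M.inPoint i : ℂ) + t • ((M.outPoint (σ i) : ℂ) - M.inPoint i))
      ((M.outPoint (σ i) : ℂ) - M.inPoint i) u := by
    simpa using ((hasDerivAt_id u).smul_const
      ((M.outPoint (σ i) : ℂ) - M.inPoint i)).const_add (M.inPoint i : ℂ)
  refine h.congr_of_eventuallyEq ?_
  filter_upwards [Ioo_mem_nhds hu.1 hu.2] with t ht
  exact arcCurve_straightDiagram σ L i (Set.Ioo_subset_Icc_self ht)

theorem straightDiagram_not_arcSelf (σ : Equiv.Perm (Fin n)) (L : List C(UnitAddCircle, Disc))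
    (i : Fin n) {u v : ℝ} (hu : 0 ≤ u) (huv : u < v) (hv : v ≤ 1) :
    (straightDiagram M σ L).arcCurve i u ≠ (straightDiagram M σ L).arcCurve i v := by
  intro h
  have h1 := congrArg Subtype.val h
  rw [arcCurve_straightDiagram σ L i ⟨hu, by linarith⟩,
    arcCurve_straightDiagram σ L i ⟨by linarith, hv⟩] at h1
  exact huv.ne (smul_left_injective ℝ (chord_ne_zero M i (σ i)) (add_left_cancel h1))

theorem straightDiagram_crossing {σ : Equiv.Perm (Fin n)} {L : List C(UnitAddCircle, Disc)}
    {i j : Fin n} {u v : ℝ} (hu : u ∈ Set.Icc (0 : ℝ) 1) (hv : v ∈ Set.Icc (0 : ℝ) 1)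
    (h : (straightDiagram M σ L).arcCurve i u = (straightDiagram M σ L).arcCurve j v) :
    (M.inPoint i : ℂ) + u • ((M.outPoint (σ i) : ℂ) - M.inPoint i) =
      M.inPoint j + v • ((M.outPoint (σ j) : ℂ) - M.inPoint j) := by
  rw [← arcCurve_straightDiagram σ L i hu, ← arcCurve_straightDiagram σ L j hv, h]

/-- Straight chords of the circle cross transversely, and at most once. -/
theorem isGeneric_straightDiagram (σ : Equiv.Perm (Fin n)) :
    (straightDiagram M σ []).IsGeneric := by
  have key : ∀ c : (straightDiagram M σ []).Crossing, ∃ i j u v hij hu hv h,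
      c = .arcArc i j u v hij hu hv h := by
    rintro (⟨i, j, u, v, hij, hu, hv, h⟩ | ⟨i, u, v, hu, huv, hv, h⟩ | ⟨_, k, -⟩ | ⟨k, -⟩ | ⟨k, -⟩)
    · exact ⟨i, j, u, v, hij, hu, hv, h, rfl⟩
    · exact absurd h (straightDiagram_not_arcSelf σ [] i hu huv hv)
    all_goals exact k.elim0
  constructor
  · choose i j u v hij hu hv h hc using key
    refine Finite.of_injective (fun c => (i c, j c)) fun c c' hcc => ?_
    obtain ⟨hi, hj⟩ := Prod.mk.inj hcc
    have e := straightDiagram_crossing (hu c) (hv c) (h c)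
    have e' := straightDiagram_crossing (hu c') (hv c') (h c')
    rw [← hi, ← hj] at e'
    obtain ⟨hu', hv'⟩ := pair_eq_of_smul_add_eq (linearIndependent_chords (hij c).ne e) e e'
    rw [hc c, hc c']
    congr
  · intro c
    obtain ⟨i, j, u, v, hij, hu, hv, h, rfl⟩ := key c
    have e := straightDiagram_crossing hu hv h
    exact ⟨_, _, hasDerivAt_straightDiagram σ [] i (chord_param_mem_Ioo hij.ne hu e),
      hasDerivAt_straightDiagram σ [] j (chord_param_mem_Ioo hij.ne' hv e.symm),
      linearIndependent_chords hij.ne e⟩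

/-! ### The homology of the string complex -/

/-- The differential of the string complex, transported from the permutation complex. -/
def stringD (M : MarkedDisc n) : StringComplex M →ₗ[ZMod 2] StringComplex M :=
  (permEquiv M).symm.toLinearMap ∘ₗ permD n ∘ₗ (permEquiv M).toLinearMap

theorem permEquiv_stringD (x : StringComplex M) :
    permEquiv M (stringD M x) = permD n (permEquiv M x) := by
  simp [stringD]

theorem stringD_stringD (x : StringComplex M) : stringD M (stringD M x) = 0 := by
  refine (permEquiv M).injective ?_
  rw [permEquiv_stringD, permEquiv_stringD, permD_permD, map_zero]

theorem ResolvesCrossings.eq {d d' : StringComplex M →ₗ[ZMod 2] StringComplex M}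
    (h : ResolvesCrossings d) (h' : ResolvesCrossings d') : d = d' :=
  stringComplex_hom_ext fun σ => by
    rw [h _ (isGeneric_straightDiagram σ), h' _ (isGeneric_straightDiagram σ)]

/-- The cycle represented by a combination of chord diagrams. -/
def chordCycle (M : MarkedDisc n) :
    (ChordDiagram n →₀ ZMod 2) →ₗ[ZMod 2] LinearMap.ker (stringD M) :=
  ((permEquiv M).symm.toLinearMap ∘ₗ chordMap n).codRestrict _ fun x => by
    refine (permEquiv M).injective ?_
    rw [permEquiv_stringD, map_zero]
    simp [permD_chordMap]

theorem permEquiv_chordCycle (x : ChordDiagram n →₀ ZMod 2) :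
    permEquiv M (chordCycle M x : StringComplex M) = chordMap n x :=
  (permEquiv M).apply_symm_apply _

theorem homology_equiv (M : MarkedDisc n) :
    Nonempty (Homology (stringD M) ≃ₗ[ZMod 2] ChordSpace n) := by
  obtain ⟨h1, h2⟩ := permSpace_homology n
  let f : (ChordDiagram n →₀ ZMod 2) →ₗ[ZMod 2] Homology (stringD M) :=
    Submodule.mkQ _ ∘ₗ chordCycle M
  have hsurj : Function.Surjective f := by
    intro q
    obtain ⟨x, rfl⟩ := Submodule.mkQ_surjective _ q
    obtain ⟨c, y, hc⟩ := h1 (permEquiv M x) (by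
      rw [← permEquiv_stringD, LinearMap.mem_ker.1 x.2, map_zero])
    refine ⟨c, (Submodule.Quotient.eq _).2 ⟨(permEquiv M).symm y, (permEquiv M).injective ?_⟩⟩
    rw [permEquiv_stringD, LinearEquiv.apply_symm_apply]
    simp only [Submodule.subtype_apply, map_sub, permEquiv_chordCycle, hc]
    rw [eq_sub_iff_add_eq, add_comm, add_assoc, ZModModule.add_self, add_zero]
  have hker : LinearMap.ker f = bypassRelations n := by
    ext c
    have hiff : c ∈ LinearMap.ker f ↔ chordMap n c ∈ LinearMap.range (permD n) := by
      rw [LinearMap.mem_ker]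
      change Submodule.Quotient.mk (chordCycle M c) = 0 ↔ _
      rw [Submodule.Quotient.mk_eq_zero]
      change (∃ y, stringD M y = chordCycle M c) ↔ ∃ y, permD n y = chordMap n c
      constructor
      · rintro ⟨y, hy⟩
        exact ⟨permEquiv M y, by rw [← permEquiv_stringD, hy, permEquiv_chordCycle]⟩
      · rintro ⟨y, hy⟩
        refine ⟨(permEquiv M).symm y, (permEquiv M).injective ?_⟩
        rw [permEquiv_stringD, LinearEquiv.apply_symm_apply, hy, permEquiv_chordCycle]
    rw [hiff]
    exact ⟨h2 c, chordMap_mem_range_of_mem_bypassRelations⟩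
  exact ⟨(f.quotKerEquivOfSurjective hsurj).symm.trans (Submodule.quotEquivOfEq _ _ hker)⟩

end StringHomology
end

noncomputable section
namespace StringHomology
variable {n : ℕ} {M : MarkedDisc n}

/-! ### Counting the crossings of a generic diagram -/

namespace StringDiagram

variable {s : StringDiagram M}

/-- The pair of components that cross: two arcs, or an arc and a closed curve. The crossings whose
resolution creates a closed curve do not matter and are not distinguished from one another. -/
def Crossing.kind : s.Crossing → Option ((Fin n × Fin n) ⊕ (Fin n × Fin s.loops.length))
  | arcArc i j _ _ _ _ _ _ => some (.inl (i, j))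
  | arcSelf _ _ _ _ _ _ _ => none
  | arcLoop i k _ _ _ _ _ => some (.inr (i, k))
  | loopLoop _ _ _ _ _ _ _ _ => none
  | loopSelf _ _ _ _ _ _ _ => none

/-- The class of the resolution of a crossing of the given kind. -/
def resolvedClass (s : StringDiagram M) :
    Option ((Fin n × Fin n) ⊕ (Fin n × Fin s.loops.length)) → StringComplex M
  | none => 0
  | some (.inl p) => (straightDiagram M (s.target * Equiv.swap p.1 p.2) s.loops).toComplex
  | some (.inr p) => (straightDiagram M s.target (s.loops.eraseIdx p.2)).toComplex

theorem toComplex_resolve (c : s.Crossing) : c.resolve.toComplex = s.resolvedClass c.kind := by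
  cases c with
  | arcArc => exact toComplex_eq_straight _
  | arcLoop => exact toComplex_eq_straight _
  | arcSelf => exact toComplex_eq_zero (List.cons_ne_nil _ _)
  | loopLoop => exact toComplex_eq_zero (List.cons_ne_nil _ _)
  | loopSelf => exact toComplex_eq_zero (List.cons_ne_nil _ _)

theorem Crossing.kind_eq_inl {c : s.Crossing} {i j : Fin n} :
    c.kind = some (.inl (i, j)) ↔ ∃ u v hij hu hv h, c = .arcArc i j u v hij hu hv h := by
  constructor
  · intro h
    cases c with
    | arcArc i' j' u v hij hu hv h' =>
      simp only [kind, Option.some.injEq, Sum.inl.injEq, Prod.mk.injEq] at h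
      obtain ⟨rfl, rfl⟩ := h
      exact ⟨u, v, hij, hu, hv, h', rfl⟩
    | _ => simp [kind] at h
  · rintro ⟨u, v, hij, hu, hv, h, rfl⟩
    rfl

theorem Crossing.kind_eq_inr {c : s.Crossing} {i : Fin n} {k : Fin s.loops.length} :
    c.kind = some (.inr (i, k)) ↔ ∃ u v hu hv h, c = .arcLoop i k u v hu hv h := by
  constructor
  · intro h
    cases c with
    | arcLoop i' k' u v hu hv h' =>
      simp only [kind, Option.some.injEq, Sum.inr.injEq, Prod.mk.injEq] at h
      obtain ⟨rfl, rfl⟩ := h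
      exact ⟨u, v, hu, hv, h', rfl⟩
    | _ => simp [kind] at h
  · rintro ⟨u, v, hu, hv, h, rfl⟩
    rfl

/-- The parameters of the two strands of a crossing. -/
def Crossing.params : s.Crossing → ℝ × ℝ
  | arcArc _ _ u v _ _ _ _ => (u, v)
  | arcSelf _ u v _ _ _ _ => (u, v)
  | arcLoop _ _ u v _ _ _ => (u, v)
  | loopLoop _ _ u v _ _ _ _ => (u, v)
  | loopSelf _ u v _ _ _ _ => (u, v)

theorem ltBit_angle (M : MarkedDisc n) (k l : Fin (2 * n)) :
    ltBit (M.angle k) (M.angle l) = ltBit (k : ℕ) (l : ℕ) := by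
  simp only [ltBit, M.strictMono_angle.lt_iff_lt, Fin.lt_def]

/-- Modulo two, the number of crossings of two arcs is determined by their endpoints. -/
theorem card_kind_inl [Fintype s.Crossing] (hs : s.IsGeneric) {i j : Fin n} (hij : i < j) :
    (({c : s.Crossing | c.kind = some (.inl (i, j))} : Finset s.Crossing).card : ZMod 2) =
      chordCross s.target i j := by
  have hinj : Set.InjOn Crossing.params
      (({c : s.Crossing | c.kind = some (.inl (i, j))} : Finset s.Crossing) : Set s.Crossing) := by
    intro c hc c' hc' h
    simp only [Finset.coe_filter, Finset.mem_univ, true_and, Set.mem_ofPred_eq] at hc hc'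
    obtain ⟨u, v, _, _, _, _, rfl⟩ := Crossing.kind_eq_inl.1 hc
    obtain ⟨u', v', _, _, _, _, rfl⟩ := Crossing.kind_eq_inl.1 hc'
    obtain ⟨rfl, rfl⟩ := Prod.mk.inj h
    rfl
  have hangle : ∀ k l : Fin (2 * n), (k : ℕ) ≠ l → M.angle k ≠ M.angle l ∧
      M.angle k < M.angle l + 2 * Real.pi ∧ M.angle l < M.angle k + 2 * Real.pi := fun k l h =>
    ⟨fun h' => h (congrArg Fin.val (M.strictMono_angle.injective h')), M.angle_lt k l,
      M.angle_lt l k⟩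
  have hv : (i : ℕ) ≠ j := fun h => hij.ne (Fin.ext h)
  have hσ : (s.target i : ℕ) ≠ s.target j := fun h =>
    hij.ne (s.target.injective (Fin.ext h))
  rw [← Finset.card_image_of_injOn hinj,
    card_crossings_arc_arc (f := s.arcCurve i) (g := s.arcCurve j)
      (α₀ := M.angle ⟨2 * i, by omega⟩) (α₁ := M.angle ⟨2 * s.target i + 1, by omega⟩)
      (β₀ := M.angle ⟨2 * j, by omega⟩) (β₁ := M.angle ⟨2 * s.target j + 1, by omega⟩)]
  · simp only [ltBit_angle]
    rfl
  · rw [s.arcCurve_zero]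
    rfl
  · rw [s.arcCurve_one]
    rfl
  · rw [s.arcCurve_zero]
    rfl
  · rw [s.arcCurve_one]
    rfl
  · rintro α (rfl | rfl) β (rfl | rfl) <;> apply hangle <;> simp only <;> omega
  · intro z hz
    simp only [Finset.mem_image, Finset.mem_filter, Finset.mem_univ, true_and]
    constructor
    · intro h
      exact ⟨.arcArc i j z.1 z.2 hij hz.1 hz.2 h, rfl, rfl⟩
    · rintro ⟨c, hc, rfl⟩
      obtain ⟨u, v, _, _, _, h, rfl⟩ := Crossing.kind_eq_inl.1 hc
      exact h
  · intro z hz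
    simp only [Finset.mem_image, Finset.mem_filter, Finset.mem_univ, true_and] at hz
    obtain ⟨c, hc, rfl⟩ := hz
    obtain ⟨u, v, _, hu, hv, h, rfl⟩ := Crossing.kind_eq_inl.1 hc
    have ht : TransverseAt (s.arcCurve i) (s.arcCurve j) u v := hs.2 (.arcArc i j u v hij hu hv h)
    exact ⟨⟨ht.mem_Ioo hu, ht.symm.mem_Ioo hv⟩, ht⟩

theorem card_kind_inl_of_not_lt [Fintype s.Crossing] {i j : Fin n} (hij : ¬ i < j) :
    ({c : s.Crossing | c.kind = some (.inl (i, j))} : Finset s.Crossing).card = 0 := by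
  rw [Finset.card_eq_zero, Finset.filter_eq_empty_iff]
  intro c _ hc
  obtain ⟨-, -, h, -⟩ := Crossing.kind_eq_inl.1 hc
  exact hij h

theorem _root_.StringHomology.TransverseAt.add_one {f g : C(ℝ, Disc)} {u v : ℝ}
    (hg : ∀ v, g (v + 1) = g v) (h : TransverseAt f g u v) : TransverseAt f g u (v + 1) := by
  obtain ⟨a, b, ha, hb, hab⟩ := h
  refine ⟨a, b, ha, ?_, hab⟩
  have h1 := HasDerivAt.comp_sub_const (v + 1) 1 (f := fun t => (g t : ℂ)) (f' := b)
    (by rwa [add_sub_cancel_right])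
  have h2 : (fun t => (g t : ℂ)) = fun t => (g (t - 1) : ℂ) := by
    funext t
    rw [← hg (t - 1), sub_add_cancel]
  rwa [h2]

/-- An arc crosses a closed curve an even number of times. -/
theorem card_kind_inr [Fintype s.Crossing] (hs : s.IsGeneric) (i : Fin n)
    (k : Fin s.loops.length) :
    (({c : s.Crossing | c.kind = some (.inr (i, k))} : Finset s.Crossing).card : ZMod 2) = 0 := by
  -- the closed curve is cut open at a parameter `c` at which there is no crossing
  obtain ⟨c, hc, hcv⟩ := (Set.Ioo_infinite (zero_lt_one' ℝ)).exists_notMem_finset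
    (Finset.univ.image fun c : s.Crossing => c.params.2)
  have hcv' : ∀ x : s.Crossing, x.params.2 ≠ c := fun x h =>
    hcv (Finset.mem_image.2 ⟨x, Finset.mem_univ _, h⟩)
  let shift : ℝ × ℝ → ℝ × ℝ := fun z => (z.1, if z.2 < c then z.2 + 1 else z.2)
  have hinj : Set.InjOn (fun x : s.Crossing => shift x.params)
      (({c : s.Crossing | c.kind = some (.inr (i, k))} : Finset s.Crossing) : Set s.Crossing) := by
    intro x hx x' hx' h
    simp only [Finset.coe_filter, Finset.mem_univ, true_and, Set.mem_ofPred_eq] at hx hx'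
    obtain ⟨u, v, _, hv, _, rfl⟩ := Crossing.kind_eq_inr.1 hx
    obtain ⟨u', v', _, hv', _, rfl⟩ := Crossing.kind_eq_inr.1 hx'
    obtain rfl : u = u' := congrArg Prod.fst h
    have h2 : (if v < c then v + 1 else v) = if v' < c then v' + 1 else v' := congrArg Prod.snd h
    obtain rfl : v = v' := by
      by_cases h3 : v < c <;> by_cases h4 : v' < c <;> simp only [h3, h4, ↓reduceIte] at h2 <;>
        linarith [hv.1, hv.2, hv'.1, hv'.2]
    rfl
  rw [← Finset.card_image_of_injOn hinj]
  refine card_crossings_arc_loop (f := s.arcCurve i) (g := s.loopCurve k) (c := c)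
    (by rw [s.arcCurve_zero]; exact M.norm_inPoint i)
    (by rw [s.arcCurve_one]; exact M.norm_outPoint _) (s.loopCurve_add_one k) _ ?_ ?_
  · intro z hz
    simp only [Finset.mem_image, Finset.mem_filter, Finset.mem_univ, true_and]
    obtain ⟨u, v⟩ := z
    obtain ⟨hu, hv1, hv2⟩ := hz
    dsimp only at hu hv1 hv2
    constructor
    · intro h
      rcases lt_or_ge v 1 with h1 | h1
      · refine ⟨.arcLoop i k u v hu ⟨hc.1.le.trans hv1, h1⟩ h, rfl, ?_⟩
        exact Prod.ext rfl (if_neg hv1.not_gt)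
      · have h' : s.arcCurve i u = s.loopCurve k (v - 1) := by
          rw [← s.loopCurve_add_one, sub_add_cancel]
          exact h
        refine ⟨.arcLoop i k u (v - 1) hu ⟨by linarith, by linarith [hc.2]⟩ h', rfl, ?_⟩
        have hne := hcv' (.arcLoop i k u (v - 1) hu ⟨by linarith, by linarith [hc.2]⟩ h')
        have hlt : v - 1 < c := lt_of_le_of_ne (by linarith) hne
        exact Prod.ext rfl ((if_pos hlt).trans (sub_add_cancel v 1))
    · rintro ⟨x, hx, hxz⟩
      obtain ⟨u', v', _, _, h, rfl⟩ := Crossing.kind_eq_inr.1 hx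
      obtain rfl : u' = u := congrArg Prod.fst hxz
      have hv' : (if v' < c then v' + 1 else v') = v := congrArg Prod.snd hxz
      change s.arcCurve i u' = s.loopCurve k v
      rw [← hv']
      split_ifs
      · rwa [s.loopCurve_add_one]
      · exact h
  · intro z hz
    simp only [Finset.mem_image, Finset.mem_filter, Finset.mem_univ, true_and] at hz
    obtain ⟨x, hx, rfl⟩ := hz
    have hxc := hcv' x
    obtain ⟨u, v, hu, hv, h, rfl⟩ := Crossing.kind_eq_inr.1 hx
    have ht : TransverseAt (s.arcCurve i) (s.loopCurve k) u v := hs.2 (.arcLoop i k u v hu hv h)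
    have hu' := ht.mem_Ioo hu
    change v ≠ c at hxc
    change shift (u, v) ∈ _ ∧ TransverseAt _ _ (shift (u, v)).1 (shift (u, v)).2
    rcases lt_or_gt_of_ne hxc with hlt | hlt
    · rw [show shift (u, v) = (u, v + 1) from Prod.ext rfl (if_pos hlt)]
      exact ⟨⟨hu', by dsimp only; linarith [hc.2, hv.1], by dsimp only; linarith⟩,
        ht.add_one (s.loopCurve_add_one k)⟩
    · rw [show shift (u, v) = (u, v) from Prod.ext rfl (if_neg hlt.not_gt)]
      exact ⟨⟨hu', hlt, by dsimp only; linarith [hc.1, hv.2]⟩, ht⟩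

/-- The sum of all resolutions of a generic diagram: only the crossings of different arcs
contribute, and the arcs may be taken to be straight. -/
theorem finsum_toComplex_resolve (hs : s.IsGeneric) :
    ∑ᶠ c : s.Crossing, c.resolve.toComplex =
      ∑ p : Fin n × Fin n with p.1 < p.2, chordCross s.target p.1 p.2 •
        (straightDiagram M (s.target * Equiv.swap p.1 p.2) s.loops).toComplex := by
  have := hs.1
  have := Fintype.ofFinite s.Crossing
  rw [finsum_eq_sum_of_fintype]
  calc ∑ c : s.Crossing, c.resolve.toComplex
      = ∑ κ, ∑ c : s.Crossing with c.kind = κ, s.resolvedClass c.kind := by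
        rw [Finset.sum_fiberwise]
        exact Finset.sum_congr rfl fun c _ => toComplex_resolve c
    _ = ∑ κ, (({c : s.Crossing | c.kind = κ} : Finset s.Crossing).card : ZMod 2) •
          s.resolvedClass κ := by
        refine Finset.sum_congr rfl fun κ _ => ?_
        rw [Nat.cast_smul_eq_nsmul, ← Finset.sum_const]
        exact Finset.sum_congr rfl fun c hc => by rw [(Finset.mem_filter.1 hc).2]
    _ = _ := by
        rw [Fintype.sum_option, Fintype.sum_sum_type, Finset.sum_filter]
        simp only [card_kind_inr hs, zero_smul, Finset.sum_const_zero, add_zero]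
        rw [resolvedClass, smul_zero, zero_add]
        refine Finset.sum_congr rfl fun p _ => ?_
        split_ifs with hp
        · rw [card_kind_inl hs hp, resolvedClass]
        · rw [card_kind_inl_of_not_lt hp, Nat.cast_zero, zero_smul]

end StringDiagram

theorem resolvesCrossings_stringD (M : MarkedDisc n) : ResolvesCrossings (stringD M) := by
  intro s hs
  rw [s.finsum_toComplex_resolve hs]
  by_cases h : s.loops = []
  · rw [s.toComplex_eq_straight, h]
    refine (permEquiv M).injective ?_
    rw [permEquiv_stringD, permEquiv_straight, permD_single, resolveSum, map_sum]
    exact Finset.sum_congr rfl fun p _ => by rw [map_smul, permEquiv_straight]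
  · rw [StringDiagram.toComplex_eq_zero h, map_zero, Finset.sum_eq_zero]
    intro p _
    rw [StringDiagram.toComplex_eq_zero (s := straightDiagram M _ s.loops) h, smul_zero]

end StringHomology
end

theorem mainTheorem5 (n : ℕ) (M : StringHomology.MarkedDisc n) :
    (∃! d : StringHomology.StringComplex M →ₗ[ZMod 2] StringHomology.StringComplex M,
      StringHomology.ResolvesCrossings d) ∧
    ∀ d : StringHomology.StringComplex M →ₗ[ZMod 2] StringHomology.StringComplex M,
      StringHomology.ResolvesCrossings d →
        d ∘ₗ d = 0 ∧
        Nonempty (StringHomology.Homology d ≃ₗ[ZMod 2] StringHomology.ChordSpace n) := by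
  refine ⟨⟨StringHomology.stringD M, StringHomology.resolvesCrossings_stringD M,
    fun d hd => hd.eq (StringHomology.resolvesCrossings_stringD M)⟩, fun d hd => ?_⟩
  obtain rfl := hd.eq (StringHomology.resolvesCrossings_stringD M)
  exact ⟨LinearMap.ext StringHomology.stringD_stringD, StringHomology.homology_equiv M⟩
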